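/- Let $\Bbbk$ be a field of characteristic $0$. A conformal algebra is a $\Bbbk[\partial]$-module with bilinear products $(\cdot\,{}_{(n)}\,\cdot)$, $n\ge 0$, such that for all $a,b$ one has $a_{(n)}b=0$ for $n\gg 0$ and, with $(a_{(\lambda)}b)=\sum_{n\ge0}\frac{\lambda^n}{n!}\,a_{(n)}b$, $(\partial a_{(\lambda)}b)=-\lambda(a_{(\lambda)}b)$ and $(a_{(\lambda)}\partial b)=(\partial+\lambda)(a_{(\lambda)}b)$. It is associative if $(a_{(\lambda)}(b_{(\mu)}c))=((a_{(\lambda)}b)_{(\lambda+\mu)}c)$, and commutative if it is associative and $(a_{(\lambda)}b)=(b_{(-\partial-\lambda)}a)$. For a set $Y$, $\mathrm{ComConf}(Y,N=3)$ is the free commutative conformal algebra generated by $Y$ subject to the locality $x_{(n)}y=0$ for $x,y\in Y$, $n\ge 3$. For a Lie conformal algebra $L$ with a generating set $X$, $U(L;X,N=3)$ is the universal associative conformal envelope of $L$ relative to locality $3$ on $X$: it is the associative conformal algebra that is universal for homomorphisms $\tau$ from $L$ to associative conformal algebras with the commutator $[a_{(\lambda)}b]=(a_{(\lambda)}b)-(b_{(-\partial-\lambda)}a)$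 such that $\tau(x)_{(n)}\tau(y)=0$ for $x,y\in X$, $n\ge3$. It is filtered by degree in $X$ ($F_p$ is the span of all monomials in $X$, formed by $\partial$ and the $n$-products, with at most $p$ factors from $X$), and $\mathrm{gr}\,U=\bigoplus_p F_p/F_{p-1}$ is the associated graded conformal algebra. Let $\mathfrak g$ be a Lie algebra over $\Bbbk$ (of any dimension) with a linear basis $X_1$. (1) Let $\langle\cdot|\cdot\rangle$ be any symmetric invariant bilinear form on $\mathfrak g$ (that is, $\langle[a,b]|c\rangle=\langle a|[b,c]\rangle$). Let $K(\mathfrak g)=(\Bbbk[\partial]\otimes\mathfrak g)\oplus\Bbbk e$, $\partial e=0$, be the Kac–Moody conformal algebra with $[a_{(\lambda)}b]=[a,b]+\lambda\langle a|b\rangle e$ for $a,b\in\mathfrak g$ and $e$ central, and let $X=X_1\cup\{e\}$. Then $$\mathrm{gr}\,U(K(\mathfrak g);X,N=3)\simeq \mathrm{ComConf}(X_1,N=3)\oplus\Bbbk e$$ as conformal algebras, where on the right $\partial e=0$ and all products with $e$ are zero; there is such an isomorphism that maps the degree-one classes of the elements of $X_1$ and of $e$ to the generators $X_1$ of $\mathrm{ComConf}(X_1,N=3)$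 and to $e$, respectively. (2) Let $\mathrm{Cur}\,\mathfrak g=\Bbbk[\partial]\otimes\mathfrak g$ be the current conformal algebra with $[a_{(\lambda)}b]=[a,b]$ for $a,b\in\mathfrak g$. Then $$\mathrm{gr}\,U(\mathrm{Cur}\,\mathfrak g;X_1,N=3)\simeq \mathrm{ComConf}(X_1,N=3)$$ as conformal algebras, by an isomorphism that maps the degree-one classes of the elements of $X_1$ to the generators. -/

import Mathlib

open scoped Polynomial TensorProduct

noncomputable section

namespace Conf

/-! ### Conformal algebras -/

/-- A conformal algebra over a field `k`: a `k[∂]`-module (`del` is the action of `∂`) with bilinear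
`n`-products, `n ≥ 0`, that are local and sesquilinear. In terms of the `λ`-product
`(a (λ) b) = ∑ₙ λⁿ / n! (a (n) b)`, the last two axioms read `(∂a (λ) b) = -λ (a (λ) b)` and
`(a (λ) ∂b) = (∂ + λ) (a (λ) b)`. For `n = 0` the terms with `n - 1` have the coefficient `0`. -/
class ConformalAlgebra (k : Type*) (C : Type*) [Field k] [AddCommGroup C] [Module k C] where
  del : C →ₗ[k] C
  mul : ℕ → C →ₗ[k] C →ₗ[k] C
  locality : ∀ a b : C, ∃ M : ℕ, ∀ n ≥ M, mul n a b = 0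
  mul_del_left : ∀ (n : ℕ) (a b : C), mul n (del a) b = -((n : k) • mul (n - 1) a b)
  mul_del_right : ∀ (n : ℕ) (a b : C),
    mul n a (del b) = del (mul n a b) + (n : k) • mul (n - 1) a b

section Basic

variable (k : Type*) [Field k] {C : Type*} [AddCommGroup C] [Module k C] [ConformalAlgebra k C]

/-- The operator `∂`. -/
def D : C →ₗ[k] C := ConformalAlgebra.del

/-- The product `a (n) b`. -/
def nprod (n : ℕ) : C →ₗ[k] C →ₗ[k] C := ConformalAlgebra.mul n

/-- The `n`-th coefficient of `(b (-∂-λ) a)`, that is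
`∑ₛ (-1)ⁿ⁺ˢ / s! ∂ˢ (b (n+s) a)` (a finite sum by locality). -/
def opp (n : ℕ) (a b : C) : C :=
  ∑ᶠ s : ℕ, ((-1 : k) ^ (n + s) / (s.factorial : k)) • (D k ^ s) (nprod k (n + s) b a)

/-- The commutator `[a (n) b] = a (n) b - ∑ₛ (-1)ⁿ⁺ˢ / s! ∂ˢ (b (n+s) a)`, i.e.
`[a (λ) b] = (a (λ) b) - (b (-∂-λ) a)`. -/
def comm (n : ℕ) (a b : C) : C := nprod k n a b - opp k n a b

/-- Associativity: `(a (λ) (b (μ) c)) = ((a (λ) b) (λ+μ) c)`. -/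
def IsAssoc (C : Type*) [AddCommGroup C] [Module k C] [ConformalAlgebra k C] : Prop :=
  ∀ (n m : ℕ) (a b c : C), nprod k n a (nprod k m b c) =
    ∑ s ∈ Finset.range (n + 1), (n.choose s : k) • nprod k (m + s) (nprod k (n - s) a b) c

/-- Commutativity: `(a (λ) b) = (b (-∂-λ) a)`. -/
def IsCommutative (C : Type*) [AddCommGroup C] [Module k C] [ConformalAlgebra k C] : Prop :=
  ∀ (n : ℕ) (a b : C), nprod k n a b = opp k n a b

/-- The family `x` generates `C` as a conformal algebra. -/
def Generates {ι : Type*} (x : ι → C) : Prop :=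
  ∀ S : Submodule k C, (∀ i, x i ∈ S) → (∀ a ∈ S, D k a ∈ S) →
    (∀ n, ∀ a ∈ S, ∀ b ∈ S, nprod k n a b ∈ S) → S = ⊤

variable {k}

/-- A linear map that is a homomorphism of conformal algebras. -/
def IsHom {C' : Type*} [AddCommGroup C'] [Module k C'] [ConformalAlgebra k C']
    (f : C →ₗ[k] C') : Prop :=
  (∀ a, f (D k a) = D k (f a)) ∧ ∀ n a b, f (nprod k n a b) = nprod k n (f a) (f b)

/-- A linear map from a (Lie) conformal algebra `L` to an associative conformal algebra `A` that is
a homomorphism from `L` to `A` with the commutator products. -/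
def IsLieHom {A : Type*} [AddCommGroup A] [Module k A] [ConformalAlgebra k A]
    (f : C →ₗ[k] A) : Prop :=
  (∀ a, f (D k a) = D k (f a)) ∧ ∀ n a b, f (nprod k n a b) = comm k n (f a) (f b)

theorem nprod_D_left (n : ℕ) (a b : C) :
    nprod k n (D k a) b = -((n : k) • nprod k (n - 1) a b) :=
  ConformalAlgebra.mul_del_left n a b

theorem nprod_D_right (n : ℕ) (a b : C) :
    nprod k n a (D k b) = D k (nprod k n a b) + (n : k) • nprod k (n - 1) a b :=
  ConformalAlgebra.mul_del_right n a b

theorem opp_eq_sum (n M : ℕ) (a b : C) (h : ∀ m ≥ M, nprod k m b a = 0) :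
    opp k n a b = ∑ s ∈ Finset.range M,
      ((-1 : k) ^ (n + s) / (s.factorial : k)) • (D k ^ s) (nprod k (n + s) b a) := by
  unfold opp
  apply finsum_eq_sum_of_support_subset
  intro s hs
  simp only [Finset.coe_range, Set.mem_Iio]
  by_contra hM
  apply hs
  simp [h (n + s) (by omega)]

end Basic

/-! ### Direct sums, and the one-dimensional algebra with trivial structure -/

instance {k : Type*} [Field k] {C C' : Type*} [AddCommGroup C] [Module k C] [ConformalAlgebra k C]
    [AddCommGroup C'] [Module k C'] [ConformalAlgebra k C'] : ConformalAlgebra k (C × C') where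
  del := (D k).prodMap (D k)
  mul n := LinearMap.mk₂ k (fun a b => (nprod k n a.1 b.1, nprod k n a.2 b.2))
    (by intros; simp) (by intros; simp) (by intros; simp) (by intros; simp)
  locality a b := by
    obtain ⟨M, hM⟩ := ConformalAlgebra.locality (k := k) a.1 b.1
    obtain ⟨M', hM'⟩ := ConformalAlgebra.locality (k := k) a.2 b.2
    exact ⟨max M M', fun n hn => Prod.ext (hM n (le_trans (le_max_left _ _) hn))
      (hM' n (le_trans (le_max_right _ _) hn))⟩
  mul_del_left n a b := by simp [nprod_D_left]
  mul_del_right n a b := by simp [nprod_D_right]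

/-- The one-dimensional conformal algebra `k e` with `∂ e = 0` and zero products (`e` is `1 : k`). -/
def TrivialLine (k : Type*) : Type _ := k

instance (k : Type*) [Field k] : AddCommGroup (TrivialLine k) := inferInstanceAs (AddCommGroup k)
instance (k : Type*) [Field k] : Module k (TrivialLine k) := inferInstanceAs (Module k k)
instance (k : Type*) [Field k] : ConformalAlgebra k (TrivialLine k) where
  del := 0
  mul _ := 0
  locality _ _ := ⟨0, fun _ _ => rfl⟩
  mul_del_left _ _ _ := by simp
  mul_del_right _ _ _ := by simp

/-- The basis vector `e` of `k e`. -/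
def TrivialLine.e (k : Type*) [Field k] : TrivialLine k := (1 : k)

/-! ### Conformal algebras given by generators and relations -/

/-- The monomials in the symbols `T` with respect to `∂` and all the `n`-products. -/
inductive Word (T : Type*) : Type _
  | of : T → Word T
  | D : Word T → Word T
  | mul : ℕ → Word T → Word T → Word T

/-- The linear span of the monomials. -/
abbrev Free (k T : Type*) [Field k] : Type _ := Word T →₀ k

namespace Free

variable (k : Type*) [Field k] {T : Type*}

/-- A symbol as an element of the span of the monomials. -/
def of (t : T) : Free k T := Finsupp.single (Word.of t) 1

/-- The operator `∂` on formal combinations of monomials. -/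
def D : Free k T →ₗ[k] Free k T := Finsupp.lmapDomain k k Word.D

/-- The `n`-products on formal combinations of monomials. -/
def mul (n : ℕ) : Free k T →ₗ[k] Free k T →ₗ[k] Free k T :=
  Finsupp.lsum k fun w => LinearMap.toSpanSingleton k _ (Finsupp.lmapDomain k k (Word.mul n w))

theorem mul_single (n : ℕ) (u v : Word T) :
    mul k n (Finsupp.single u 1) (Finsupp.single v 1) = Finsupp.single (Word.mul n u v) 1 := by
  simp [mul]

theorem D_single (u : Word T) :
    D k (Finsupp.single u 1) = Finsupp.single (Word.D u) 1 := by
  simp [D]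

/-- The partial sum `∑_{s < M} (-1)ⁿ⁺ˢ / s! ∂ˢ (b (n+s) a)`. -/
def opp (M n : ℕ) (a b : Free k T) : Free k T :=
  ∑ s ∈ Finset.range M, ((-1 : k) ^ (n + s) / (s.factorial : k)) • (D k ^ s) (mul k (n + s) b a)

end Free

/-- Subspaces `P` of formal combinations of monomials that are stable under `∂` and under products
and contain the identities of sesquilinearity and associativity. -/
structure IsIdeal {k : Type*} [Field k] {T : Type*} (P : Submodule k (Free k T)) : Prop where
  D_mem : ∀ a ∈ P, Free.D k a ∈ P
  mul_mem_left : ∀ n a, ∀ b ∈ P, Free.mul k n a b ∈ P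
  mul_mem_right : ∀ n, ∀ a ∈ P, ∀ b, Free.mul k n a b ∈ P
  sesq_left : ∀ n a b, Free.mul k n (Free.D k a) b + (n : k) • Free.mul k (n - 1) a b ∈ P
  sesq_right : ∀ n a b, Free.mul k n a (Free.D k b)
    - (Free.D k (Free.mul k n a b) + (n : k) • Free.mul k (n - 1) a b) ∈ P
  assoc : ∀ n m a b c, Free.mul k n a (Free.mul k m b c)
    - ∑ s ∈ Finset.range (n + 1),
        (n.choose s : k) • Free.mul k (m + s) (Free.mul k (n - s) a b) c ∈ P

/-- `a` and `b` are local modulo `P`. -/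
def LocalMod {k : Type*} [Field k] {T : Type*} (P : Submodule k (Free k T)) (a b : Free k T) :
    Prop :=
  ∃ M : ℕ, ∀ n ≥ M, Free.mul k n a b ∈ P

/-- The elements obtained from the set `A` by linear combinations, `∂` and products, modulo `P`. -/
inductive GenMod {k : Type*} [Field k] {T : Type*} (P : Submodule k (Free k T))
    (A : Set (Free k T)) : Free k T → Prop
  | of (a) : a ∈ A → GenMod P A a
  | zero : GenMod P A 0
  | add (a b) : GenMod P A a → GenMod P A b → GenMod P A (a + b)
  | smul (c : k) (a) : GenMod P A a → GenMod P A (c • a)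
  | D (a) : GenMod P A a → GenMod P A (Free.D k a)
  | mul (n a b) : GenMod P A a → GenMod P A b → GenMod P A (Free.mul k n a b)
  | congr (a b) : a - b ∈ P → GenMod P A b → GenMod P A a

section Dong

variable {k : Type*} [Field k] {T : Type*} {P : Submodule k (Free k T)} {A : Set (Free k T)}

theorem IsIdeal.mul_congr_left (hP : IsIdeal P) {a a' b : Free k T} {n : ℕ} (h : a - a' ∈ P)
    (h' : Free.mul k n a' b ∈ P) : Free.mul k n a b ∈ P := by
  have := hP.mul_mem_right n _ h b
  simp only [map_sub, LinearMap.sub_apply] at this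
  simpa using P.add_mem this h'

theorem IsIdeal.mul_congr_right (hP : IsIdeal P) {a b b' : Free k T} {n : ℕ} (h : b - b' ∈ P)
    (h' : Free.mul k n a b' ∈ P) : Free.mul k n a b ∈ P := by
  have := hP.mul_mem_left n a _ h
  simp only [map_sub] at this
  simpa using P.add_mem this h'

theorem IsIdeal.D_left (hP : IsIdeal P) {a b : Free k T} (h : LocalMod P a b) :
    LocalMod P (Free.D k a) b := by
  obtain ⟨M, hM⟩ := h
  refine ⟨M + 1, fun n hn => ?_⟩
  have h1 := hP.sesq_left n a b
  have h2 := P.smul_mem (n : k) (hM (n - 1) (by omega))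
  simpa using P.sub_mem h1 h2

theorem IsIdeal.D_right (hP : IsIdeal P) {a b : Free k T} (h : LocalMod P a b) :
    LocalMod P a (Free.D k b) := by
  obtain ⟨M, hM⟩ := h
  refine ⟨M + 1, fun n hn => ?_⟩
  have h1 := hP.sesq_right n a b
  have h2 := P.smul_mem (n : k) (hM (n - 1) (by omega))
  have h3 := hP.D_mem _ (hM n (by omega))
  simpa using P.add_mem h1 (P.add_mem h3 h2)

theorem IsIdeal.mul_left_aux (hP : IsIdeal P) {a b c : Free k T} {M : ℕ}
    (hM : ∀ m ≥ M, Free.mul k m b c ∈ P) (n : ℕ) :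
    ∀ m ≥ M, Free.mul k m (Free.mul k n a b) c ∈ P := by
  induction n using Nat.strong_induction_on with
  | _ n ih =>
    intro m hm
    have h1 := hP.assoc n m a b c
    have h2 := hP.mul_mem_left n a _ (hM m hm)
    have h3 := P.sub_mem h2 h1
    rw [sub_sub_cancel, Finset.sum_range_succ'] at h3
    have h4 : ∑ s ∈ Finset.range n, (n.choose (s + 1) : k) •
        Free.mul k (m + (s + 1)) (Free.mul k (n - (s + 1)) a b) c ∈ P :=
      P.sum_mem fun s hs => P.smul_mem _
        (ih _ (by have := Finset.mem_range.1 hs; omega) _ (by omega))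
    simpa using (P.add_mem_iff_right h4).1 h3

theorem IsIdeal.mul_left (hP : IsIdeal P) {a b c : Free k T} (n : ℕ) (h : LocalMod P b c) :
    LocalMod P (Free.mul k n a b) c := by
  obtain ⟨M, hM⟩ := h
  exact ⟨M, hP.mul_left_aux hM n⟩

theorem IsIdeal.mul_right (hP : IsIdeal P) {a b c : Free k T} (m : ℕ) (h : LocalMod P a b)
    (h' : LocalMod P b c) : LocalMod P a (Free.mul k m b c) := by
  obtain ⟨M, hM⟩ := h
  obtain ⟨M', hM'⟩ := h'
  refine ⟨M + M', fun n hn => ?_⟩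
  have h1 := hP.assoc n m a b c
  refine (P.sub_mem_iff_left (P.sum_mem fun s hs => P.smul_mem _ ?_)).1 h1
  by_cases hs' : M ≤ n - s
  · exact hP.mul_mem_right _ _ (hM _ hs') _
  · exact hP.mul_left_aux hM' _ _ (by omega)

theorem IsIdeal.local_of_gen (hP : IsIdeal P) {b : Free k T} (hb : ∀ a ∈ A, LocalMod P a b)
    {a : Free k T} (ha : GenMod P A a) : LocalMod P a b := by
  induction ha with
  | of a h => exact hb a h
  | zero => exact ⟨0, fun n _ => by simp⟩
  | add a a' _ _ h h' =>
    obtain ⟨M, hM⟩ := h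
    obtain ⟨M', hM'⟩ := h'
    refine ⟨max M M', fun n hn => ?_⟩
    simpa using P.add_mem (hM n (le_trans (le_max_left _ _) hn))
      (hM' n (le_trans (le_max_right _ _) hn))
  | smul c a _ h =>
    obtain ⟨M, hM⟩ := h
    exact ⟨M, fun n hn => by simpa using P.smul_mem c (hM n hn)⟩
  | D a _ h => exact hP.D_left h
  | mul n a a' _ _ _ h => exact hP.mul_left n h
  | congr a a' h _ h' =>
    obtain ⟨M, hM⟩ := h'
    exact ⟨M, fun n hn => hP.mul_congr_left h (hM n hn)⟩

/-- Dong's lemma: if the elements of `A` are mutually local, so are the elements they generate. -/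
theorem IsIdeal.dong (hP : IsIdeal P) (hA : ∀ a ∈ A, ∀ b ∈ A, LocalMod P a b)
    {a b : Free k T} (ha : GenMod P A a) (hb : GenMod P A b) : LocalMod P a b := by
  refine hP.local_of_gen ?_ ha
  clear ha a
  induction hb with
  | of b h => exact fun a ha => hA a ha b h
  | zero => exact fun a _ => ⟨0, fun n _ => by simp⟩
  | add b b' _ _ h h' =>
    intro a ha
    obtain ⟨M, hM⟩ := h a ha
    obtain ⟨M', hM'⟩ := h' a ha
    refine ⟨max M M', fun n hn => ?_⟩
    simpa using P.add_mem (hM n (le_trans (le_max_left _ _) hn))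
      (hM' n (le_trans (le_max_right _ _) hn))
  | smul c b _ h =>
    intro a ha
    obtain ⟨M, hM⟩ := h a ha
    exact ⟨M, fun n hn => by simpa using P.smul_mem c (hM n hn)⟩
  | D b _ h => exact fun a ha => hP.D_right (h a ha)
  | mul n b b' hb _ h h' =>
    exact fun a ha => hP.mul_right n (h a ha) (hP.local_of_gen h' hb)
  | congr b b' h _ h' =>
    intro a ha
    obtain ⟨M, hM⟩ := h' a ha
    exact ⟨M, fun n hn => hP.mul_congr_right h (hM n hn)⟩

/-- If all symbols are generated by `A` modulo `P`, so is everything. -/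
theorem genMod_of_symbols (h : ∀ t, GenMod P A (Free.of k t)) (a : Free k T) : GenMod P A a := by
  have hw : ∀ w : Word T, GenMod P A (Finsupp.single w 1) := by
    intro w
    induction w with
    | of t => exact h t
    | D w ih => simpa [Free.D_single] using GenMod.D _ ih
    | mul n u v hu hv => simpa [Free.mul_single] using GenMod.mul n _ _ hu hv
  induction a using Finsupp.induction_linear with
  | zero => exact GenMod.zero
  | add a b ha hb => exact GenMod.add _ _ ha hb
  | single w c => simpa using GenMod.smul c _ (hw w)

end Dong

section Quotient

variable {k : Type*} [Field k]

/-- A bilinear map on quotients. -/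
def qlift₂ {M N R : Type*} [AddCommGroup M] [Module k M] [AddCommGroup N] [Module k N]
    [AddCommGroup R] [Module k R] (P : Submodule k M) (Q : Submodule k N) (f : M →ₗ[k] N →ₗ[k] R)
    (hP : ∀ a ∈ P, ∀ b, f a b = 0) (hQ : ∀ a, ∀ b ∈ Q, f a b = 0) : (M ⧸ P) →ₗ[k] (N ⧸ Q) →ₗ[k] R :=
  P.liftQ (Q.liftQ f.flip fun b hb => LinearMap.ext fun a => hQ a b hb).flip fun a ha =>
    LinearMap.ext fun b => by
      obtain ⟨b, rfl⟩ := Q.mkQ_surjective b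
      exact hP a ha b

@[simp]
theorem qlift₂_mkQ {M N R : Type*} [AddCommGroup M] [Module k M] [AddCommGroup N] [Module k N]
    [AddCommGroup R] [Module k R] (P : Submodule k M) (Q : Submodule k N) (f : M →ₗ[k] N →ₗ[k] R)
    (hP : ∀ a ∈ P, ∀ b, f a b = 0) (hQ : ∀ a, ∀ b ∈ Q, f a b = 0) (a : M) (b : N) :
    qlift₂ P Q f hP hQ (P.mkQ a) (Q.mkQ b) = f a b := rfl

variable {T : Type*}

/-- The quotient by an ideal modulo which all elements are mutually local. -/
@[reducible]
def quotientAlgebra (P : Submodule k (Free k T)) (hP : IsIdeal P) (h : ∀ a b, LocalMod P a b) :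
    ConformalAlgebra k (Free k T ⧸ P) where
  del := P.mapQ P (Free.D k) hP.D_mem
  mul n := qlift₂ P P ((Free.mul k n).compr₂ P.mkQ)
    (fun a ha b => by simpa using hP.mul_mem_right n a ha b)
    (fun a b hb => by simpa using hP.mul_mem_left n a b hb)
  locality a b := by
    obtain ⟨a, rfl⟩ := P.mkQ_surjective a
    obtain ⟨b, rfl⟩ := P.mkQ_surjective b
    obtain ⟨M, hM⟩ := h a b
    exact ⟨M, fun n hn => (Submodule.Quotient.mk_eq_zero P).2 (hM n hn)⟩
  mul_del_left n a b := by
    obtain ⟨a, rfl⟩ := P.mkQ_surjective a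
    obtain ⟨b, rfl⟩ := P.mkQ_surjective b
    refine (Submodule.Quotient.eq P).2 ?_
    simpa using hP.sesq_left n a b
  mul_del_right n a b := by
    obtain ⟨a, rfl⟩ := P.mkQ_surjective a
    obtain ⟨b, rfl⟩ := P.mkQ_surjective b
    exact (Submodule.Quotient.eq P).2 (hP.sesq_right n a b)

theorem IsIdeal.sInf {S : Set (Submodule k (Free k T))} (h : ∀ P ∈ S, IsIdeal P) :
    IsIdeal (sInf S) where
  D_mem a ha := Submodule.mem_sInf.2 fun P hP =>
    (h P hP).D_mem a (Submodule.mem_sInf.1 ha P hP)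
  mul_mem_left n a b hb := Submodule.mem_sInf.2 fun P hP =>
    (h P hP).mul_mem_left n a b (Submodule.mem_sInf.1 hb P hP)
  mul_mem_right n a ha b := Submodule.mem_sInf.2 fun P hP =>
    (h P hP).mul_mem_right n a (Submodule.mem_sInf.1 ha P hP) b
  sesq_left n a b := Submodule.mem_sInf.2 fun P hP => (h P hP).sesq_left n a b
  sesq_right n a b := Submodule.mem_sInf.2 fun P hP => (h P hP).sesq_right n a b
  assoc n m a b c := Submodule.mem_sInf.2 fun P hP => (h P hP).assoc n m a b c

end Quotient

section Eval

variable {k : Type*} [Field k] {T : Type*} {A : Type*} [AddCommGroup A] [Module k A]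
  [ConformalAlgebra k A]

/-- The value of a monomial in a conformal algebra. -/
def Word.eval (k : Type*) [Field k] {T A : Type*} [AddCommGroup A] [Module k A]
    [ConformalAlgebra k A] (f : T → A) : Word T → A
  | .of t => f t
  | .D w => Conf.D k (w.eval k f)
  | .mul n u v => nprod k n (u.eval k f) (v.eval k f)

/-- The evaluation of formal combinations of monomials. -/
def Free.eval (f : T → A) : Free k T →ₗ[k] A := Finsupp.linearCombination k (Word.eval k f)

@[simp]
theorem Free.eval_of (f : T → A) (t : T) : Free.eval f (Free.of k t) = f t := by
  simp [Free.eval, Free.of, Word.eval]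

@[simp]
theorem Free.eval_D (f : T → A) (a : Free k T) :
    Free.eval f (Free.D k a) = Conf.D k (Free.eval f a) := by
  have : (Free.eval f).comp (Free.D k) = (Conf.D k).comp (Free.eval (k := k) f) := by
    ext w
    simp [Free.eval, Free.D, Word.eval]
  exact LinearMap.congr_fun this a

@[simp]
theorem Free.eval_mul (f : T → A) (n : ℕ) (a b : Free k T) :
    Free.eval f (Free.mul k n a b) = nprod k n (Free.eval f a) (Free.eval f b) := by
  have : (Free.mul k n).compr₂ (Free.eval f) =
      (nprod k n).compl₁₂ (Free.eval (k := k) f) (Free.eval f) := by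
    ext u v
    simp [Free.eval, Free.mul, Word.eval]
  exact LinearMap.congr_fun₂ this a b

@[simp]
theorem Free.eval_D_pow (f : T → A) (s : ℕ) (a : Free k T) :
    Free.eval f ((Free.D k ^ s) a) = (Conf.D k ^ s) (Free.eval f a) := by
  induction s with
  | zero => simp
  | succ s ih => simp only [pow_succ', Module.End.mul_apply, Free.eval_D, ih]

theorem Free.eval_opp (f : T → A) (n M : ℕ) (a b : Free k T)
    (h : ∀ m ≥ M, nprod k m (Free.eval f b) (Free.eval f a) = 0) :
    Free.eval f (Free.opp k M n a b) = Conf.opp k n (Free.eval f a) (Free.eval f b) := by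
  rw [opp_eq_sum n M _ _ h]
  simp [Free.opp]

theorem Free.ker_eval (hA : IsAssoc k A) (f : T → A) :
    IsIdeal (LinearMap.ker (Free.eval (k := k) f)) where
  D_mem a ha := by simp_all
  mul_mem_left n a b hb := by simp_all
  mul_mem_right n a ha b := by simp_all
  sesq_left n a b := by simp [nprod_D_left]
  sesq_right n a b := by simp [nprod_D_right]
  assoc n m a b c := by simp [hA n m]

/-- Two homomorphisms from a quotient of `Free k T` that agree on the symbols are equal. -/
theorem Free.hom_ext {P : Submodule k (Free k T)} (hP : IsIdeal P) (hl : ∀ a b, LocalMod P a b)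
    {φ ψ : (Free k T ⧸ P) →ₗ[k] A}
    (hφ : @IsHom k _ _ _ _ (quotientAlgebra P hP hl) _ _ _ _ φ)
    (hψ : @IsHom k _ _ _ _ (quotientAlgebra P hP hl) _ _ _ _ ψ)
    (h : ∀ t, φ (P.mkQ (Free.of k t)) = ψ (P.mkQ (Free.of k t))) : φ = ψ := by
  have hw : ∀ w : Word T, φ (P.mkQ (Finsupp.single w 1)) = ψ (P.mkQ (Finsupp.single w 1)) := by
    intro w
    induction w with
    | of t => exact h t
    | D w ih =>
      have h1 := hφ.1 (P.mkQ (Finsupp.single w 1))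
      have h2 := hψ.1 (P.mkQ (Finsupp.single w 1))
      rw [ih, ← h2] at h1
      rw [← Free.D_single]
      exact h1
    | mul n u v hu hv =>
      have h1 := hφ.2 n (P.mkQ (Finsupp.single u 1)) (P.mkQ (Finsupp.single v 1))
      have h2 := hψ.2 n (P.mkQ (Finsupp.single u 1)) (P.mkQ (Finsupp.single v 1))
      rw [hu, hv, ← h2] at h1
      rw [← Free.mul_single]
      exact h1
  ext w
  exact hw w

theorem quotientAlgebra_isAssoc {P : Submodule k (Free k T)} (hP : IsIdeal P)
    (hl : ∀ a b, LocalMod P a b) : @IsAssoc k _ _ _ _ (quotientAlgebra P hP hl) := by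
  intro n m a b c
  obtain ⟨a, rfl⟩ := P.mkQ_surjective a
  obtain ⟨b, rfl⟩ := P.mkQ_surjective b
  obtain ⟨c, rfl⟩ := P.mkQ_surjective c
  have h := (Submodule.Quotient.eq P).2 (hP.assoc n m a b c)
  refine h.trans ?_
  rw [← Submodule.mkQ_apply, map_sum]
  rfl

theorem quotientAlgebra_opp {P : Submodule k (Free k T)} (hP : IsIdeal P)
    (hl : ∀ a b, LocalMod P a b) (n M : ℕ) (a b : Free k T)
    (h : ∀ m ≥ M, Free.mul k m b a ∈ P) :
    @Conf.opp k _ _ _ _ (quotientAlgebra P hP hl) n (P.mkQ a) (P.mkQ b) =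
      P.mkQ (Free.opp k M n a b) := by
  let _ := quotientAlgebra P hP hl
  rw [opp_eq_sum n M _ _ fun m hm => (Submodule.Quotient.mk_eq_zero P).2 (h m hm)]
  rw [Free.opp, map_sum]
  refine Finset.sum_congr rfl fun s _ => ?_
  rw [map_smul]
  congr 1
  have : ∀ u, (Conf.D k ^ s) (P.mkQ u) = P.mkQ ((Free.D k ^ s) u) := by
    intro u
    clear * -
    induction s with
    | zero => rfl
    | succ s ih =>
      rw [pow_succ', pow_succ', Module.End.mul_apply, Module.End.mul_apply, ih]
      rfl
  exact this _

end Eval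

/-! ### The free commutative conformal algebra -/

section ComConf

variable (k : Type*) [Field k] {Y : Type*} (N : Y → Y → ℕ)

/-- The ideals that contain all relations of an associative commutative conformal algebra with
generators `Y` such that `x (n) y = 0` for `n ≥ N x y`. Commutativity is imposed on `a`, `b` with
`b (m) a = 0` for `m ≥ M`; such an `M` exists for all `a`, `b` by `comConfIdeal_local`. -/
structure IsComConfIdeal (P : Submodule k (Free k Y)) : Prop extends IsIdeal P where
  loc : ∀ x y, ∀ n ≥ N x y, Free.mul k n (Free.of k x) (Free.of k y) ∈ P
  comm : ∀ n M a b, (∀ m ≥ M, Free.mul k m b a ∈ P) →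
    Free.mul k n a b - Free.opp k M n a b ∈ P

/-- The smallest ideal that contains the relations. -/
def comConfIdeal : Submodule k (Free k Y) := sInf {P | IsComConfIdeal k N P}

theorem comConfIdeal_spec : IsComConfIdeal k N (comConfIdeal k N) where
  toIsIdeal := IsIdeal.sInf fun _ hP => hP.toIsIdeal
  loc x y n hn := Submodule.mem_sInf.2 fun _ hP => hP.loc x y n hn
  comm n M a b h := Submodule.mem_sInf.2 fun P hP =>
    hP.comm n M a b fun m hm => Submodule.mem_sInf.1 (h m hm) P hP

theorem comConfIdeal_local (a b : Free k Y) : LocalMod (comConfIdeal k N) a b := by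
  have h := comConfIdeal_spec k N
  have hg := genMod_of_symbols (P := comConfIdeal k N) (A := Set.range (Free.of k))
    fun t => GenMod.of _ ⟨t, rfl⟩
  refine h.toIsIdeal.dong ?_ (hg a) (hg b)
  rintro _ ⟨x, rfl⟩ _ ⟨y, rfl⟩
  exact ⟨N x y, h.loc x y⟩

/-- `ComConf(Y, N)`: the free (associative) commutative conformal algebra generated by `Y` with the
locality function `N`. -/
def ComConf : Type _ := Free k Y ⧸ comConfIdeal k N

instance : AddCommGroup (ComConf k N) := inferInstanceAs (AddCommGroup (Free k Y ⧸ comConfIdeal k N))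
instance : Module k (ComConf k N) := inferInstanceAs (Module k (Free k Y ⧸ comConfIdeal k N))
instance : ConformalAlgebra k (ComConf k N) :=
  quotientAlgebra (comConfIdeal k N) (comConfIdeal_spec k N).toIsIdeal (comConfIdeal_local k N)

/-- The generators of `ComConf(Y, N)`. -/
def ComConf.gen (y : Y) : ComConf k N := (comConfIdeal k N).mkQ (Free.of k y)

theorem ComConf.isAssoc : IsAssoc k (ComConf k N) :=
  quotientAlgebra_isAssoc (comConfIdeal_spec k N).toIsIdeal (comConfIdeal_local k N)

theorem ComConf.isCommutative : IsCommutative k (ComConf k N) := by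
  intro n a b
  obtain ⟨a, rfl⟩ := (comConfIdeal k N).mkQ_surjective a
  obtain ⟨b, rfl⟩ := (comConfIdeal k N).mkQ_surjective b
  obtain ⟨M, hM⟩ := comConfIdeal_local k N b a
  exact ((Submodule.Quotient.eq _).2 ((comConfIdeal_spec k N).comm n M a b hM)).trans
    (quotientAlgebra_opp (comConfIdeal_spec k N).toIsIdeal (comConfIdeal_local k N) n M a b hM).symm

theorem ComConf.gen_local (x y : Y) (n : ℕ) (hn : N x y ≤ n) :
    nprod k n (ComConf.gen k N x) (ComConf.gen k N y) = 0 :=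
  (Submodule.Quotient.mk_eq_zero _).2 ((comConfIdeal_spec k N).loc x y n hn)

/-- The universal property of `ComConf(Y, N)`. -/
theorem ComConf.existsUnique_hom {A : Type*} [AddCommGroup A] [Module k A] [ConformalAlgebra k A]
    (hA : IsAssoc k A) (hc : IsCommutative k A) (f : Y → A)
    (hf : ∀ x y, ∀ n ≥ N x y, nprod k n (f x) (f y) = 0) :
    ∃! φ : ComConf k N →ₗ[k] A, IsHom φ ∧ ∀ y, φ (ComConf.gen k N y) = f y := by
  have hker : IsComConfIdeal k N (LinearMap.ker (Free.eval (k := k) f)) :=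
    { toIsIdeal := Free.ker_eval hA f
      loc := fun x y n hn => by simpa using hf x y n hn
      comm := fun n M a b h => by
        simp only [LinearMap.mem_ker, Free.eval_mul] at h
        simp [Free.eval_opp f n M a b h, hc n] }
  have hle : comConfIdeal k N ≤ LinearMap.ker (Free.eval (k := k) f) := sInf_le hker
  refine ⟨(comConfIdeal k N).liftQ (Free.eval f) hle, ⟨⟨fun a => ?_, fun n a b => ?_⟩, fun y => ?_⟩,
    fun ψ hψ => ?_⟩
  · obtain ⟨a, rfl⟩ := (comConfIdeal k N).mkQ_surjective a
    exact Free.eval_D f a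
  · obtain ⟨a, rfl⟩ := (comConfIdeal k N).mkQ_surjective a
    obtain ⟨b, rfl⟩ := (comConfIdeal k N).mkQ_surjective b
    exact Free.eval_mul f n a b
  · exact Free.eval_of f y
  · refine Free.hom_ext (comConfIdeal_spec k N).toIsIdeal (comConfIdeal_local k N) hψ.1
      ⟨fun a => ?_, fun n a b => ?_⟩ fun y => (hψ.2 y).trans (Free.eval_of f y).symm
    · obtain ⟨a, rfl⟩ := (comConfIdeal k N).mkQ_surjective a
      exact Free.eval_D f a
    · obtain ⟨a, rfl⟩ := (comConfIdeal k N).mkQ_surjective a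
      obtain ⟨b, rfl⟩ := (comConfIdeal k N).mkQ_surjective b
      exact Free.eval_mul f n a b

end ComConf

/-! ### Universal associative conformal envelopes -/

section Envelope

variable (k : Type*) [Field k] {L : Type*} [AddCommGroup L] [Module k L] [ConformalAlgebra k L]
  {ι : Type*} (x : ι → L) (N : ι → ι → ℕ)

/-- The ideals that contain all relations which say that `L` maps to an associative conformal
algebra, as a homomorphism with respect to the commutator, in such a way that the images of
`x i`, `x j` have locality at most `N i j`. The bracket relation is imposed on `a`, `b` with
`b (m) a = 0` for `m ≥ M`; such an `M` exists for all `a`, `b` by `envelopeIdeal_local`. -/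
structure IsEnvelopeIdeal (P : Submodule k (Free k L)) : Prop extends IsIdeal P where
  of_add : ∀ a b : L, Free.of k (a + b) - (Free.of k a + Free.of k b) ∈ P
  of_smul : ∀ (c : k) (a : L), Free.of k (c • a) - c • Free.of k a ∈ P
  of_D : ∀ a : L, Free.of k (D k a) - Free.D k (Free.of k a) ∈ P
  of_bracket : ∀ n M (a b : L), (∀ m ≥ M, Free.mul k m (Free.of k b) (Free.of k a) ∈ P) →
    Free.of k (nprod k n a b) - (Free.mul k n (Free.of k a) (Free.of k b)
      - Free.opp k M n (Free.of k a) (Free.of k b)) ∈ P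
  loc : ∀ i j, ∀ n ≥ N i j, Free.mul k n (Free.of k (x i)) (Free.of k (x j)) ∈ P

/-- The smallest ideal that contains the relations. -/
def envelopeIdeal : Submodule k (Free k L) := sInf {P | IsEnvelopeIdeal k x N P}

theorem envelopeIdeal_spec : IsEnvelopeIdeal k x N (envelopeIdeal k x N) where
  toIsIdeal := IsIdeal.sInf fun _ hP => hP.toIsIdeal
  of_add a b := Submodule.mem_sInf.2 fun _ hP => hP.of_add a b
  of_smul c a := Submodule.mem_sInf.2 fun _ hP => hP.of_smul c a
  of_D a := Submodule.mem_sInf.2 fun _ hP => hP.of_D a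
  of_bracket n M a b h := Submodule.mem_sInf.2 fun P hP =>
    hP.of_bracket n M a b fun m hm => Submodule.mem_sInf.1 (h m hm) P hP
  loc i j n hn := Submodule.mem_sInf.2 fun _ hP => hP.loc i j n hn

variable {x}

theorem envelopeIdeal_local (hx : Generates k x) (a b : Free k L) :
    LocalMod (envelopeIdeal k x N) a b := by
  have h := envelopeIdeal_spec k x N
  set P := envelopeIdeal k x N
  set A : Set (Free k L) := Set.range fun i => Free.of k (x i)
  have hA : ∀ a ∈ A, ∀ b ∈ A, LocalMod P a b := by
    rintro _ ⟨i, rfl⟩ _ ⟨j, rfl⟩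
    exact ⟨N i j, h.loc i j⟩
  let S : Submodule k L :=
    { carrier := {a | GenMod P A (Free.of k a)}
      add_mem' := fun ha hb => GenMod.congr _ _ (h.of_add _ _) (GenMod.add _ _ ha hb)
      zero_mem' := by
        refine GenMod.congr _ _ ?_ GenMod.zero
        simpa using h.of_smul 0 0
      smul_mem' := fun c a ha => GenMod.congr _ _ (h.of_smul _ _) (GenMod.smul _ _ ha) }
  have hS : S = ⊤ := by
    refine hx S (fun i => GenMod.of _ ⟨i, rfl⟩)
      (fun a ha => GenMod.congr _ _ (h.of_D a) (GenMod.D _ ha)) fun n a ha b hb => ?_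
    obtain ⟨M, hM⟩ := h.toIsIdeal.dong hA hb ha
    refine GenMod.congr _ _ (h.of_bracket n M a b hM) ?_
    rw [sub_eq_add_neg, ← neg_one_smul k]
    refine GenMod.add _ _ (GenMod.mul _ _ _ ha hb) (GenMod.smul _ _ ?_)
    unfold Free.opp
    refine Finset.sum_induction _ (GenMod P A) (fun _ _ => GenMod.add _ _) GenMod.zero ?_
    intro s _
    refine GenMod.smul _ _ ?_
    have hD : ∀ (s : ℕ) (u : Free k L), GenMod P A u → GenMod P A ((Free.D k ^ s) u) := by
      intro s
      induction s with
      | zero => intro u hu; simpa using hu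
      | succ s ih => intro u hu; rw [pow_succ']; exact GenMod.D _ (ih u hu)
    exact hD _ _ (GenMod.mul _ _ _ hb ha)
  have hg := genMod_of_symbols (P := P) (A := A) fun t => (hS ▸ Submodule.mem_top : t ∈ S)
  exact h.toIsIdeal.dong hA (hg a) (hg b)

/-- `U(L; X, N)`: the universal associative conformal envelope of a Lie conformal algebra `L` with
the generating family `X = (x i)`, relative to the locality function `N` on `X`. -/
def Envelope (_hx : Generates k x) : Type _ := Free k L ⧸ envelopeIdeal k x N

variable (hx : Generates k x)

instance : AddCommGroup (Envelope k N hx) :=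
  inferInstanceAs (AddCommGroup (Free k L ⧸ envelopeIdeal k x N))
instance : Module k (Envelope k N hx) :=
  inferInstanceAs (Module k (Free k L ⧸ envelopeIdeal k x N))
instance : ConformalAlgebra k (Envelope k N hx) :=
  quotientAlgebra (envelopeIdeal k x N) (envelopeIdeal_spec k x N).toIsIdeal
    (envelopeIdeal_local k N hx)

/-- The canonical map from `L` to its universal envelope. -/
def Envelope.ofL : L →ₗ[k] Envelope k N hx where
  toFun a := (envelopeIdeal k x N).mkQ (Free.of k a)
  map_add' a b := (Submodule.Quotient.eq _).2 ((envelopeIdeal_spec k x N).of_add a b)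
  map_smul' c a := (Submodule.Quotient.eq _).2 ((envelopeIdeal_spec k x N).of_smul c a)

theorem Envelope.isAssoc : IsAssoc k (Envelope k N hx) :=
  quotientAlgebra_isAssoc (envelopeIdeal_spec k x N).toIsIdeal (envelopeIdeal_local k N hx)

theorem Envelope.ofL_isLieHom : IsLieHom (Envelope.ofL k N hx) := by
  refine ⟨fun a => (Submodule.Quotient.eq _).2 ((envelopeIdeal_spec k x N).of_D a),
    fun n a b => ?_⟩
  obtain ⟨M, hM⟩ := envelopeIdeal_local k N hx (Free.of k b) (Free.of k a)
  have h := (Submodule.Quotient.eq _).2 ((envelopeIdeal_spec k x N).of_bracket n M a b hM)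
  refine h.trans ?_
  rw [← Submodule.mkQ_apply, map_sub,
    ← quotientAlgebra_opp (envelopeIdeal_spec k x N).toIsIdeal (envelopeIdeal_local k N hx) n M
      _ _ hM]
  rfl

theorem Envelope.ofL_local (i j : ι) (n : ℕ) (hn : N i j ≤ n) :
    nprod k n (Envelope.ofL k N hx (x i)) (Envelope.ofL k N hx (x j)) = 0 :=
  (Submodule.Quotient.mk_eq_zero _).2 ((envelopeIdeal_spec k x N).loc i j n hn)

/-- The universal property of `U(L; X, N)`. -/
theorem Envelope.existsUnique_hom {A : Type*} [AddCommGroup A] [Module k A] [ConformalAlgebra k A]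
    (hA : IsAssoc k A) (τ : L →ₗ[k] A) (hτ : IsLieHom τ)
    (hN : ∀ i j, ∀ n ≥ N i j, nprod k n (τ (x i)) (τ (x j)) = 0) :
    ∃! φ : Envelope k N hx →ₗ[k] A, IsHom φ ∧ ∀ a, φ (Envelope.ofL k N hx a) = τ a := by
  have hker : IsEnvelopeIdeal k x N (LinearMap.ker (Free.eval (k := k) τ)) :=
    { toIsIdeal := Free.ker_eval hA τ
      of_add := fun a b => by simp
      of_smul := fun c a => by simp
      of_D := fun a => by simp [hτ.1]
      of_bracket := fun n M a b h => by
        simp only [LinearMap.mem_ker, Free.eval_mul] at h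
        simp [Free.eval_opp τ n M _ _ h, hτ.2, comm]
      loc := fun i j n hn => by simpa using hN i j n hn }
  have hle : envelopeIdeal k x N ≤ LinearMap.ker (Free.eval (k := k) τ) := sInf_le hker
  refine ⟨(envelopeIdeal k x N).liftQ (Free.eval τ) hle,
    ⟨⟨fun a => ?_, fun n a b => ?_⟩, fun y => ?_⟩, fun ψ hψ => ?_⟩
  · obtain ⟨a, rfl⟩ := (envelopeIdeal k x N).mkQ_surjective a
    exact Free.eval_D τ a
  · obtain ⟨a, rfl⟩ := (envelopeIdeal k x N).mkQ_surjective a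
    obtain ⟨b, rfl⟩ := (envelopeIdeal k x N).mkQ_surjective b
    exact Free.eval_mul τ n a b
  · exact Free.eval_of τ y
  · refine Free.hom_ext (envelopeIdeal_spec k x N).toIsIdeal (envelopeIdeal_local k N hx) hψ.1
      ⟨fun a => ?_, fun n a b => ?_⟩ fun y => (hψ.2 y).trans (Free.eval_of _ y).symm
    · obtain ⟨a, rfl⟩ := (envelopeIdeal k x N).mkQ_surjective a
      exact Free.eval_D τ a
    · obtain ⟨a, rfl⟩ := (envelopeIdeal k x N).mkQ_surjective a
      obtain ⟨b, rfl⟩ := (envelopeIdeal k x N).mkQ_surjective b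
      exact Free.eval_mul τ n a b

end Envelope

/-! ### Current and Kac–Moody conformal algebras -/

section KacMoody

open Polynomial

variable (k : Type*) [Field k]

/-- The coefficient of `λⁿ / n!` in `f(-λ) h(∂ + λ)`. As the coefficient of `λᵐ` in `h(∂ + λ)` is
`h⁽ᵐ⁾(∂) / m!`, it is `∑ᵢ (-1)ⁱ n! / (n-i)! fᵢ h⁽ⁿ⁻ⁱ⁾`. -/
def polyMul (n : ℕ) : k[X] →ₗ[k] k[X] →ₗ[k] k[X] :=
  ∑ i ∈ Finset.range (n + 1), ((-1 : k) ^ i * (n.descFactorial i : k)) •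
    (lcoeff k i).smulRight (derivative ^ (n - i) : k[X] →ₗ[k] k[X])

theorem polyMul_apply (n : ℕ) (f h : k[X]) : polyMul k n f h =
    ∑ i ∈ Finset.range (n + 1), ((-1 : k) ^ i * (n.descFactorial i : k) * f.coeff i) •
      derivative^[n - i] h := by
  simp [polyMul, LinearMap.sum_apply, smul_smul, Module.End.pow_apply]

theorem polyMul_X_left (n : ℕ) (f h : k[X]) :
    polyMul k n (X * f) h = -((n : k) • polyMul k (n - 1) f h) := by
  rw [polyMul_apply, polyMul_apply, Finset.sum_range_succ']
  cases n with
  | zero => simp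
  | succ n =>
    simp only [coeff_X_mul, Nat.succ_descFactorial_succ, coeff_X_mul_zero, Nat.add_sub_cancel,
      mul_zero, zero_smul, add_zero, Finset.smul_sum, ← Finset.sum_neg_distrib]
    refine Finset.sum_congr rfl fun i _ => ?_
    rw [smul_smul, ← neg_smul, Nat.add_sub_add_right]
    congr 1
    push_cast
    ring

theorem iterate_derivative_X_mul' (m : ℕ) (h : k[X]) :
    derivative^[m] (X * h) = X * derivative^[m] h + (m : k) • derivative^[m - 1] h := by
  induction m with
  | zero => simp
  | succ m ih =>
    rw [Function.iterate_succ_apply', ih, derivative_add, derivative_mul, derivative_smul]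
    cases m with
    | zero => simp [add_comm]
    | succ m =>
      simp only [Nat.add_sub_cancel, ← Function.iterate_succ_apply' derivative, derivative_X,
        one_mul, Nat.succ_eq_add_one]
      push_cast
      module

theorem polyMul_X_right (n : ℕ) (f h : k[X]) :
    polyMul k n f (X * h) = X * polyMul k n f h + (n : k) • polyMul k (n - 1) f h := by
  rw [polyMul_apply, polyMul_apply, polyMul_apply]
  simp only [iterate_derivative_X_mul', smul_add, Finset.sum_add_distrib, Finset.mul_sum,
    mul_smul_comm]
  congr 1
  cases n with
  | zero => simp
  | succ n =>
    rw [Finset.sum_range_succ]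
    simp only [Nat.sub_self, Nat.cast_zero, zero_smul, smul_zero, add_zero, Nat.add_sub_cancel,
      Finset.smul_sum, smul_smul]
    refine Finset.sum_congr rfl fun i hi => ?_
    have hi' : i ≤ n := Nat.lt_succ_iff.1 (Finset.mem_range.1 hi)
    have e : n + 1 - i - 1 = n - i := by omega
    rw [e]
    congr 1
    have h1 : ((n + 1).descFactorial i : k) * ((n + 1 - i : ℕ) : k)
        = ((n + 1 : ℕ) : k) * (n.descFactorial i : k) := by
      rw [← Nat.cast_mul, ← Nat.cast_mul, mul_comm, ← Nat.descFactorial_succ,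
        Nat.succ_descFactorial_succ]
    linear_combination ((-1 : k) ^ i * f.coeff i) * h1

theorem polyMul_local (f h : k[X]) : ∃ M : ℕ, ∀ n ≥ M, polyMul k n f h = 0 := by
  refine ⟨f.natDegree + h.natDegree + 1, fun n hn => ?_⟩
  rw [polyMul_apply]
  refine Finset.sum_eq_zero fun i _ => ?_
  by_cases hi : f.natDegree < i
  · simp [coeff_eq_zero_of_natDegree_lt hi]
  · rw [iterate_derivative_eq_zero (by omega), smul_zero]

variable (g : Type*) [LieRing g] [LieAlgebra k g]

/-- The action of `∂` on `k[∂] ⊗ g`. -/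
def curD : (k[X] ⊗[k] g) →ₗ[k] (k[X] ⊗[k] g) :=
  TensorProduct.map (LinearMap.mulLeft k X) LinearMap.id

/-- The `n`-products on `k[∂] ⊗ g` with `(a (λ) b) = [a, b]` for `a, b ∈ g`: by sesquilinearity,
`(f(∂)a (λ) h(∂)b) = f(-λ) h(∂ + λ) [a, b]`. -/
def curMul (n : ℕ) : (k[X] ⊗[k] g) →ₗ[k] (k[X] ⊗[k] g) →ₗ[k] (k[X] ⊗[k] g) :=
  TensorProduct.map₂ (polyMul k n) (LieModule.toEnd k g g : g →ₗ[k] g →ₗ[k] g)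

theorem tensor_ind₂ {p : (k[X] ⊗[k] g) → (k[X] ⊗[k] g) → Prop}
    (h0 : ∀ v, p 0 v) (h0' : ∀ u, p u 0) (ht : ∀ f a h b, p (f ⊗ₜ a) (h ⊗ₜ b))
    (ha : ∀ u u' v, p u v → p u' v → p (u + u') v) (ha' : ∀ u v v', p u v → p u v' → p u (v + v'))
    (u v) : p u v := by
  induction u using TensorProduct.induction_on with
  | zero => exact h0 v
  | add u u' hu hu' => exact ha _ _ _ hu hu'
  | tmul f a =>
    induction v using TensorProduct.induction_on with
    | zero => exact h0' _
    | add v v' hv hv' => exact ha' _ _ _ hv hv'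
    | tmul h b => exact ht f a h b

theorem curMul_local (u v : k[X] ⊗[k] g) : ∃ M : ℕ, ∀ n ≥ M, curMul k g n u v = 0 := by
  refine tensor_ind₂ k g (p := fun u v => ∃ M : ℕ, ∀ n ≥ M, curMul k g n u v = 0)
    ?_ ?_ ?_ ?_ ?_ u v
  · exact fun v => ⟨0, fun n _ => by simp⟩
  · exact fun v => ⟨0, fun n _ => by simp⟩
  · intro f a h b
    obtain ⟨M, hM⟩ := polyMul_local k f h
    exact ⟨M, fun n hn => by simp [curMul, hM n hn]⟩
  · rintro u u' v ⟨M, hM⟩ ⟨M', hM'⟩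
    refine ⟨max M M', fun n hn => ?_⟩
    simp [hM n (le_trans (le_max_left _ _) hn), hM' n (le_trans (le_max_right _ _) hn)]
  · rintro u u' v ⟨M, hM⟩ ⟨M', hM'⟩
    refine ⟨max M M', fun n hn => ?_⟩
    simp [hM n (le_trans (le_max_left _ _) hn), hM' n (le_trans (le_max_right _ _) hn)]

theorem curMul_D_left (n : ℕ) (u v : k[X] ⊗[k] g) :
    curMul k g n (curD k g u) v = -((n : k) • curMul k g (n - 1) u v) := by
  refine tensor_ind₂ k g (p := fun u v =>
    curMul k g n (curD k g u) v = -((n : k) • curMul k g (n - 1) u v)) ?_ ?_ ?_ ?_ ?_ u v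
  · simp
  · simp
  · intro f a h b
    simp [curMul, curD, polyMul_X_left, TensorProduct.neg_tmul, TensorProduct.smul_tmul']
  · intro u u' v hu hu'
    simp only [map_add, LinearMap.add_apply, hu, hu']
    module
  · intro u u' v hu hu'
    simp only [map_add, hu, hu']
    module

theorem curMul_D_right (n : ℕ) (u v : k[X] ⊗[k] g) : curMul k g n u (curD k g v) =
    curD k g (curMul k g n u v) + (n : k) • curMul k g (n - 1) u v := by
  refine tensor_ind₂ k g (p := fun u v => curMul k g n u (curD k g v) =
    curD k g (curMul k g n u v) + (n : k) • curMul k g (n - 1) u v) ?_ ?_ ?_ ?_ ?_ u v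
  · simp
  · simp
  · intro f a h b
    simp [curMul, curD, polyMul_X_right, TensorProduct.add_tmul, TensorProduct.smul_tmul']
  · intro u u' v hu hu'
    simp only [map_add, LinearMap.add_apply, hu, hu']
    module
  · intro u u' v hu hu'
    simp only [map_add, hu, hu']
    module

/-- The current conformal algebra `Cur g = k[∂] ⊗ g` with `[a (λ) b] = [a, b]` for `a, b ∈ g`. -/
def Cur : Type _ := k[X] ⊗[k] g

instance : AddCommGroup (Cur k g) := inferInstanceAs (AddCommGroup (k[X] ⊗[k] g))
instance : Module k (Cur k g) := inferInstanceAs (Module k (k[X] ⊗[k] g))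
instance : ConformalAlgebra k (Cur k g) where
  del := curD k g
  mul n := curMul k g n
  locality := curMul_local k g
  mul_del_left := curMul_D_left k g
  mul_del_right := curMul_D_right k g

/-- The elements of `g` in `Cur g`. -/
def Cur.of : g →ₗ[k] Cur k g := TensorProduct.mk k k[X] g 1

variable {k g}

theorem span_curD_eq_top {ι : Type*} (X₁ : Module.Basis ι k g) (S : Submodule k (k[X] ⊗[k] g))
    (h : ∀ i, (1 : k[X]) ⊗ₜ[k] X₁ i ∈ S) (hD : ∀ u ∈ S, curD k g u ∈ S) : S = ⊤ := by
  have h1 : ∀ a : g, (1 : k[X]) ⊗ₜ[k] a ∈ S := by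
    intro a
    have : (⊤ : Submodule k g) ≤ S.comap (TensorProduct.mk k k[X] g 1) := by
      rw [← X₁.span_eq, Submodule.span_le]
      rintro _ ⟨i, rfl⟩
      exact h i
    exact this (Submodule.mem_top (x := a))
  rw [eq_top_iff]
  rintro u -
  induction u using TensorProduct.induction_on with
  | zero => exact S.zero_mem
  | add u v hu hv => exact S.add_mem hu hv
  | tmul f a =>
    induction f using Polynomial.induction_on with
    | C c =>
      rw [show (C c : k[X]) = c • 1 by simp [smul_eq_C_mul], ← TensorProduct.smul_tmul']
      exact S.smul_mem _ (h1 a)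
    | add f h hf hh => rw [TensorProduct.add_tmul]; exact S.add_mem hf hh
    | monomial n c hc =>
      have := hD _ hc
      rw [curD, TensorProduct.map_tmul] at this
      have e : (C c * X ^ (n + 1) : k[X]) = X * (C c * X ^ n) := by ring
      rw [e]
      exact this

theorem Cur.generates {ι : Type*} (X₁ : Module.Basis ι k g) :
    Generates k fun i => Cur.of k g (X₁ i) :=
  fun S h hD _ => span_curD_eq_top X₁ S h hD

variable (k g)

/-- The `e`-component of the `n`-products on `K(g)`: since `(a (λ) b) = [a, b] + λ ⟨a|b⟩ e` for
`a, b ∈ g` and `∂ e = 0`, it is the coefficient of `λⁿ / n!` in `λ f(-λ) h(λ) ⟨a|b⟩` for `f(∂)a`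
and `h(∂)b`. -/
def kmForm (form : LinearMap.BilinForm k g) (n : ℕ) :
    (k[X] ⊗[k] g) →ₗ[k] (k[X] ⊗[k] g) →ₗ[k] k :=
  (n : k) • (TensorProduct.map₂ ((polyMul k (n - 1)).compr₂ (leval 0)) form).compr₂
    (TensorProduct.lid k k : k ⊗[k] k →ₗ[k] k)

variable {k g}

theorem kmForm_tmul (form : LinearMap.BilinForm k g) (n : ℕ) (f h : k[X]) (a b : g) :
    kmForm k g form n (f ⊗ₜ a) (h ⊗ₜ b) =
      (n : k) * ((polyMul k (n - 1) f h).eval 0 * form a b) := by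
  simp [kmForm, leval]

theorem kmForm_local (form : LinearMap.BilinForm k g) (u v : k[X] ⊗[k] g) :
    ∃ M : ℕ, ∀ n ≥ M, kmForm k g form n u v = 0 := by
  refine tensor_ind₂ k g (p := fun u v => ∃ M : ℕ, ∀ n ≥ M, kmForm k g form n u v = 0)
    ?_ ?_ ?_ ?_ ?_ u v
  · exact fun v => ⟨0, fun n _ => by simp⟩
  · exact fun v => ⟨0, fun n _ => by simp⟩
  · intro f a h b
    obtain ⟨M, hM⟩ := polyMul_local k f h
    exact ⟨M + 1, fun n hn => by simp [kmForm_tmul, hM (n - 1) (by omega)]⟩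
  · rintro u u' v ⟨M, hM⟩ ⟨M', hM'⟩
    refine ⟨max M M', fun n hn => ?_⟩
    simp [hM n (le_trans (le_max_left _ _) hn), hM' n (le_trans (le_max_right _ _) hn)]
  · rintro u u' v ⟨M, hM⟩ ⟨M', hM'⟩
    refine ⟨max M M', fun n hn => ?_⟩
    simp [hM n (le_trans (le_max_left _ _) hn), hM' n (le_trans (le_max_right _ _) hn)]

theorem kmForm_D_left (form : LinearMap.BilinForm k g) (n : ℕ) (u v : k[X] ⊗[k] g) :
    kmForm k g form n (curD k g u) v = -((n : k) • kmForm k g form (n - 1) u v) := by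
  refine tensor_ind₂ k g (p := fun u v =>
    kmForm k g form n (curD k g u) v = -((n : k) • kmForm k g form (n - 1) u v)) ?_ ?_ ?_ ?_ ?_ u v
  · simp
  · simp
  · intro f a h b
    rw [curD, TensorProduct.map_tmul, LinearMap.mulLeft_apply, kmForm_tmul, kmForm_tmul,
      polyMul_X_left]
    simp only [eval_neg, eval_smul, smul_eq_mul, LinearMap.id_apply]
    ring
  · intro u u' v hu hu'
    simp only [map_add, LinearMap.add_apply, hu, hu']
    module
  · intro u u' v hu hu'
    simp only [map_add, hu, hu']
    module

theorem kmForm_D_right (form : LinearMap.BilinForm k g) (n : ℕ) (u v : k[X] ⊗[k] g) :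
    kmForm k g form n u (curD k g v) = (n : k) • kmForm k g form (n - 1) u v := by
  refine tensor_ind₂ k g (p := fun u v =>
    kmForm k g form n u (curD k g v) = (n : k) • kmForm k g form (n - 1) u v) ?_ ?_ ?_ ?_ ?_ u v
  · simp
  · simp
  · intro f a h b
    rw [curD, TensorProduct.map_tmul, LinearMap.mulLeft_apply, kmForm_tmul, kmForm_tmul,
      polyMul_X_right]
    simp only [eval_add, eval_mul, eval_X, eval_smul, smul_eq_mul, LinearMap.id_apply]
    ring
  · intro u u' v hu hu'
    simp only [map_add, LinearMap.add_apply, hu, hu']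
    module
  · intro u u' v hu hu'
    simp only [map_add, hu, hu']
    module

/-- The `n`-products on `(k[∂] ⊗ g) ⊕ k e`. -/
def kmMul (form : LinearMap.BilinForm k g) (n : ℕ) :
    ((k[X] ⊗[k] g) × k) →ₗ[k] ((k[X] ⊗[k] g) × k) →ₗ[k] ((k[X] ⊗[k] g) × k) :=
  ((curMul k g n).compr₂ (LinearMap.inl k _ k) +
    (kmForm k g form n).compr₂ (LinearMap.inr k _ k)).compl₁₂
      (LinearMap.fst k _ k) (LinearMap.fst k _ k)

theorem kmMul_apply (form : LinearMap.BilinForm k g) (n : ℕ) (u v : (k[X] ⊗[k] g) × k) :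
    kmMul form n u v = (curMul k g n u.1 v.1, kmForm k g form n u.1 v.1) := by
  simp [kmMul]

variable (k g) in
/-- The action of `∂` on `(k[∂] ⊗ g) ⊕ k e`, with `∂ e = 0`. -/
def kmD : ((k[X] ⊗[k] g) × k) →ₗ[k] ((k[X] ⊗[k] g) × k) := (curD k g).prodMap 0

theorem kmMul_D_left (form : LinearMap.BilinForm k g) (n : ℕ) (u v : (k[X] ⊗[k] g) × k) :
    kmMul form n (kmD k g u) v = -((n : k) • kmMul form (n - 1) u v) := by
  rw [kmMul_apply, kmMul_apply]
  exact Prod.ext (curMul_D_left k g n u.1 v.1) (kmForm_D_left form n u.1 v.1)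

theorem kmMul_D_right (form : LinearMap.BilinForm k g) (n : ℕ) (u v : (k[X] ⊗[k] g) × k) :
    kmMul form n u (kmD k g v) = kmD k g (kmMul form n u v) + (n : k) • kmMul form (n - 1) u v := by
  rw [kmMul_apply, kmMul_apply, kmMul_apply]
  exact Prod.ext (curMul_D_right k g n u.1 v.1)
    ((kmForm_D_right form n u.1 v.1).trans (zero_add _).symm)

theorem kmMul_local (form : LinearMap.BilinForm k g) (u v : (k[X] ⊗[k] g) × k) :
    ∃ M : ℕ, ∀ n ≥ M, kmMul form n u v = 0 := by
  obtain ⟨M, hM⟩ := curMul_local k g u.1 v.1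
  obtain ⟨M', hM'⟩ := kmForm_local form u.1 v.1
  exact ⟨max M M', fun n hn => (kmMul_apply form n u v).trans
    (Prod.ext (hM n (le_trans (le_max_left _ _) hn)) (hM' n (le_trans (le_max_right _ _) hn)))⟩

/-- The Kac–Moody conformal algebra `K(g) = (k[∂] ⊗ g) ⊕ k e`, `∂ e = 0`, with
`[a (λ) b] = [a, b] + λ ⟨a|b⟩ e` and `[a (λ) e] = [e (λ) a] = [e (λ) e] = 0` for `a, b ∈ g`. -/
def KacMoody (_form : LinearMap.BilinForm k g) : Type _ := (k[X] ⊗[k] g) × k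

variable (form : LinearMap.BilinForm k g)

instance : AddCommGroup (KacMoody form) := inferInstanceAs (AddCommGroup ((k[X] ⊗[k] g) × k))
instance : Module k (KacMoody form) := inferInstanceAs (Module k ((k[X] ⊗[k] g) × k))
instance : ConformalAlgebra k (KacMoody form) where
  del := kmD k g
  mul := kmMul form
  locality := kmMul_local form
  mul_del_left := kmMul_D_left form
  mul_del_right := kmMul_D_right form

/-- The elements of `g` in `K(g)`. -/
def KacMoody.of : g →ₗ[k] KacMoody form :=
  (LinearMap.inl k (k[X] ⊗[k] g) k).comp (TensorProduct.mk k k[X] g 1)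

/-- The element `e` of `K(g)`. -/
def KacMoody.e : KacMoody form := ((0, 1) : (k[X] ⊗[k] g) × k)

theorem KacMoody.nprod_of (n : ℕ) (a b : g) :
    nprod k n (KacMoody.of form a) (KacMoody.of form b) =
      if n = 0 then KacMoody.of form ⁅a, b⁆
      else if n = 1 then form a b • KacMoody.e form else 0 := by
  have h0 : ∀ n : ℕ, polyMul k n 1 1 = if n = 0 then 1 else 0 := by
    intro n
    rw [polyMul_apply, Finset.sum_range_succ']
    cases n with
    | zero => simp
    | succ n => simp [coeff_one]
  refine (kmMul_apply form n _ _).trans ?_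
  have h1 : curMul k g n (1 ⊗ₜ a) (1 ⊗ₜ b) = (if n = 0 then 1 else 0 : k[X]) ⊗ₜ[k] ⁅a, b⁆ := by
    rw [← h0 n]
    simp [curMul]
  have h2 : kmForm k g form n (1 ⊗ₜ a) (1 ⊗ₜ b) = if n = 1 then form a b else 0 := by
    rw [kmForm_tmul, h0]
    rcases n with _ | _ | n <;> simp
  refine (Prod.ext h1 h2 : (_ : (k[X] ⊗[k] g) × k) = (_, _)).trans ?_
  rcases n with _ | _ | n
  · rfl
  · have : ((0 : k[X]) ⊗ₜ[k] ⁅a, b⁆, form a b) = form a b • ((0, 1) : (k[X] ⊗[k] g) × k) := by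
      simp
    exact this
  · have : ((0 : k[X]) ⊗ₜ[k] ⁅a, b⁆, (0 : k)) = (0 : (k[X] ⊗[k] g) × k) := by simp
    exact this

variable {ι : Type*} (X₁ : Module.Basis ι k g)

/-- The generating set `X = X₁ ∪ {e}` of `K(g)`, as a family. -/
def KacMoody.gens : Option ι → KacMoody form
  | none => KacMoody.e form
  | some i => KacMoody.of form (X₁ i)

theorem KacMoody.generates : Generates k (KacMoody.gens form X₁) := by
  intro S h hD _
  let S' : Submodule k ((k[X] ⊗[k] g) × k) := S
  have hD' : ∀ u ∈ S', kmD k g u ∈ S' := hD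
  have h1 : S'.comap (LinearMap.inl k (k[X] ⊗[k] g) k) = ⊤ :=
    span_curD_eq_top X₁ _ (fun i => h (some i)) fun u hu => by
      have h2 := hD' _ hu
      simpa [kmD] using h2
  have h5 : S' = ⊤ := by
    rw [eq_top_iff]
    rintro ⟨u, c⟩ -
    have h2 : u ∈ S'.comap (LinearMap.inl k (k[X] ⊗[k] g) k) := h1 ▸ Submodule.mem_top
    have h3 : ((0, 1) : (k[X] ⊗[k] g) × k) ∈ S' := h none
    have h4 : (u, (0 : k)) + c • ((0, 1) : (k[X] ⊗[k] g) × k) = (u, c) := by simp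
    exact h4 ▸ S'.add_mem h2 (S'.smul_mem c h3)
  exact h5

end KacMoody

/-! ### The associated graded conformal algebra of the filtration by degree -/

section Graded

variable {k : Type*} [Field k] {C : Type*} [AddCommGroup C] [Module k C] [ConformalAlgebra k C]
  {ι : Type*}

/-- `IsMonomial k x n a`: `a` is a monomial of degree `n` in the generators `x i`, formed by means
of `∂` (of degree `0`) and the `n`-products. -/
inductive IsMonomial (k : Type*) [Field k] {C : Type*} [AddCommGroup C] [Module k C]
    [ConformalAlgebra k C] {ι : Type*} (x : ι → C) : ℕ → C → Prop
  | gen (i) : IsMonomial k x 1 (x i)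
  | D (p a) : IsMonomial k x p a → IsMonomial k x p (Conf.D k a)
  | nprod (n p q a b) : IsMonomial k x p a → IsMonomial k x q b →
      IsMonomial k x (p + q) (Conf.nprod k n a b)

theorem IsMonomial.pos {x : ι → C} {p : ℕ} {a : C} (h : IsMonomial k x p a) : 0 < p := by
  induction h <;> omega

variable (k) in
/-- The filtration by degree in the generators: the span of the monomials of degree at most `p`. -/
def fil (x : ι → C) (p : ℕ) : Submodule k C :=
  Submodule.span k {a | ∃ q ≤ p, IsMonomial k x q a}

variable (x : ι → C)

theorem fil_zero : fil k x 0 = ⊥ := by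
  rw [fil, Submodule.span_eq_bot]
  rintro a ⟨q, hq, h⟩
  have := h.pos
  omega

theorem fil_mono {p q : ℕ} (h : p ≤ q) : fil k x p ≤ fil k x q :=
  Submodule.span_mono fun _ ⟨r, hr, ha⟩ => ⟨r, hr.trans h, ha⟩

theorem gen_mem_fil (i : ι) : x i ∈ fil k x 1 :=
  Submodule.subset_span ⟨1, le_rfl, IsMonomial.gen i⟩

theorem D_mem_fil {p : ℕ} {a : C} (ha : a ∈ fil k x p) : D k a ∈ fil k x p := by
  have : fil k x p ≤ (fil k x p).comap (D k) := by
    refine Submodule.span_le.2 ?_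
    rintro a ⟨q, hq, h⟩
    exact Submodule.subset_span ⟨q, hq, h.D⟩
  exact this ha

theorem nprod_mem_fil (n : ℕ) {p q : ℕ} {a b : C} (ha : a ∈ fil k x p) (hb : b ∈ fil k x q) :
    nprod k n a b ∈ fil k x (p + q) := by
  have h1 : ∀ a, (∃ p' ≤ p, IsMonomial k x p' a) →
      fil k x q ≤ (fil k x (p + q)).comap (nprod k n a) := by
    rintro a ⟨p', hp', h⟩
    refine Submodule.span_le.2 ?_
    rintro b ⟨q', hq', h'⟩
    exact Submodule.subset_span ⟨p' + q', add_le_add hp' hq', h.nprod n _ _ _ _ h'⟩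
  have h2 : fil k x p ≤ (fil k x (p + q)).comap ((nprod k n).flip b) :=
    Submodule.span_le.2 fun a h => h1 a h hb
  exact h2 ha

/-- For positive `p` or `q` products of elements of degree `≤ p - 1` and `≤ q` have degree
`≤ p + q - 1`; for `p = 0` they vanish. -/
theorem nprod_mem_fil_left (n : ℕ) {p q : ℕ} {a b : C} (ha : a ∈ fil k x (p - 1))
    (hb : b ∈ fil k x q) : nprod k n a b ∈ fil k x (p + q - 1) := by
  rcases p with _ | p
  · rw [Nat.zero_sub, fil_zero, Submodule.mem_bot] at ha
    simp [ha]
  · have := nprod_mem_fil x n ha hb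
    exact fil_mono x (by omega) this

theorem nprod_mem_fil_right (n : ℕ) {p q : ℕ} {a b : C} (ha : a ∈ fil k x p)
    (hb : b ∈ fil k x (q - 1)) : nprod k n a b ∈ fil k x (p + q - 1) := by
  rcases q with _ | q
  · rw [Nat.zero_sub, fil_zero, Submodule.mem_bot] at hb
    simp [hb]
  · have := nprod_mem_fil x n ha hb
    exact fil_mono x (by omega) this

variable (k)

/-- The component `F_p / F_{p-1}` of degree `p` (it is zero for `p = 0`, as `F_0 = 0`). -/
abbrev GrPiece (p : ℕ) : Type _ := fil k x p ⧸ (fil k x (p - 1)).submoduleOf (fil k x p)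

/-- The action of `∂` on `F_p / F_{p-1}`. -/
def grD (p : ℕ) : GrPiece k x p →ₗ[k] GrPiece k x p :=
  Submodule.mapQ _ _ ((D k).restrict fun _ ha => D_mem_fil x ha) fun a ha => by
    simp only [Submodule.submoduleOf, Submodule.mem_comap] at ha ⊢
    exact D_mem_fil x ha

/-- The `n`-product `F_p × F_q → F_{p+q}`. -/
def filMul (n p q : ℕ) : fil k x p →ₗ[k] fil k x q →ₗ[k] fil k x (p + q) :=
  LinearMap.mk₂ k (fun a b => ⟨nprod k n (a : C) (b : C), nprod_mem_fil x n a.2 b.2⟩)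
    (fun _ _ _ => Subtype.ext (by simp)) (fun _ _ _ => Subtype.ext (by simp))
    (fun _ _ _ => Subtype.ext (by simp)) (fun _ _ _ => Subtype.ext (by simp))

/-- The `n`-product `F_p / F_{p-1} × F_q / F_{q-1} → F_{p+q} / F_{p+q-1}`. -/
def grMul (n p q : ℕ) : GrPiece k x p →ₗ[k] GrPiece k x q →ₗ[k] GrPiece k x (p + q) :=
  qlift₂ _ _ ((filMul k x n p q).compr₂ (Submodule.mkQ _))
    (fun _ ha b => (Submodule.Quotient.mk_eq_zero _).2 (nprod_mem_fil_left x n ha b.2))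
    (fun a _ hb => (Submodule.Quotient.mk_eq_zero _).2 (nprod_mem_fil_right x n a.2 hb))

open scoped DirectSum

/-- The associated graded space `gr C = ⨁ₚ F_p / F_{p-1}`. -/
def Gr : Type _ := ⨁ p, GrPiece k x p

instance : AddCommGroup (Gr k x) := inferInstanceAs (AddCommGroup (⨁ p, GrPiece k x p))
instance : Module k (Gr k x) := inferInstanceAs (Module k (⨁ p, GrPiece k x p))

/-- The inclusion of the component of degree `p` into `gr C`. -/
def Gr.of (p : ℕ) : GrPiece k x p →ₗ[k] Gr k x := DirectSum.lof k ℕ (fun p => GrPiece k x p) p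

/-- The symbol of degree `p` in `gr C` of an element of `F_p`. -/
def Gr.symbol (p : ℕ) (a : fil k x p) : Gr k x := Gr.of k x p (Submodule.Quotient.mk a)

variable {k} in
theorem Gr.ind {P : Gr k x → Prop} (h0 : P 0) (hs : ∀ p a, P (Gr.symbol k x p a))
    (ha : ∀ u v, P u → P v → P (u + v)) (u : Gr k x) : P u := by
  refine DirectSum.induction_on (motive := P) u h0 ?_ ha
  intro p a
  obtain ⟨a, rfl⟩ := Submodule.Quotient.mk_surjective _ a
  exact hs p a

/-- The action of `∂` on `gr C`. -/
def Gr.D : Gr k x →ₗ[k] Gr k x :=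
  DirectSum.toModule k ℕ (Gr k x) fun p => (Gr.of k x p).comp (grD k x p)

/-- The `n`-products on `gr C`. -/
def Gr.mul (n : ℕ) : Gr k x →ₗ[k] Gr k x →ₗ[k] Gr k x :=
  DirectSum.toModule k ℕ (Gr k x →ₗ[k] Gr k x) fun p => LinearMap.flip <|
    DirectSum.toModule k ℕ (GrPiece k x p →ₗ[k] Gr k x) fun q =>
      ((grMul k x n p q).compr₂ (Gr.of k x (p + q))).flip

theorem Gr.D_symbol (p : ℕ) (a : fil k x p) :
    Gr.D k x (Gr.symbol k x p a) = Gr.symbol k x p ⟨Conf.D k (a : C), D_mem_fil x a.2⟩ := by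
  refine (DirectSum.toModule_lof k p _).trans ?_
  rfl

theorem Gr.mul_symbol (n p q : ℕ) (a : fil k x p) (b : fil k x q) :
    Gr.mul k x n (Gr.symbol k x p a) (Gr.symbol k x q b) =
      Gr.symbol k x (p + q) ⟨nprod k n (a : C) (b : C), nprod_mem_fil x n a.2 b.2⟩ := by
  refine (LinearMap.congr_fun (DirectSum.toModule_lof k p _) _).trans ?_
  refine (LinearMap.congr_fun (DirectSum.toModule_lof k q _) _).trans ?_
  rfl

variable {k} in
theorem Gr.ind₂ {P : Gr k x → Gr k x → Prop} (h0 : ∀ v, P 0 v) (h0' : ∀ u, P u 0)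
    (hs : ∀ p a q b, P (Gr.symbol k x p a) (Gr.symbol k x q b))
    (ha : ∀ u u' v, P u v → P u' v → P (u + u') v)
    (ha' : ∀ u v v', P u v → P u v' → P u (v + v')) (u v : Gr k x) : P u v :=
  Gr.ind x (h0 v) (fun p a => Gr.ind x (h0' _) (fun q b => hs p a q b)
    (fun v v' => ha' _ v v') v) (fun u u' => ha u u' v) u

/-- The associated graded conformal algebra of the filtration by degree in the generators. -/
instance : ConformalAlgebra k (Gr k x) where
  del := Gr.D k x
  mul := Gr.mul k x
  locality := by
    refine Gr.ind₂ x ?_ ?_ ?_ ?_ ?_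
    · exact fun v => ⟨0, fun n _ => by simp⟩
    · exact fun v => ⟨0, fun n _ => by simp⟩
    · intro p a q b
      obtain ⟨M, hM⟩ := ConformalAlgebra.locality (k := k) (a : C) (b : C)
      refine ⟨M, fun n hn => ?_⟩
      rw [Gr.mul_symbol, Gr.symbol, show (⟨nprod k n (a : C) (b : C), nprod_mem_fil x n a.2 b.2⟩ :
        fil k x (p + q)) = 0 from Subtype.ext (hM n hn)]
      simp
    · rintro u u' v ⟨M, hM⟩ ⟨M', hM'⟩
      refine ⟨max M M', fun n hn => ?_⟩
      simp [hM n (le_trans (le_max_left _ _) hn), hM' n (le_trans (le_max_right _ _) hn)]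
    · rintro u u' v ⟨M, hM⟩ ⟨M', hM'⟩
      refine ⟨max M M', fun n hn => ?_⟩
      simp [hM n (le_trans (le_max_left _ _) hn), hM' n (le_trans (le_max_right _ _) hn)]
  mul_del_left n := by
    refine Gr.ind₂ x ?_ ?_ ?_ ?_ ?_
    · simp
    · simp
    · intro p a q b
      rw [Gr.D_symbol, Gr.mul_symbol, Gr.mul_symbol, Gr.symbol, Gr.symbol, ← map_smul, ← map_neg,
        ← Submodule.Quotient.mk_smul, ← Submodule.Quotient.mk_neg]
      congr 2
      exact Subtype.ext (nprod_D_left n (a : C) (b : C))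
    · intro u u' v hu hu'
      simp only [map_add, LinearMap.add_apply, hu, hu']
      module
    · intro u u' v hu hu'
      simp only [map_add, hu, hu']
      module
  mul_del_right n := by
    refine Gr.ind₂ x ?_ ?_ ?_ ?_ ?_
    · simp
    · simp
    · intro p a q b
      rw [Gr.D_symbol, Gr.mul_symbol, Gr.mul_symbol, Gr.mul_symbol, Gr.D_symbol, Gr.symbol,
        Gr.symbol, Gr.symbol, ← map_smul, ← map_add, ← Submodule.Quotient.mk_smul,
        ← Submodule.Quotient.mk_add]
      congr 2
      exact Subtype.ext (nprod_D_right n (a : C) (b : C))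
    · intro u u' v hu hu'
      simp only [map_add, LinearMap.add_apply, hu, hu']
      module
    · intro u u' v hu hu'
      simp only [map_add, hu, hu']
      module

/-- The image of the generator `x i` in the component of degree `1` of `gr C`. -/
def Gr.gen (i : ι) : Gr k x := Gr.symbol k x 1 ⟨x i, gen_mem_fil x i⟩

end Graded

end Conf

/-!
# The associated graded algebra of the envelope of locality three

Let `L` be the Kac–Moody conformal algebra `K(g)` of an invariant form, `U` its universal envelope
with locality `3`, and `C = ComConf(X₁, 3) ⊕ k e`.

The easy half is a surjection `Θ : C → gr U`. The brackets of generators have degree at most one,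
so the generators commute in `gr U`, and an associative conformal algebra that is generated by
commuting elements is commutative (`isCommutative_of_generates`). The generators inherit locality,
so `Θ` exists by the universal property of `ComConf` (`ComConf.existsUnique_hom`,
`exists_hom_prod`).

The main point is that `Θ` is injective: `U` has to be shown to be large, for which a
representation is constructed whose leading part is faithful on `C`. It consists of fields, i.e.
of sequences of modes with values in an associative algebra, and the envelope maps to fields as
soon as `L` maps to mutually local fields with the required commutators and locality
(`IsFieldMap.exists_hom`).

* *Operators.* Any Lie algebra `h` in characteristic zero acts on `S(h)`, transferred from the
  left multiplication on `U(h)` by symmetrization, by `x ↦ ∑ₙ Bₙ / n! T_n(x)`. Here `T_0(x)` is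
  the multiplication by `x`, and `T_n(x)` lowers the degree by `n - 1` (`starT`). With a parameter
  `ħ` one obtains `x ↦ ħ⁻¹ ∑ₙ Bₙ / n! T_n(x) ħⁿ`. The bracket relation (`starT_comm`,
  `bernSeries_lie`) is a functional equation of the generating function `t / (eᵗ - 1)` of the
  Bernoulli numbers. It is proved directly, without the Poincaré–Birkhoff–Witt theorem.
* *Locality.* Now let `h` be the affine Lie algebra `g[t, t⁻¹] ⊕ k e`. Let `locIdeal` be the ideal
  of `S(h)` generated by the coefficients of `(z - w)³ a(z) b(w)` for `a, b ∈ g` and by the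
  products with `e`. Each single operator `T_n(x)` preserves this ideal (`starT_mem`), and modulo
  the ideal the compositions `T_i(a(z)) T_j(b(w))` are annihilated by `(z - w)³`
  (`starT_starT_mem`). Both hold because `(z - w)³ [y, a(z)] b(w)` is, up to multiples of `e`, a
  combination of shifts of expressions of the same kind, and because `(z - w)²` already
  annihilates `[a(z), b(w)]`. This is where locality `3` matches. On `S(h) / locIdeal` the fields
  are therefore local of order three (`opL_local`) and represent `U` by Laurent series in `ħ`.
* *Leading terms.* The elements of `F_p` have poles of order at most `p` in `ħ`, so the
  coefficients of `ħ⁻ᵖ` define a representation of `gr U` (`IsFieldHom.exists_gr`). In it the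
  generators act on `S(h) / locIdeal` as multiplications by `a(z)` and by `e`.
* *Faithfulness.* The modes of the elements of the commutative conformal algebra `C` form a
  commutative algebra, the coefficient algebra (`Modes`, `modeMul`). The map `a tᵖ ↦ a(p)` extends
  to a homomorphism from `S(h)` to its unitization, which annihilates `locIdeal`
  (`symModes_eq_zero`). If `c ∈ C` acts by zero through `Θ`, its modes are zero, and since an
  element of a conformal algebra is determined by its modes (`modes_injective`), `c = 0`
  (`IsFieldHom.injective`).

For `Cur g`, the same fields with the zero form are restricted along the inclusion `curInl` of
`Cur g` into `K(g)`.
-/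

namespace Conf

/-! ### Formal distributions and sequences of modes -/

section Seq

variable (k : Type*) [Field k] {P Q R R' : Type*} [AddCommGroup P] [Module k P] [AddCommGroup Q]
  [Module k Q] [AddCommGroup R] [Module k R] [AddCommGroup R'] [Module k R']

/-- Multiplication of a formal distribution `∑ f p q z⁻ᵖ⁻¹ w⁻ᵠ⁻¹` by `z - w`. -/
def Δ : (ℤ → ℤ → R) →ₗ[k] (ℤ → ℤ → R) where
  toFun f p q := f (p + 1) q - f p (q + 1)
  map_add' f g := by ext p q; simp; abel
  map_smul' c f := by ext p q; simp [smul_sub]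

theorem Δ_apply (f : ℤ → ℤ → R) (p q : ℤ) : Δ k f p q = f (p + 1) q - f p (q + 1) := rfl

theorem Δ_pow_succ (n : ℕ) (f : ℤ → ℤ → R) (p q : ℤ) :
    (Δ k ^ (n + 1)) f p q = (Δ k ^ n) f (p + 1) q - (Δ k ^ n) f p (q + 1) := by
  rw [pow_succ']
  rfl

theorem Δ_pow_mono {f : ℤ → ℤ → R} {N n : ℕ} (h : (Δ k ^ N) f = 0) (hn : N ≤ n) :
    (Δ k ^ n) f = 0 := by
  obtain ⟨m, rfl⟩ := Nat.exists_eq_add_of_le' hn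
  rw [pow_add, Module.End.mul_apply, h, map_zero]

theorem exists_Δ_pow_add {f f' : ℤ → ℤ → R}
    (h : ∃ N, (Δ k ^ N) f = 0) (h' : ∃ N, (Δ k ^ N) f' = 0) : ∃ N, (Δ k ^ N) (f + f') = 0 := by
  obtain ⟨N, h⟩ := h
  obtain ⟨N', h'⟩ := h'
  refine ⟨max N N', ?_⟩
  rw [map_add, Δ_pow_mono k h (le_max_left _ _), Δ_pow_mono k h' (le_max_right _ _), add_zero]

theorem Δ_pow_comp (n : ℕ) (F : R →ₗ[k] R') (f : ℤ → ℤ → R) (p q : ℤ) :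
    (Δ k ^ n) (fun p q => F (f p q)) p q = F ((Δ k ^ n) f p q) := by
  induction n generalizing p q with
  | zero => rfl
  | succ n ih => rw [Δ_pow_succ, Δ_pow_succ, ih, ih, map_sub]

theorem Δ_pow_shift (n : ℕ) (a b : ℤ) (f : ℤ → ℤ → R) (p q : ℤ) :
    (Δ k ^ n) (fun p q => f (p + a) (q + b)) p q = (Δ k ^ n) f (p + a) (q + b) := by
  induction n generalizing p q with
  | zero => rfl
  | succ n ih => rw [Δ_pow_succ, Δ_pow_succ, ih, ih, add_right_comm, add_right_comm q]

theorem Δ_pow_flip (n : ℕ) (f : ℤ → ℤ → R) (p q : ℤ) :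
    (Δ k ^ n) (fun p q => f q p) p q = (-1 : k) ^ n • (Δ k ^ n) f q p := by
  induction n generalizing p q with
  | zero => simp
  | succ n ih => rw [Δ_pow_succ, Δ_pow_succ, ih, ih, pow_succ]; module

theorem Δ_pow_mem (n : ℕ) (Z : Submodule k R) {f : ℤ → ℤ → R} (h : ∀ p q, f p q ∈ Z) (p q : ℤ) :
    (Δ k ^ n) f p q ∈ Z := by
  induction n generalizing p q with
  | zero => exact h p q
  | succ n ih => rw [Δ_pow_succ]; exact Z.sub_mem (ih _ _) (ih _ _)

/-- A distribution killed by `(z - w)ᴺ` is determined by its products with `(z - w)ˢ`, expanded at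
the zeroth mode in `z`. -/
theorem Δ_pow_expand {f : ℤ → ℤ → R} {N K : ℕ} (h : (Δ k ^ N) f = 0) (hK : N ≤ K) (n : ℕ)
    (p q : ℤ) : (Δ k ^ n) f p q =
      ∑ s ∈ Finset.range K, Ring.choose p s • (Δ k ^ (n + s)) f 0 (p + q - s) := by
  -- descending induction on `n`, starting at `n ≥ N`
  obtain ⟨j, hj⟩ : ∃ j, N ≤ n + j := ⟨N, by omega⟩
  induction j generalizing n p q with
  | zero =>
    rw [add_zero] at hj
    rw [Δ_pow_mono k h hj, Finset.sum_eq_zero]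
    · rfl
    · intro s _
      rw [Δ_pow_mono k h (by omega)]
      simp
  | succ j ih =>
    -- `G` is the right hand side; its difference to the left hand side vanishes for `p = 0` and is
    -- annihilated by `z - w`, hence zero
    set G : ℤ → ℤ → R := fun p q =>
      ∑ s ∈ Finset.range K, Ring.choose p s • (Δ k ^ (n + s)) f 0 (p + q - s) with hG
    have hstep : ∀ p q, G (p + 1) q - G p (q + 1) = (Δ k ^ (n + 1)) f p q := by
      intro p q
      rw [ih (n + 1) p q (by omega)]
      simp only [hG]
      rw [← Finset.sum_sub_distrib]
      have e : ∀ s ∈ Finset.range K, Ring.choose (p + 1) s • (Δ k ^ (n + s)) f 0 (p + 1 + q - s) -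
          Ring.choose p s • (Δ k ^ (n + s)) f 0 (p + (q + 1) - s) =
          (Ring.choose (p + 1) s - Ring.choose p s) • (Δ k ^ (n + s)) f 0 (p + q + 1 - s) := by
        intro s _
        rw [sub_smul, show p + 1 + q - s = p + q + 1 - s by ring,
          show p + (q + 1) - s = p + q + 1 - s by ring]
      rw [Finset.sum_congr rfl e]
      have h1 : ∑ s ∈ Finset.range (K + 1), (Ring.choose (p + 1) s - Ring.choose p s) •
          (Δ k ^ (n + s)) f 0 (p + q + 1 - s) = ∑ s ∈ Finset.range K,
            (Ring.choose (p + 1) s - Ring.choose p s) • (Δ k ^ (n + s)) f 0 (p + q + 1 - s) := by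
        rw [Finset.sum_range_succ, Δ_pow_mono k h (show N ≤ n + K by omega)]
        simp
      rw [← h1, Finset.sum_range_succ']
      simp only [Ring.choose_zero_right, sub_self, zero_smul, add_zero]
      refine Finset.sum_congr rfl fun s _ => ?_
      rw [Ring.choose_succ_succ]
      congr 1
      · rw [add_sub_cancel_right]
      · rw [show n + (s + 1) = n + 1 + s by omega,
          show p + q + 1 - ((s + 1 : ℕ) : ℤ) = p + q - s by push_cast; ring]
    have h0 : ∀ q, G 0 q = (Δ k ^ n) f 0 q := by
      intro q
      simp only [hG]
      rcases K with _ | K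
      · rw [Δ_pow_mono k h (by omega)]
        simp
      · rw [Finset.sum_range_succ', Finset.sum_eq_zero]
        · simp
        · intro s _
          rw [Ring.choose_zero_succ, zero_smul]
    have key : ∀ p q,
        (Δ k ^ n) f (p + 1) q - G (p + 1) q = (Δ k ^ n) f p (q + 1) - G p (q + 1) := by
      intro p q
      have h2 := hstep p q
      rw [Δ_pow_succ] at h2
      rw [sub_eq_sub_iff_sub_eq_sub]
      exact h2.symm
    have hz : ∀ p q, (Δ k ^ n) f p q - G p q = 0 := by
      intro p
      induction p using Int.induction_on with
      | zero => intro q; rw [h0, sub_self]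
      | succ p ihp => intro q; rw [key, ihp]
      | pred p ihp =>
        intro q
        have := key (-(p : ℤ) - 1) (q - 1)
        rw [sub_add_cancel, sub_add_cancel, ihp] at this
        exact this.symm
    exact sub_eq_zero.1 (hz p q)

/-- The operator `∂` on sequences of modes: `(∂a)(m) = -m a(m-1)`. -/
def seqD : (ℤ → R) →ₗ[k] (ℤ → R) where
  toFun a m := -((m : k) • a (m - 1))
  map_add' a b := by ext m; simp; abel
  map_smul' c a := by ext m; simp [smul_comm c]

theorem seqD_apply (a : ℤ → R) (m : ℤ) : seqD k a m = -((m : k) • a (m - 1)) := rfl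

variable {k}

/-- The products of the modes of two sequences. -/
def seqTens (μ : P →ₗ[k] Q →ₗ[k] R) : (ℤ → P) →ₗ[k] (ℤ → Q) →ₗ[k] (ℤ → ℤ → R) :=
  LinearMap.mk₂ k (fun a b p q => μ (a p) (b q))
    (by intros; ext; simp) (by intros; ext; simp) (by intros; ext; simp) (by intros; ext; simp)

/-- The `n`-product of two sequences of modes,
`(a (n) b)(m) = ∑ᵢ (-1)ⁱ (n choose i) a(n-i) b(m+i)`, with values multiplied by means of `μ`.
It is the residue in `z` of `(z - w)ⁿ a(z) b(w)`. -/
def seqMul (μ : P →ₗ[k] Q →ₗ[k] R) (n : ℕ) : (ℤ → P) →ₗ[k] (ℤ → Q) →ₗ[k] (ℤ → R) :=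
  (seqTens μ).compr₂ ((LinearMap.proj 0).comp (Δ k ^ n))

theorem seqMul_eq (μ : P →ₗ[k] Q →ₗ[k] R) (n : ℕ) (a : ℤ → P) (b : ℤ → Q) (m : ℤ) :
    seqMul μ n a b m = (Δ k ^ n) (fun p q => μ (a p) (b q)) 0 m := rfl

/-- The shifted sequence `m ↦ a(m+1)`. -/
def seqShift (a : ℤ → P) : ℤ → P := fun m => a (m + 1)

theorem seqMul_zero (μ : P →ₗ[k] Q →ₗ[k] R) (a : ℤ → P) (b : ℤ → Q) (m : ℤ) :
    seqMul μ 0 a b m = μ (a 0) (b m) := rfl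

theorem seqMul_shift_right (μ : P →ₗ[k] Q →ₗ[k] R) (n : ℕ) (a : ℤ → P) (b : ℤ → Q) :
    seqMul μ n a (seqShift b) = seqShift (seqMul μ n a b) := by
  ext m
  have := Δ_pow_shift k n 0 1 (fun p q => μ (a p) (b q)) 0 m
  simp only [add_zero] at this
  exact this

theorem seqMul_succ (μ : P →ₗ[k] Q →ₗ[k] R) (n : ℕ) (a : ℤ → P) (b : ℤ → Q) :
    seqMul μ (n + 1) a b = seqMul μ n (seqShift a) b - seqMul μ n a (seqShift b) := by
  ext m
  rw [seqMul_shift_right, seqMul_eq, Δ_pow_succ]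
  have := Δ_pow_shift k n 1 0 (fun p q => μ (a p) (b q)) 0 m
  simp only [add_zero] at this
  rw [← this]
  rfl

theorem seqMul_shift_left (μ : P →ₗ[k] Q →ₗ[k] R) (n : ℕ) (a : ℤ → P) (b : ℤ → Q) :
    seqMul μ n (seqShift a) b = seqMul μ (n + 1) a b + seqShift (seqMul μ n a b) := by
  rw [seqMul_succ, seqMul_shift_right, sub_add_cancel]

theorem seqMul_mem (μ : P →ₗ[k] Q →ₗ[k] R) (n : ℕ) (Z : Submodule k R) {a : ℤ → P} {b : ℤ → Q}
    (h : ∀ p q, μ (a p) (b q) ∈ Z) (m : ℤ) : seqMul μ n a b m ∈ Z :=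
  Δ_pow_mem k n Z h 0 m

theorem seqMul_map {P' Q' : Type*} [AddCommGroup P'] [Module k P'] [AddCommGroup Q'] [Module k Q']
    (μ : P →ₗ[k] Q →ₗ[k] R) (μ' : P' →ₗ[k] Q' →ₗ[k] R') (F : R →ₗ[k] R') {a : ℤ → P} {b : ℤ → Q}
    {a' : ℤ → P'} {b' : ℤ → Q'} (h : ∀ p q, F (μ (a p) (b q)) = μ' (a' p) (b' q)) (n : ℕ) (m : ℤ) :
    F (seqMul μ n a b m) = seqMul μ' n a' b' m := by
  rw [seqMul_eq, seqMul_eq, ← Δ_pow_comp]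
  simp only [h]

theorem seqShift_seqD (a : ℤ → P) : seqShift (seqD k a) = seqD k (seqShift a) - a := by
  ext m
  simp only [seqShift, seqD_apply, Pi.sub_apply, add_sub_cancel_right, sub_add_cancel]
  push_cast
  module

theorem seqMul_seqD_left (μ : P →ₗ[k] Q →ₗ[k] R) (n : ℕ) (a : ℤ → P) (b : ℤ → Q) :
    seqMul μ n (seqD k a) b = -((n : k) • seqMul μ (n - 1) a b) := by
  induction n generalizing a b with
  | zero => ext m; simp [seqMul_zero, seqD_apply]
  | succ n ih =>
    rw [seqMul_succ, seqShift_seqD, map_sub, LinearMap.sub_apply, ih, ih, Nat.add_sub_cancel]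
    rcases n with _ | n
    · simp
    · rw [Nat.add_sub_cancel, seqMul_succ μ n a b]
      push_cast
      module

theorem seqMul_seqD_right (μ : P →ₗ[k] Q →ₗ[k] R) (n : ℕ) (a : ℤ → P) (b : ℤ → Q) :
    seqMul μ n a (seqD k b) = seqD k (seqMul μ n a b) + (n : k) • seqMul μ (n - 1) a b := by
  induction n generalizing a b with
  | zero => ext m; simp [seqMul_zero, seqD_apply]
  | succ n ih =>
    rw [seqMul_succ, seqShift_seqD, map_sub, ih, ih, Nat.add_sub_cancel, seqMul_succ, map_sub]
    rcases n with _ | n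
    · simp; abel
    · rw [Nat.add_sub_cancel, seqMul_succ μ n a b]
      push_cast
      module

/-- The `n`-products of sequences with values in an associative algebra are associative. -/
theorem seqMul_assoc (μ : R →ₗ[k] R →ₗ[k] R) (hμ : ∀ x y z, μ x (μ y z) = μ (μ x y) z) (n m : ℕ)
    (a b c : ℤ → R) : seqMul μ n a (seqMul μ m b c) = ∑ s ∈ Finset.range (n + 1),
      (n.choose s : k) • seqMul μ (m + s) (seqMul μ (n - s) a b) c := by
  have h : ∀ (n : ℕ) (a b c : ℤ → R), seqMul μ n a (seqMul μ m b c) =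
      ∑ ij ∈ Finset.HasAntidiagonal.antidiagonal n,
        n.choose ij.1 • seqMul μ (m + ij.1) (seqMul μ ij.2 a b) c := by
    intro n
    induction n with
    | zero =>
      intro a b c
      ext l
      simp only [Finset.HasAntidiagonal.antidiagonal_zero, Finset.sum_singleton, Nat.choose_self,
        one_smul, add_zero]
      exact seqMul_map μ μ (μ (a 0)) (fun p q => hμ _ _ _) m l
    | succ n ih =>
      intro a b c
      rw [seqMul_succ, ih, ← seqMul_shift_right, ih, Finset.sum_antidiagonal_choose_succ_nsmul
        (fun i j => seqMul μ (m + i) (seqMul μ j a b) c), ← Finset.sum_sub_distrib,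
        ← Finset.sum_add_distrib]
      refine Finset.sum_congr rfl fun ij hij => ?_
      rw [← Nat.choose_symm_of_eq_add (Finset.HasAntidiagonal.mem_antidiagonal.1 hij).symm,
        seqMul_shift_left, map_add, LinearMap.add_apply, ← add_assoc m, seqMul_succ μ (m + ij.1),
        smul_add, smul_sub]
      abel
  rw [h, Finset.Nat.sum_antidiagonal_eq_sum_range_succ_mk]
  simp only [Nat.cast_smul_eq_nsmul]

theorem seqD_pow_apply [CharZero k] (s : ℕ) (a : ℤ → R) (m : ℤ) :
    (seqD k ^ s) a m = ((-1 : k) ^ s * s.factorial) • Ring.choose m s • a (m - s) := by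
  induction s generalizing m with
  | zero => simp
  | succ s ih =>
    rw [pow_succ', Module.End.mul_apply, seqD_apply, ih]
    have h : (m : k) * ((Ring.choose (m - 1) s : ℤ) : k) =
        ((s : k) + 1) * ((Ring.choose m (s + 1) : ℤ) : k) := by
      have := Ring.choose_smul_choose m (n := s + 1) (k := 1) (by omega)
      simp only [Nat.choose_one_right, Ring.choose_one_right, nsmul_eq_mul, Nat.cast_one,
        Nat.add_sub_cancel] at this
      have h2 := congrArg (Int.cast : ℤ → k) this
      push_cast at h2
      exact h2.symm
    rw [← Int.cast_smul_eq_zsmul k, ← Int.cast_smul_eq_zsmul k, smul_smul, smul_smul, smul_smul,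
      ← neg_smul, show m - 1 - (s : ℤ) = m - ((s + 1 : ℕ) : ℤ) by push_cast; ring]
    congr 1
    rw [Nat.factorial_succ]
    push_cast
    linear_combination (-(-1 : k) ^ s * s.factorial) * h

/-- For mutually local sequences, the `n`-product `(b (-∂-λ) a)` is the `n`-product of `a` and `b`
with respect to the opposite multiplication. -/
theorem seqMul_flip_eq_sum [CharZero k] (μ : P →ₗ[k] Q →ₗ[k] R) {b : ℤ → P} {a : ℤ → Q} {N M : ℕ}
    (h : (Δ k ^ N) (fun p q => μ (b p) (a q)) = 0) (hM : ∀ m ≥ M, seqMul μ m b a = 0) (n : ℕ) :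
    seqMul μ.flip n a b = ∑ s ∈ Finset.range M,
      ((-1 : k) ^ (n + s) / (s.factorial : k)) • (seqD k ^ s) (seqMul μ (n + s) b a) := by
  ext m
  rw [seqMul_eq]
  have h1 := Δ_pow_flip k n (fun p q => μ (b p) (a q)) 0 m
  refine h1.trans ?_
  rw [Δ_pow_expand k h (le_max_left N M), Finset.smul_sum,
    Finset.sum_subset (Finset.range_mono (le_max_right N M))]
  · rw [Finset.sum_apply]
    refine Finset.sum_congr rfl fun s _ => ?_
    rw [Pi.smul_apply, seqD_pow_apply, smul_smul, seqMul_eq, add_zero]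
    congr 1
    have : (s.factorial : k) ≠ 0 := Nat.cast_ne_zero.2 s.factorial_ne_zero
    field_simp
    rw [pow_add, mul_assoc, ← pow_add, Even.neg_one_pow ⟨s, rfl⟩, mul_one]
  · intro s _ hs
    rw [hM _ (by simp at hs; omega)]
    simp

/-- Locality is stable under `∂`. -/
theorem Δ_pow_seqD (μ : P →ₗ[k] Q →ₗ[k] R) {b : ℤ → P} {a : ℤ → Q} {N : ℕ}
    (h : (Δ k ^ N) (fun p q => μ (b p) (a q)) = 0) :
    (Δ k ^ (N + 1)) (fun p q => μ (seqD k b p) (a q)) = 0 ∧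
      (Δ k ^ (N + 1)) (fun p q => μ (b p) (seqD k a q)) = 0 := by
  -- the commutator of `∂` in the variable `z` with `(z - w)ⁿ⁺¹`
  have key : ∀ (n : ℕ) (f : ℤ → ℤ → R) (p q : ℤ),
      (Δ k ^ (n + 1)) (fun p q => -((p : k) • f (p - 1) q)) p q =
        -((p : k) • (Δ k ^ (n + 1)) f (p - 1) q) - ((n : k) + 1) • (Δ k ^ n) f p q := by
    intro n f
    induction n with
    | zero =>
      intro p q
      simp only [zero_add, pow_one, Δ_apply, pow_zero, Module.End.one_apply]
      rw [add_sub_cancel_right, sub_add_cancel]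
      push_cast
      module
    | succ n ih =>
      intro p q
      rw [Δ_pow_succ, ih, ih, Δ_pow_succ k (n + 1) f (p - 1) q, Δ_pow_succ k n f p q,
        add_sub_cancel_right, sub_add_cancel]
      push_cast
      have := Δ_pow_succ k n f p q
      rw [this]
      module
  constructor
  · ext p q
    have := key N (fun p q => μ (b p) (a q)) p q
    rw [Δ_pow_mono k h N.le_succ, h] at this
    simp only [seqD_apply, map_neg, map_smul, LinearMap.neg_apply, LinearMap.smul_apply]
    simpa using this
  · ext p q
    have h' : (Δ k ^ N) (fun p q => μ (b q) (a p)) = 0 := by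
      ext p q
      rw [Δ_pow_flip k N (fun p q => μ (b p) (a q)), h]
      simp
    have := key N (fun p q => μ (b q) (a p)) q p
    rw [Δ_pow_mono k h' N.le_succ, h'] at this
    simp only [seqD_apply, map_neg, map_smul]
    rw [Δ_pow_flip k (N + 1) (fun p q => -((p : k) • μ (b q) (a (p - 1)))), this]
    simp

end Seq

/-! ### The coefficient algebra of a conformal algebra -/

section Modes

theorem succ_mul_choose (n : ℤ) (s : ℕ) :
    ((s : ℤ) + 1) * Ring.choose n (s + 1) = n * Ring.choose (n - 1) s := by
  have := Ring.choose_smul_choose n (n := s + 1) (k := 1) (by omega)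
  simpa using this

theorem sub_mul_choose (n : ℤ) (s : ℕ) :
    (n - s) * Ring.choose n s = n * Ring.choose (n - 1) s := by
  rcases s with _ | s
  · simp
  · have h1 := succ_mul_choose n s
    have h2 := Ring.choose_succ_succ (n - 1) s
    rw [sub_add_cancel] at h2
    push_cast
    linear_combination n * h2 - h1

/-- A double sum over a square, arranged by the sum of the indices. -/
theorem sum_square_eq_sum_diag {W : Type*} [AddCommGroup W] (T : ℕ) (H : ℕ → ℕ → W)
    (h : ∀ i j, T ≤ i + j → H i j = 0) :
    ∑ i ∈ Finset.range T, ∑ j ∈ Finset.range T, H i j =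
      ∑ t ∈ Finset.range T, ∑ i ∈ Finset.range (t + 1), H i (t - i) := by
  rw [Finset.sum_range_diag_flip]
  refine Finset.sum_congr rfl fun i _ => ?_
  refine (Finset.sum_subset (Finset.range_mono (Nat.sub_le T i)) fun j _ hj => h i j ?_).symm
  simp at hj
  omega

variable (k : Type*) [Field k] {R : Type*} [AddCommGroup R] [Module k R]

/-- The converse of `Δ_pow_expand`: if `f` is a combination of derivatives of the delta function
with coefficients `u s`, then multiplication by `(z - w)ⁿ` shifts the coefficients by `n`. -/
theorem Δ_pow_of_expand (M : ℕ) (u : ℕ → ℤ → R) (hu : ∀ s ≥ M, u s = 0) (f : ℤ → ℤ → R)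
    (hf : ∀ p q, f p q = ∑ s ∈ Finset.range M, Ring.choose p s • u s (p + q - s)) (n : ℕ)
    (p q : ℤ) : (Δ k ^ n) f p q =
      ∑ s ∈ Finset.range M, Ring.choose p s • u (n + s) (p + q - s) := by
  induction n generalizing p q with
  | zero => simpa using hf p q
  | succ n ih =>
    rw [Δ_pow_succ, ih, ih, ← Finset.sum_sub_distrib]
    have h1 : ∑ s ∈ Finset.range M, (Ring.choose (p + 1) s • u (n + s) (p + 1 + q - s) -
        Ring.choose p s • u (n + s) (p + (q + 1) - s)) = ∑ s ∈ Finset.range (M + 1),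
          (Ring.choose (p + 1) s - Ring.choose p s) • u (n + s) (p + q + 1 - s) := by
      rw [Finset.sum_range_succ _ M, hu (n + M) (by omega), Pi.zero_apply, smul_zero, add_zero]
      refine Finset.sum_congr rfl fun s _ => ?_
      rw [sub_smul, show p + 1 + q - s = p + q + 1 - s by ring,
        show p + (q + 1) - s = p + q + 1 - s by ring]
    rw [h1, Finset.sum_range_succ']
    simp only [Ring.choose_zero_right, sub_self, zero_smul, add_zero]
    refine Finset.sum_congr rfl fun s _ => ?_
    rw [Ring.choose_succ_succ, add_sub_cancel_right, show n + (s + 1) = n + 1 + s by omega,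
      show p + q + 1 - ((s + 1 : ℕ) : ℤ) = p + q - s by push_cast; ring]

variable {C : Type*} [AddCommGroup C] [Module k C] [ConformalAlgebra k C]

variable (C) in
/-- The relations `(∂a)(n) = -n a(n-1)` between the modes. -/
def modeRel : Submodule k (ℤ →₀ C) := Submodule.span k
  (Set.range fun na : ℤ × C => Finsupp.single na.1 (D k na.2) +
    (na.1 : k) • Finsupp.single (na.1 - 1) na.2)

variable (C) in
/-- The space of modes `a(n)`, `n ∈ ℤ`, of the elements of a conformal algebra. -/
def Modes : Type _ := (ℤ →₀ C) ⧸ modeRel k C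

instance : AddCommGroup (Modes k C) := inferInstanceAs (AddCommGroup ((ℤ →₀ C) ⧸ modeRel k C))
instance : Module k (Modes k C) := inferInstanceAs (Module k ((ℤ →₀ C) ⧸ modeRel k C))

/-- The mode `a(n)`. -/
def mode (n : ℤ) : C →ₗ[k] Modes k C := (modeRel k C).mkQ.comp (Finsupp.lsingle n)

variable {k} in
theorem Modes.ind {p : Modes k C → Prop} (hm : ∀ n a, p (mode k n a))
    (ha : ∀ u v, p u → p v → p (u + v)) (u : Modes k C) : p u := by
  obtain ⟨u, rfl⟩ := (modeRel k C).mkQ_surjective u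
  induction u using Finsupp.induction_linear with
  | zero =>
    have h := hm 0 0
    rw [map_zero] at h
    exact h
  | add u v hu hv => rw [map_add]; exact ha _ _ hu hv
  | single n a => exact hm n a

theorem mode_D (n : ℤ) (a : C) : mode k n (D k a) = -((n : k) • mode k (n - 1) a) := by
  refine eq_neg_of_add_eq_zero_left ?_
  refine (Submodule.Quotient.mk_eq_zero _).2 ?_
  exact Submodule.subset_span ⟨(n, a), rfl⟩

/-- The sequence of modes of an element. -/
def modes : C →ₗ[k] (ℤ → Modes k C) := LinearMap.pi (mode k)

theorem modes_apply (a : C) (n : ℤ) : modes k a n = mode k n a := rfl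

theorem modes_D (a : C) : modes k (D k a) = seqD k (modes k a) := by
  ext n
  exact mode_D k n a

theorem mode_D_pow [CharZero k] (s : ℕ) (n : ℤ) (a : C) : mode k n ((D k ^ s) a) =
    ((-1 : k) ^ s * s.factorial) • Ring.choose n s • mode k (n - s) a := by
  have h : modes k ((D k ^ s) a) = (seqD k ^ s) (modes k a) := by
    induction s with
    | zero => rfl
    | succ s ih =>
      rw [pow_succ', pow_succ', Module.End.mul_apply, Module.End.mul_apply, modes_D, ih]
  exact (congrFun h n).trans (seqD_pow_apply s _ n)

/-- In characteristic zero a conformal algebra embeds into its coefficient algebra by `a ↦ a(-1)`.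
-/
theorem mode_neg_one_injective [CharZero k] : Function.Injective (mode k (C := C) (-1)) := by
  -- the left inverse sends `a(-j-1)` to `∂ʲa / j!` and the other modes to `0`
  let F : ℤ → C →ₗ[k] C := fun n =>
    if n < 0 then ((-n - 1).toNat.factorial : k)⁻¹ • D k ^ (-n - 1).toNat else 0
  have hF : ∀ (n : ℤ) (a : C), F n (D k a) + (n : k) • F (n - 1) a = 0 := by
    intro n a
    simp only [F]
    rcases lt_trichotomy n 0 with hn | rfl | hn
    · obtain ⟨j, rfl⟩ : ∃ j : ℕ, n = -(j : ℤ) - 1 := ⟨(-n - 1).toNat, by omega⟩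
      rw [if_pos hn, if_pos (by omega), show (-(-(j : ℤ) - 1) - 1).toNat = j by omega,
        show (-(-(j : ℤ) - 1 - 1) - 1).toNat = j + 1 by omega, LinearMap.smul_apply,
        LinearMap.smul_apply, ← Module.End.mul_apply, ← pow_succ, smul_smul, ← add_smul,
        Nat.factorial_succ]
      have h1 : (j.factorial : k) ≠ 0 := Nat.cast_ne_zero.2 j.factorial_ne_zero
      have h2 : (j : k) + 1 ≠ 0 := by exact_mod_cast j.succ_ne_zero
      convert zero_smul k _
      push_cast
      field_simp
      ring
    · simp
    · rw [if_neg (by omega), if_neg (by omega)]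
      simp
  have hle : modeRel k C ≤ LinearMap.ker (Finsupp.lsum k F) := by
    refine Submodule.span_le.2 ?_
    rintro _ ⟨⟨n, a⟩, rfl⟩
    rw [SetLike.mem_coe, LinearMap.mem_ker, map_add, map_smul, Finsupp.lsum_single,
      Finsupp.lsum_single]
    exact hF n a
  refine Function.LeftInverse.injective (g := (modeRel k C).liftQ _ hle) fun a => ?_
  have : (modeRel k C).liftQ _ hle (mode k (-1) a) = F (-1) a :=
    Finsupp.lsum_single k F (-1) a
  rw [this]
  simp [F]

theorem modes_injective [CharZero k] : Function.Injective (modes k (C := C)) :=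
  fun _ _ h => mode_neg_one_injective k (congrFun h (-1))

/-- The bilinear map `(a, b) ↦ ∑ₛ (n choose s) (a (s) b)(n+m-s)`. -/
def modeBil (n m : ℤ) : C →ₗ[k] C →ₗ[k] Modes k C := by
  have hfin : ∀ (a b : C), (Function.support fun s : ℕ =>
      Ring.choose n s • mode k (n + m - s) (nprod k s a b)).Finite := by
    intro a b
    obtain ⟨M, hM⟩ := ConformalAlgebra.locality (k := k) a b
    refine (Finset.range M).finite_toSet.subset fun s hs => ?_
    by_contra h
    refine hs ?_
    have : nprod k s a b = 0 := hM s (by simpa using h)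
    simp [this]
  exact LinearMap.mk₂ k
    (fun a b => ∑ᶠ s : ℕ, Ring.choose n s • mode k (n + m - s) (nprod k s a b))
    (fun a a' b => by
      rw [← finsum_add_distrib (hfin a b) (hfin a' b)]
      simp only [map_add, LinearMap.add_apply, smul_add])
    (fun c a b => by
      rw [smul_finsum' _ (hfin a b)]
      simp only [map_smul, LinearMap.smul_apply, smul_comm c])
    (fun a b b' => by
      rw [← finsum_add_distrib (hfin a b) (hfin a b')]
      simp only [map_add, smul_add])
    (fun c a b => by
      rw [smul_finsum' _ (hfin a b)]
      simp only [map_smul, smul_comm c])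

theorem modeBil_eq_sum (n m : ℤ) (a b : C) (M : ℕ) (h : ∀ s ≥ M, nprod k s a b = 0) :
    modeBil k n m a b =
      ∑ s ∈ Finset.range M, Ring.choose n s • mode k (n + m - s) (nprod k s a b) := by
  refine finsum_eq_sum_of_support_subset _ fun s hs => ?_
  by_contra hM
  refine hs ?_
  have : nprod k s a b = 0 := h s (by simpa using hM)
  simp [this]

/-- The bilinear map of `modeBil` on formal combinations of modes. -/
def modeBil' : (ℤ →₀ C) →ₗ[k] (ℤ →₀ C) →ₗ[k] Modes k C :=
  Finsupp.lsum k fun n => (Finsupp.lsum k fun m => (modeBil k n m).flip).flip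

theorem modeBil'_single (n m : ℤ) (a b : C) :
    modeBil' k (Finsupp.single n a) (Finsupp.single m b) = modeBil k n m a b := by
  simp [modeBil']

theorem modeBil_D_left (n m : ℤ) (a b : C) :
    modeBil k n m (D k a) b + (n : k) • modeBil k (n - 1) m a b = 0 := by
  obtain ⟨M, hM⟩ := ConformalAlgebra.locality (k := k) a b
  replace hM : ∀ s ≥ M, nprod k s a b = 0 := hM
  rw [modeBil_eq_sum k (n - 1) m a b M hM, modeBil_eq_sum k n m (D k a) b (M + 1),
    Finset.sum_range_succ', Finset.smul_sum]
  · simp only [nprod_D_left, Nat.cast_zero, zero_smul, neg_zero, map_zero, smul_zero, add_zero,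
      Nat.add_sub_cancel]
    rw [← Finset.sum_add_distrib]
    refine Finset.sum_eq_zero fun s _ => ?_
    rw [show n + m - ((s + 1 : ℕ) : ℤ) = n - 1 + m - s by push_cast; ring, map_neg, map_smul,
      ← Int.cast_smul_eq_zsmul k, ← Int.cast_smul_eq_zsmul k, smul_neg, smul_smul, smul_smul,
      neg_add_eq_zero]
    congr 1
    have := congrArg (Int.cast : ℤ → k) (succ_mul_choose n s)
    push_cast at this ⊢
    linear_combination this
  · intro s hs
    rw [nprod_D_left, hM (s - 1) (by omega), smul_zero, neg_zero]

theorem modeBil_D_right (n m : ℤ) (a b : C) :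
    modeBil k n m a (D k b) + (m : k) • modeBil k n (m - 1) a b = 0 := by
  obtain ⟨M, hM⟩ := ConformalAlgebra.locality (k := k) a b
  replace hM : ∀ s ≥ M, nprod k s a b = 0 := hM
  rw [modeBil_eq_sum k n (m - 1) a b M hM, modeBil_eq_sum k n m a (D k b) (M + 1),
    Finset.smul_sum]
  · simp only [nprod_D_right, map_add, smul_add, Finset.sum_add_distrib, mode_D]
    rw [Finset.sum_range_succ, hM M le_rfl, Finset.sum_range_succ']
    simp only [Nat.cast_zero, zero_smul, map_zero, smul_zero, add_zero, neg_zero,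
      Nat.add_sub_cancel]
    rw [← Finset.sum_add_distrib, ← Finset.sum_add_distrib]
    refine Finset.sum_eq_zero fun s _ => ?_
    rw [show n + m - ((s + 1 : ℕ) : ℤ) = n + m - s - 1 by push_cast; ring,
      show n + (m - 1) - (s : ℤ) = n + m - s - 1 by ring, map_smul]
    simp only [← Int.cast_smul_eq_zsmul k, smul_neg, smul_smul]
    rw [← neg_smul, ← add_smul, ← add_smul]
    convert zero_smul k _
    have h1 := congrArg (Int.cast : ℤ → k) (succ_mul_choose n s)
    have h2 := congrArg (Int.cast : ℤ → k) (sub_mul_choose n s)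
    push_cast at h1 h2 ⊢
    linear_combination h1 - h2
  · intro s hs
    rw [nprod_D_right, hM (s - 1) (by omega), hM s (by omega)]
    simp

/-- The product `a(n) b(m) = ∑ₛ (n choose s) (a (s) b)(n+m-s)` of modes. -/
def modeMul : Modes k C →ₗ[k] Modes k C →ₗ[k] Modes k C :=
  qlift₂ (modeRel k C) (modeRel k C) (modeBil' k)
    (fun u hu v => by
      have : modeRel k C ≤ LinearMap.ker (modeBil' k (C := C)) := by
        refine Submodule.span_le.2 ?_
        rintro _ ⟨⟨n, a⟩, rfl⟩
        refine LinearMap.mem_ker.2 ?_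
        ext m b
        simpa [modeBil'_single] using modeBil_D_left k n m a b
      rw [LinearMap.mem_ker.1 (this hu), LinearMap.zero_apply])
    (fun u v hv => by
      have : modeRel k C ≤ LinearMap.ker (modeBil' k (C := C)).flip := by
        refine Submodule.span_le.2 ?_
        rintro _ ⟨⟨n, a⟩, rfl⟩
        refine LinearMap.mem_ker.2 ?_
        ext m b
        simpa [modeBil'_single] using modeBil_D_right k m n b a
      have h := LinearMap.mem_ker.1 (this hv)
      exact LinearMap.congr_fun h u)

theorem modeMul_mode (n m : ℤ) (a b : C) (M : ℕ) (h : ∀ s ≥ M, nprod k s a b = 0) :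
    modeMul k (mode k n a) (mode k m b) =
      ∑ s ∈ Finset.range M, Ring.choose n s • mode k (n + m - s) (nprod k s a b) := by
  rw [← modeBil_eq_sum k n m a b M h, ← modeBil'_single]
  rfl

theorem Δ_pow_modeMul (n : ℕ) (a b : C) (M : ℕ) (h : ∀ s ≥ M, nprod k s a b = 0) (p q : ℤ) :
    (Δ k ^ n) (fun p q => modeMul k (mode k p a) (mode k q b)) p q =
      ∑ s ∈ Finset.range M, Ring.choose p s • mode k (p + q - s) (nprod k (n + s) a b) := by
  refine Δ_pow_of_expand k M (fun s => modes k (nprod k s a b)) (fun s hs => ?_) _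
    (fun p q => modeMul_mode k p q a b M h) n p q
  simp only [h s hs, map_zero]

theorem sum_choose_zero_smul (M : ℕ) (u : ℕ → R) (hu : ∀ s ≥ M, u s = 0) :
    ∑ s ∈ Finset.range M, Ring.choose (0 : ℤ) s • u s = u 0 := by
  rcases M with _ | M
  · simp [hu 0 le_rfl]
  · rw [Finset.sum_range_succ', Finset.sum_eq_zero]
    · simp
    · intro s _
      rw [Ring.choose_zero_succ, zero_smul]

/-- The sequence of modes is a homomorphism. -/
theorem modes_nprod (n : ℕ) (a b : C) :
    modes k (nprod k n a b) = seqMul (modeMul k) n (modes k a) (modes k b) := by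
  obtain ⟨M, hM⟩ := ConformalAlgebra.locality (k := k) a b
  replace hM : ∀ s ≥ M, nprod k s a b = 0 := hM
  ext m
  rw [seqMul_eq]
  refine Eq.trans ?_ (Δ_pow_modeMul k n a b M hM 0 m).symm
  rw [sum_choose_zero_smul M fun s => mode k (0 + m - s) (nprod k (n + s) a b)]
  · simp [modes_apply]
  · intro s hs
    rw [hM (n + s) (by omega), map_zero]

/-- Associativity with the summation index reversed. -/
theorem IsAssoc.nprod_nprod (hA : IsAssoc k C) (s r : ℕ) (a b c : C) :
    nprod k s a (nprod k r b c) = ∑ i ∈ Finset.range (s + 1),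
      s.choose i • nprod k (r + (s - i)) (nprod k i a b) c := by
  rw [hA, ← Finset.sum_range_reflect]
  refine Finset.sum_congr rfl fun i hi => ?_
  have hi' : i ≤ s := Nat.lt_succ_iff.1 (Finset.mem_range.1 hi)
  rw [Nat.cast_smul_eq_nsmul, show s + 1 - 1 - i = s - i by omega, Nat.choose_symm hi',
    Nat.sub_sub_self hi']

/-- The Vandermonde identity behind the associativity of the multiplication of modes. -/
theorem sum_choose_mul_choose (n m : ℤ) (i r : ℕ) : ∑ j ∈ Finset.range (r + 1),
    Ring.choose m (r - j) * Ring.choose n (i + j) * ((i + j).choose i : ℤ) =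
      Ring.choose n i * Ring.choose (n + m - i) r := by
  rw [show n + m - i = (n - i) + m by ring, Ring.add_choose_eq r (Commute.all _ _),
    Finset.Nat.sum_antidiagonal_eq_sum_range_succ_mk, Finset.mul_sum]
  refine Finset.sum_congr rfl fun j _ => ?_
  have := Ring.choose_smul_choose n (n := i + j) (k := i) (by omega)
  simp only [nsmul_eq_mul, Nat.add_sub_cancel_left] at this
  linear_combination Ring.choose m (r - j) * this

/-- The coefficient algebra of an associative conformal algebra is associative: both sides are sums
of modes of the elements `((a (i) b) (t-i) c)`, and the coefficients agree by
`sum_choose_mul_choose`. -/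
theorem modeMul_assoc (hA : IsAssoc k C) (u v w : Modes k C) :
    modeMul k u (modeMul k v w) = modeMul k (modeMul k u v) w := by
  induction u using Modes.ind with
  | ha u u' hu hu' => simp only [map_add, LinearMap.add_apply, hu, hu']
  | hm n a =>
  induction v using Modes.ind with
  | ha v v' hv hv' => simp only [map_add, LinearMap.add_apply, hv, hv']
  | hm m b =>
  induction w using Modes.ind with
  | ha w w' hw hw' => simp only [map_add, hw, hw']
  | hm l c =>
  have huni : ∀ (u : ℕ → C) (N : ℕ), (∀ s ≥ N, u s = 0) → ∀ c : C,
      ∃ M, (∀ s, ∀ r ≥ M, nprod k r (u s) c = 0) ∧ ∀ s, ∀ r ≥ M, nprod k r c (u s) = 0 := by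
    intro u N hN c
    choose f hf using fun s => ConformalAlgebra.locality (k := k) (u s) c
    choose f' hf' using fun s => ConformalAlgebra.locality (k := k) c (u s)
    refine ⟨(Finset.range N).sup f ⊔ (Finset.range N).sup f', fun s r hr => ?_, fun s r hr => ?_⟩
    · by_cases hs : s < N
      · exact hf s r (le_trans (le_trans (Finset.le_sup (f := f) (Finset.mem_range.2 hs))
          le_sup_left) hr)
      · rw [hN s (by omega), map_zero, LinearMap.zero_apply]
    · by_cases hs : s < N
      · exact hf' s r (le_trans (le_trans (Finset.le_sup (f := f') (Finset.mem_range.2 hs))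
          le_sup_right) hr)
      · rw [hN s (by omega), map_zero]
  obtain ⟨M₁, h₁⟩ := ConformalAlgebra.locality (k := k) a b
  obtain ⟨M₂, h₂⟩ := ConformalAlgebra.locality (k := k) b c
  obtain ⟨M₃, h₃, -⟩ := huni (fun s => nprod k s a b) M₁ h₁ c
  obtain ⟨M₄, -, h₄⟩ := huni (fun s => nprod k s b c) M₂ h₂ a
  -- all indices that contribute are below `T`
  obtain ⟨T, hT₁, hT₂⟩ : ∃ T, M₁ + M₃ ≤ T ∧ M₂ + M₄ ≤ T := ⟨_, le_max_left _ _, le_max_right _ _⟩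
  have h₁' : ∀ s ≥ T, nprod k s a b = 0 := fun s hs => h₁ s (by omega)
  have h₂' : ∀ s ≥ T, nprod k s b c = 0 := fun s hs => h₂ s (by omega)
  have hL : modeMul k (modeMul k (mode k n a) (mode k m b)) (mode k l c) =
      ∑ t ∈ Finset.range T, ∑ i ∈ Finset.range (t + 1),
        (Ring.choose n i * Ring.choose (n + m - i) (t - i)) •
          mode k (n + m + l - t) (nprod k (t - i) (nprod k i a b) c) := by
    rw [modeMul_mode k n m a b T h₁', map_sum, LinearMap.sum_apply]
    have e : ∀ s ∈ Finset.range T, modeMul k (Ring.choose n s •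
        mode k (n + m - s) (nprod k s a b)) (mode k l c) = ∑ r ∈ Finset.range T,
          (Ring.choose n s * Ring.choose (n + m - s) r) •
            mode k (n + m - s + l - r) (nprod k r (nprod k s a b) c) := by
      intro s _
      rw [map_zsmul, LinearMap.smul_apply, modeMul_mode k _ l _ c T fun r hr => h₃ s r (by omega),
        Finset.smul_sum]
      simp only [smul_smul]
    rw [Finset.sum_congr rfl e, sum_square_eq_sum_diag]
    · refine Finset.sum_congr rfl fun t _ => Finset.sum_congr rfl fun i hi => ?_
      have hi' : i ≤ t := Nat.lt_succ_iff.1 (Finset.mem_range.1 hi)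
      congr 3
      push_cast [hi']
      ring
    · intro s r hsr
      have : nprod k r (nprod k s a b) c = 0 := by
        by_cases hs : M₁ ≤ s
        · have : nprod k s a b = 0 := h₁ s hs
          rw [this, map_zero, LinearMap.zero_apply]
        · exact h₃ s r (by omega)
      rw [this, map_zero, smul_zero]
  have hR : modeMul k (mode k n a) (modeMul k (mode k m b) (mode k l c)) =
      ∑ t ∈ Finset.range T, ∑ s ∈ Finset.range (t + 1),
        (Ring.choose m (t - s) * Ring.choose n s) •
          mode k (n + m + l - t) (nprod k s a (nprod k (t - s) b c)) := by
    rw [modeMul_mode k m l b c T h₂', map_sum]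
    have e : ∀ r ∈ Finset.range T, modeMul k (mode k n a) (Ring.choose m r •
        mode k (m + l - r) (nprod k r b c)) = ∑ s ∈ Finset.range T,
          (Ring.choose m r * Ring.choose n s) •
            mode k (n + (m + l - r) - s) (nprod k s a (nprod k r b c)) := by
      intro r _
      rw [map_zsmul, modeMul_mode k n _ a _ T fun s hs => h₄ r s (by omega), Finset.smul_sum]
      simp only [smul_smul]
    rw [Finset.sum_congr rfl e, Finset.sum_comm, sum_square_eq_sum_diag]
    · refine Finset.sum_congr rfl fun t _ => Finset.sum_congr rfl fun i hi => ?_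
      have hi' : i ≤ t := Nat.lt_succ_iff.1 (Finset.mem_range.1 hi)
      congr 3
      push_cast [hi']
      ring
    · intro s r hsr
      have : nprod k s a (nprod k r b c) = 0 := by
        by_cases hr : M₂ ≤ r
        · have : nprod k r b c = 0 := h₂ r hr
          rw [this, map_zero]
        · exact h₄ r s (by omega)
      rw [this, map_zero, smul_zero]
  rw [hL, hR]
  refine Finset.sum_congr rfl fun t _ => ?_
  let H : ℕ → ℕ → Modes k C := fun i j =>
    (Ring.choose m (t - i - j) * Ring.choose n (i + j) * ((i + j).choose i : ℤ)) •
      mode k (n + m + l - t) (nprod k (t - i) (nprod k i a b) c)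
  have e : ∀ s ∈ Finset.range (t + 1), (Ring.choose m (t - s) * Ring.choose n s) •
      mode k (n + m + l - t) (nprod k s a (nprod k (t - s) b c)) =
        ∑ i ∈ Finset.range (s + 1), H i (s - i) := by
    intro s hs
    have hs' : s ≤ t := Nat.lt_succ_iff.1 (Finset.mem_range.1 hs)
    rw [hA.nprod_nprod, map_sum, Finset.smul_sum]
    refine Finset.sum_congr rfl fun i hi => ?_
    have hi' : i ≤ s := Nat.lt_succ_iff.1 (Finset.mem_range.1 hi)
    simp only [H]
    rw [map_nsmul, ← natCast_zsmul, smul_smul, show i + (s - i) = s by omega,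
      show t - i - (s - i) = t - s by omega, show t - s + (s - i) = t - i by omega]
  rw [Finset.sum_congr rfl e]
  refine (Finset.sum_range_diag_flip (t + 1) H).trans ?_
  refine Finset.sum_congr rfl fun i hi => ?_
  have hi' : i ≤ t := Nat.lt_succ_iff.1 (Finset.mem_range.1 hi)
  simp only [H]
  rw [← Finset.sum_smul, show t + 1 - i = t - i + 1 by omega, sum_choose_mul_choose]

/-- The Vandermonde identity behind `modeMul_mode_swap`. -/
theorem sum_neg_one_pow_mul_choose (n m : ℤ) (t : ℕ) : ∑ s ∈ Finset.range (t + 1),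
    (-1 : ℤ) ^ s * (Ring.choose n s * Ring.choose (n + m - s) (t - s)) = Ring.choose m t := by
  have e : ∀ s ∈ Finset.range (t + 1),
      (-1 : ℤ) ^ s * (Ring.choose n s * Ring.choose (n + m - s) (t - s)) =
        (-1) ^ t * (Ring.choose n s * Ring.choose (t - 1 - n - m) (t - s)) := by
    intro s hs
    have hs' : s ≤ t := Nat.lt_succ_iff.1 (Finset.mem_range.1 hs)
    have := Ring.choose_neg (s - n - m) (t - s)
    rw [show -((s : ℤ) - n - m) = n + m - s by ring] at this
    rw [this, show (s : ℤ) - n - m + ((t - s : ℕ) : ℤ) - 1 = t - 1 - n - m by push_cast [hs']; ring]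
    obtain ⟨j, rfl⟩ := Nat.exists_eq_add_of_le hs'
    rw [Nat.add_sub_cancel_left, pow_add, Int.negOnePow_def, Units.smul_def]
    simp
    ring
  rw [Finset.sum_congr rfl e, ← Finset.mul_sum]
  have h := Ring.add_choose_eq t (Commute.all n ((t : ℤ) - 1 - n - m))
  rw [Finset.Nat.sum_antidiagonal_eq_sum_range_succ_mk] at h
  rw [← h]
  have h2 := Ring.choose_neg (-m) t
  rw [neg_neg] at h2
  rw [h2, show n + ((t : ℤ) - 1 - n - m) = -m + t - 1 by ring, Int.negOnePow_def, Units.smul_def]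
  simp

/-- The product of modes in the opposite order is given by the products `(b (-∂-λ) a)`. -/
theorem modeMul_mode_swap [CharZero k] (n m : ℤ) (a b : C) (M : ℕ)
    (h : ∀ s ≥ M, nprod k s b a = 0) : modeMul k (mode k m b) (mode k n a) =
      ∑ s ∈ Finset.range M, Ring.choose n s • mode k (n + m - s) (opp k s a b) := by
  have e : ∀ s ∈ Finset.range M, Ring.choose n s • mode k (n + m - s) (opp k s a b) =
      ∑ r ∈ Finset.range M, ((-1 : ℤ) ^ s * (Ring.choose n s * Ring.choose (n + m - s) r)) •
        mode k (n + m - s - r) (nprod k (s + r) b a) := by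
    intro s _
    rw [opp_eq_sum s M a b h, map_sum, Finset.smul_sum]
    refine Finset.sum_congr rfl fun r _ => ?_
    rw [map_smul, mode_D_pow]
    simp only [← Int.cast_smul_eq_zsmul k, smul_smul]
    congr 1
    have : (r.factorial : k) ≠ 0 := Nat.cast_ne_zero.2 r.factorial_ne_zero
    push_cast
    field_simp
    rw [pow_add, mul_assoc, mul_assoc, mul_assoc, ← mul_assoc ((-1 : k) ^ r), ← pow_add,
      Even.neg_one_pow ⟨r, rfl⟩]
    ring
  rw [Finset.sum_congr rfl e, sum_square_eq_sum_diag, modeMul_mode k m n b a M h]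
  · refine Finset.sum_congr rfl fun t _ => ?_
    rw [← sum_neg_one_pow_mul_choose n m t, Finset.sum_smul]
    refine Finset.sum_congr rfl fun s hs => ?_
    have hs' : s ≤ t := Nat.lt_succ_iff.1 (Finset.mem_range.1 hs)
    rw [show s + (t - s) = t by omega]
    congr 2
    push_cast [hs']
    ring_nf
  · intro s r hsr
    rw [h _ hsr, map_zero, smul_zero]

theorem opp_eq_zero {n M : ℕ} {a b : C} (h : ∀ s ≥ M, nprod k s b a = 0) (hn : M ≤ n) :
    opp k n a b = 0 := by
  rw [opp_eq_sum n M a b h]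
  refine Finset.sum_eq_zero fun s _ => ?_
  rw [h _ (by omega), map_zero, smul_zero]

/-- The sequence of modes of the `n`-th coefficient of `(b (-∂-λ) a)` is the `n`-product with
respect to the opposite multiplication. -/
theorem modes_opp [CharZero k] (n : ℕ) (a b : C) :
    modes k (opp k n a b) = seqMul (modeMul k).flip n (modes k a) (modes k b) := by
  obtain ⟨M, hM⟩ := ConformalAlgebra.locality (k := k) b a
  replace hM : ∀ s ≥ M, nprod k s b a = 0 := hM
  ext m
  rw [seqMul_eq]
  have h := Δ_pow_of_expand k M (fun s => modes k (opp k s a b))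
    (fun s hs => by simp only [opp_eq_zero k hM hs, map_zero]) _
    (fun p q => modeMul_mode_swap k p q a b M hM) n 0 m
  refine Eq.trans ?_ h.symm
  rw [sum_choose_zero_smul M fun s => modes k (opp k (n + s) a b) (0 + m - s)]
  · simp
  · intro s hs
    rw [opp_eq_zero k hM (by omega), map_zero, Pi.zero_apply]

/-- The modes of two elements commute if all commutators of the elements vanish. -/
theorem modeMul_comm_of_comm [CharZero k] {a b : C} (h : ∀ n, nprod k n a b = opp k n a b)
    (n m : ℤ) : modeMul k (mode k n a) (mode k m b) = modeMul k (mode k m b) (mode k n a) := by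
  obtain ⟨M, hM⟩ := ConformalAlgebra.locality (k := k) a b
  obtain ⟨M', hM'⟩ := ConformalAlgebra.locality (k := k) b a
  rw [modeMul_mode k n m a b (max M M') fun s hs => hM s (le_trans (le_max_left _ _) hs),
    modeMul_mode_swap k n m a b (max M M') fun s hs => hM' s (le_trans (le_max_right _ _) hs)]
  simp only [h]

theorem modeMul_comm [CharZero k] (hc : IsCommutative k C) (u v : Modes k C) :
    modeMul k u v = modeMul k v u := by
  induction u using Modes.ind with
  | ha u u' hu hu' => simp only [map_add, LinearMap.add_apply, hu, hu']
  | hm n a =>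
  induction v using Modes.ind with
  | ha v v' hv hv' => simp only [map_add, LinearMap.add_apply, hv, hv']
  | hm m b => exact modeMul_comm_of_comm k (fun n => hc n a b) n m

/-- An associative conformal algebra that is generated by commuting elements is commutative. -/
theorem isCommutative_of_generates [CharZero k] (hA : IsAssoc k C) {ι : Type*} {x : ι → C}
    (hx : Generates k x) (h : ∀ n i j, nprod k n (x i) (x j) = opp k n (x i) (x j)) :
    IsCommutative k C := by
  -- the elements whose modes lie in a subspace of modes that is stable under multiplication
  have key : ∀ Z : Submodule k (Modes k C), (∀ i n, mode k n (x i) ∈ Z) →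
      (∀ u ∈ Z, ∀ v ∈ Z, modeMul k u v ∈ Z) → ∀ (a : C) n, mode k n a ∈ Z := by
    intro Z h1 h2 a
    let S : Submodule k C := ⨅ n, Z.comap (mode k n)
    have hS : S = ⊤ := by
      refine hx S (fun i => ?_) (fun a ha => ?_) fun n a ha b hb => ?_
      · simpa [S] using h1 i
      · simp only [S, Submodule.mem_iInf, Submodule.mem_comap, mode_D] at ha ⊢
        exact fun n => Z.neg_mem (Z.smul_mem _ (ha _))
      · simp only [S, Submodule.mem_iInf, Submodule.mem_comap] at ha hb ⊢
        intro m
        have := congrFun (modes_nprod k n a b) m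
        rw [modes_apply] at this
        rw [this]
        exact seqMul_mem _ n Z (fun p q => h2 _ (ha p) _ (hb q)) m
    have : a ∈ S := hS ▸ Submodule.mem_top
    simpa [S] using this
  -- the centralizer of a set of modes
  have hcent : ∀ T : Set (Modes k C), (∀ i n, ∀ v ∈ T, modeMul k (mode k n (x i)) v =
      modeMul k v (mode k n (x i))) → ∀ (a : C) n, ∀ v ∈ T,
        modeMul k (mode k n a) v = modeMul k v (mode k n a) := by
    intro T hT a n v hv
    let Z : Submodule k (Modes k C) := ⨅ v : T, LinearMap.ker ((modeMul k).flip v - modeMul k v)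
    have hZ : ∀ u, u ∈ Z ↔ ∀ v ∈ T, modeMul k u v = modeMul k v u := by
      intro u
      simp [Z, sub_eq_zero]
    refine (hZ _).1 (key Z (fun i n => (hZ _).2 (hT i n)) (fun u hu u' hu' => ?_) a n) v hv
    rw [hZ] at hu hu' ⊢
    intro v hv
    rw [← modeMul_assoc k hA, hu' v hv, modeMul_assoc k hA, hu v hv, modeMul_assoc k hA]
  have h1 := hcent (Set.range fun jm : ι × ℤ => mode k jm.2 (x jm.1)) (by
    rintro i n _ ⟨⟨j, m⟩, rfl⟩
    exact modeMul_comm_of_comm k (fun n => h n i j) n m)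
  have h2 := hcent (Set.range fun am : C × ℤ => mode k am.2 am.1) (by
    rintro i n _ ⟨⟨a, m⟩, rfl⟩
    exact (h1 a m _ ⟨(i, n), rfl⟩).symm)
  intro n a b
  refine modes_injective k ?_
  rw [modes_nprod, modes_opp]
  have h3 : (fun p q => modeMul k (modes k a p) (modes k b q)) =
      fun p q => (modeMul k).flip (modes k a p) (modes k b q) := by
    funext p q
    exact h2 a p _ ⟨(b, q), rfl⟩
  funext m
  rw [seqMul_eq, seqMul_eq, h3]

end Modes

/-! ### Graded algebras of filtered conformal algebras -/

section GradedFacts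

variable {k : Type*} [Field k] {C : Type*} [AddCommGroup C] [Module k C] [ConformalAlgebra k C]

/-- Elements annihilated by `∂` (torsion) are annihilated by all products. -/
theorem nprod_eq_zero_of_D_left [CharZero k] {a : C} (ha : D k a = 0) (n : ℕ) (b : C) :
    nprod k n a b = 0 := by
  have h := nprod_D_left (k := k) (n + 1) a b
  rw [ha, map_zero, LinearMap.zero_apply, zero_eq_neg, Nat.add_sub_cancel] at h
  exact (smul_eq_zero.1 h).resolve_left (Nat.cast_ne_zero.2 n.succ_ne_zero)

theorem nprod_eq_zero_of_D_right [CharZero k] {a : C} (ha : D k a = 0) (n : ℕ) (b : C) :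
    nprod k n b a = 0 := by
  have h : ∀ n, nprod k (n + 1) b a = 0 → nprod k n b a = 0 := by
    intro n hn
    have h := nprod_D_right (k := k) (n + 1) b a
    rw [ha, map_zero, hn, map_zero, zero_add, Nat.add_sub_cancel] at h
    exact (smul_eq_zero.1 h.symm).resolve_left (Nat.cast_ne_zero.2 n.succ_ne_zero)
  obtain ⟨M, hM⟩ := ConformalAlgebra.locality (k := k) b a
  have h2 : ∀ j, nprod k (M - j) b a = 0 := by
    intro j
    induction j with
    | zero => exact hM M le_rfl
    | succ j ih =>
      by_cases hj : j < M
      · refine h _ ?_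
        rwa [show M - (j + 1) + 1 = M - j by omega]
      · rwa [show M - (j + 1) = M - j by omega]
  by_cases hn : M ≤ n
  · exact hM n hn
  · have := h2 (M - n)
    rwa [show M - (M - n) = n by omega] at this

theorem range_eq_top_of_generates {C' : Type*} [AddCommGroup C'] [Module k C']
    [ConformalAlgebra k C'] {ι : Type*} {x : ι → C'} (hx : Generates k x) {f : C →ₗ[k] C'}
    (hf : IsHom f) (h : ∀ i, x i ∈ LinearMap.range f) : LinearMap.range f = ⊤ := by
  refine hx _ h ?_ ?_
  · rintro _ ⟨a, rfl⟩
    exact ⟨D k a, hf.1 a⟩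
  · rintro n _ ⟨a, rfl⟩ _ ⟨b, rfl⟩
    exact ⟨nprod k n a b, hf.2 n a b⟩

variable {ι : Type*} (x : ι → C)

variable (k) in
/-- The symbol as a linear map. -/
def Gr.symbolₗ (p : ℕ) : fil k x p →ₗ[k] Gr k x := (Gr.of k x p).comp (Submodule.mkQ _)

theorem Gr.symbolₗ_apply (p : ℕ) (a : fil k x p) : Gr.symbolₗ k x p a = Gr.symbol k x p a := rfl

theorem Gr.symbol_congr {p q : ℕ} (h : p = q) {a : fil k x p} {b : fil k x q} (hab : (a : C) = b) :
    Gr.symbol k x p a = Gr.symbol k x q b := by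
  subst h
  rw [Subtype.ext hab]

theorem Gr.symbol_eq_zero {p : ℕ} {a : fil k x p} (ha : (a : C) ∈ fil k x (p - 1)) :
    Gr.symbol k x p a = 0 := by
  have : (Submodule.Quotient.mk a : GrPiece k x p) = 0 := (Submodule.Quotient.mk_eq_zero _).2 ha
  rw [Gr.symbol, this, map_zero]

theorem Gr.D_symbol' (p : ℕ) (a : fil k x p) :
    Conf.D k (Gr.symbol k x p a) = Gr.symbol k x p ⟨Conf.D k (a : C), D_mem_fil x a.2⟩ :=
  Gr.D_symbol k x p a

theorem Gr.nprod_symbol (n p q : ℕ) (a : fil k x p) (b : fil k x q) :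
    nprod k n (Gr.symbol k x p a) (Gr.symbol k x q b) =
      Gr.symbol k x (p + q) ⟨nprod k n (a : C) (b : C), nprod_mem_fil x n a.2 b.2⟩ :=
  Gr.mul_symbol k x n p q a b

theorem Gr.isAssoc (hC : IsAssoc k C) : IsAssoc k (Gr k x) := by
  intro n m u v w
  induction u using Gr.ind with
  | h0 => simp
  | ha u u' hu hu' =>
    simp only [map_add, LinearMap.add_apply, hu, hu', smul_add, Finset.sum_add_distrib]
  | hs p a =>
  induction v using Gr.ind with
  | h0 => simp
  | ha v v' hv hv' =>
    simp only [map_add, LinearMap.add_apply, hv, hv', smul_add, Finset.sum_add_distrib]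
  | hs q b =>
  induction w using Gr.ind with
  | h0 => simp
  | ha w w' hw hw' =>
    simp only [map_add, hw, hw', smul_add, Finset.sum_add_distrib]
  | hs r c =>
  simp only [Gr.nprod_symbol]
  simp only [← Gr.symbolₗ_apply, ← map_smul, ← map_sum]
  refine Gr.symbol_congr x (add_assoc p q r).symm ?_
  rw [AddSubmonoidClass.coe_finsetSum]
  exact hC n m a b c

theorem D_pow_mem_fil {p : ℕ} {a : C} (ha : a ∈ fil k x p) (s : ℕ) :
    (D k ^ s) a ∈ fil k x p := by
  induction s with
  | zero => exact ha
  | succ s ih => rw [pow_succ', Module.End.mul_apply]; exact D_mem_fil x ih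

theorem Gr.D_pow_symbol (p s : ℕ) (a : fil k x p) : (Conf.D k ^ s) (Gr.symbol k x p a) =
    Gr.symbol k x p ⟨(Conf.D k ^ s) (a : C), D_pow_mem_fil x a.2 s⟩ := by
  induction s with
  | zero => rfl
  | succ s ih =>
    rw [pow_succ', Module.End.mul_apply, ih, Gr.D_symbol']
    exact Gr.symbol_congr x rfl (LinearMap.congr_fun (pow_succ' (Conf.D k) s) (a : C)).symm

/-- If the commutators of the generators have degree at most one, the generators commute in the
associated graded algebra. -/
theorem Gr.gen_comm (h : ∀ n i j, comm k n (x i) (x j) ∈ fil k x 1) (n : ℕ) (i j : ι) :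
    nprod k n (Gr.gen k x i) (Gr.gen k x j) = opp k n (Gr.gen k x i) (Gr.gen k x j) := by
  obtain ⟨M, hM⟩ := ConformalAlgebra.locality (k := k) (x j) (x i)
  obtain ⟨M', hM'⟩ := ConformalAlgebra.locality (k := k) (Gr.gen k x j) (Gr.gen k x i)
  rw [← sub_eq_zero, opp_eq_sum n (max M M') _ _ fun m hm => hM' m (le_trans (le_max_right _ _) hm)]
  simp only [Gr.gen, Gr.nprod_symbol, Gr.D_pow_symbol]
  simp only [← Gr.symbolₗ_apply, ← map_smul, ← map_sum, ← map_sub]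
  refine Gr.symbol_eq_zero x ?_
  rw [AddSubgroupClass.coe_sub, AddSubmonoidClass.coe_finsetSum]
  have h1 := h n i j
  rw [comm, opp_eq_sum n (max M M') _ _ fun m hm => hM m (le_trans (le_max_left _ _) hm)] at h1
  exact h1

theorem Gr.generates : Generates k (Gr.gen k x) := by
  intro S hg hD hn
  rw [eq_top_iff]
  rintro u -
  induction u using Gr.ind with
  | h0 => exact S.zero_mem
  | ha u v hu hv => exact S.add_mem hu hv
  | hs p a =>
  have hmon : ∀ (q : ℕ) (a : C) (ha : IsMonomial k x q a),
      Gr.symbol k x q ⟨a, Submodule.subset_span ⟨q, le_rfl, ha⟩⟩ ∈ S := by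
    intro q a ha
    induction ha with
    | gen i => exact hg i
    | D q a ha ih =>
      have := hD _ ih
      rwa [Gr.D_symbol'] at this
    | nprod n q r a b ha hb iha ihb =>
      have := hn n _ iha _ ihb
      rwa [Gr.nprod_symbol] at this
  have hle : fil k x p ≤ (S.comap (Gr.symbolₗ k x p)).map (fil k x p).subtype := by
    refine Submodule.span_le.2 ?_
    rintro c ⟨q, hq, hc⟩
    refine ⟨⟨c, Submodule.subset_span ⟨q, hq, hc⟩⟩, ?_, rfl⟩
    rw [SetLike.mem_coe, Submodule.mem_comap, Gr.symbolₗ_apply]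
    rcases hq.eq_or_lt with rfl | hlt
    · exact hmon _ c hc
    · rw [Gr.symbol_eq_zero]
      · exact S.zero_mem
      · exact Submodule.subset_span ⟨q, by omega, hc⟩
  obtain ⟨b, hb, hba⟩ := hle a.2
  rw [Submodule.subtype_apply] at hba
  rw [← Subtype.ext hba]
  exact hb

theorem Gr.isCommutative [CharZero k] (hC : IsAssoc k C)
    (h : ∀ n i j, comm k n (x i) (x j) ∈ fil k x 1) : IsCommutative k (Gr k x) :=
  isCommutative_of_generates k (Gr.isAssoc x hC) (Gr.generates x) (Gr.gen_comm x h)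

end GradedFacts

/-! ### The operators of the symmetrized star product -/

section Star

variable (k : Type*) [Field k] (h : Type*) [LieRing h] [LieAlgebra k h]

/-- The Lie bracket as a bilinear map. -/
def lieMul : h →ₗ[k] h →ₗ[k] h := (LieModule.toEnd k h h : h →ₗ[k] h →ₗ[k] h)

variable {h} in
theorem lieMul_apply (x y : h) : lieMul k h x y = ⁅x, y⁆ := rfl

open SymmetricAlgebra (ι)

/-- The algebra homomorphism `s ↦ (s, d s)` from `S(h)` to its square zero extension by `S(h) ⊗ h`,
where `d y = 1 ⊗ y` for `y ∈ h`. -/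
def symDHom : SymmetricAlgebra k h →ₐ[k]
    TrivSqZeroExt (SymmetricAlgebra k h) (SymmetricAlgebra k h ⊗[k] h) :=
  SymmetricAlgebra.lift (A := TrivSqZeroExt (SymmetricAlgebra k h) (SymmetricAlgebra k h ⊗[k] h))
    ((TrivSqZeroExt.inlAlgHom k (SymmetricAlgebra k h)
        (SymmetricAlgebra k h ⊗[k] h)).toLinearMap ∘ₗ ι k h +
      (TrivSqZeroExt.inrHom (SymmetricAlgebra k h)
        (SymmetricAlgebra k h ⊗[k] h)).restrictScalars k ∘ₗ
          TensorProduct.mk k (SymmetricAlgebra k h) h 1)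

/-- The universal derivation of the symmetric algebra, with values in `S(h) ⊗ h`. -/
def symD : SymmetricAlgebra k h →ₗ[k] (SymmetricAlgebra k h ⊗[k] h) :=
  (TrivSqZeroExt.sndHom (SymmetricAlgebra k h) (SymmetricAlgebra k h ⊗[k] h)).restrictScalars k ∘ₗ
    (symDHom k h).toLinearMap

variable {h}

theorem symD_ι (y : h) : symD k h (ι k h y) = 1 ⊗ₜ y := by
  simp [symD, symDHom]

theorem symD_mul (a b : SymmetricAlgebra k h) :
    symD k h (a * b) = a • symD k h b + b • symD k h a := by
  have h1 : (TrivSqZeroExt.fstHom k (SymmetricAlgebra k h) (SymmetricAlgebra k h ⊗[k] h)).comp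
      (symDHom k h) = AlgHom.id k _ := by
    apply SymmetricAlgebra.algHom_ext
    ext y
    simp [symDHom]
  have h2 : ∀ a, (symDHom k h a).fst = a := fun a => DFunLike.congr_fun h1 a
  have h3 : ∀ a, symD k h a = (symDHom k h a).snd := fun a => rfl
  rw [h3, map_mul, TrivSqZeroExt.snd_mul, h2, h2, h3, h3, op_smul_eq_smul]

theorem symD_one : symD k h 1 = 0 := by
  have := symD_mul k (h := h) 1 1
  rw [mul_one, one_smul] at this
  exact left_eq_add.1 this

/-- The contraction `s ⊗ y ↦ B y s`. -/
def contr (B : h →ₗ[k] SymmetricAlgebra k h →ₗ[k] SymmetricAlgebra k h) :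
    (SymmetricAlgebra k h ⊗[k] h) →ₗ[k] SymmetricAlgebra k h :=
  TensorProduct.lift B.flip

theorem contr_tmul (B : h →ₗ[k] SymmetricAlgebra k h →ₗ[k] SymmetricAlgebra k h)
    (s : SymmetricAlgebra k h) (y : h) : contr k B (s ⊗ₜ y) = B y s := rfl

theorem contr_add (B B' : h →ₗ[k] SymmetricAlgebra k h →ₗ[k] SymmetricAlgebra k h) :
    contr k (B + B') = contr k B + contr k B' := by
  ext s y
  simp [contr]

theorem contr_smul (c : k) (B : h →ₗ[k] SymmetricAlgebra k h →ₗ[k] SymmetricAlgebra k h) :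
    contr k (c • B) = c • contr k B := by
  ext s y
  simp [contr]

variable (h)

/-- The operators `T_n(x)` on `S(h)` with `T_n(x) (yᵐ) = m! / (m-n)! (ad y)ⁿ(x) yᵐ⁻ⁿ`: the operator
`T_0(x)` is the multiplication by `x`, and `T_{n+1}(x) = ∑ᵢ T_n([yᵢ, x]) ∂ᵢ` in terms of a basis
`yᵢ` of `h` and the partial derivatives `∂ᵢ`. -/
def starT : ℕ → h →ₗ[k] Module.End k (SymmetricAlgebra k h)
  | 0 => LinearMap.mul k (SymmetricAlgebra k h) ∘ₗ ι k h
  | n + 1 =>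
    { toFun := fun x => contr k (starT n ∘ₗ (lieMul k h).flip x) ∘ₗ symD k h
      map_add' := fun x y => by
        rw [map_add, LinearMap.comp_add, contr_add, LinearMap.add_comp]
      map_smul' := fun c x => by
        rw [map_smul, LinearMap.comp_smul, contr_smul, LinearMap.smul_comp]
        rfl }

variable {h}

theorem starT_zero (x : h) (s : SymmetricAlgebra k h) : starT k h 0 x s = ι k h x * s := rfl

theorem starT_succ (n : ℕ) (x : h) (s : SymmetricAlgebra k h) :
    starT k h (n + 1) x s = contr k (starT k h n ∘ₗ (lieMul k h).flip x) (symD k h s) := rfl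

/-- The divided powers `yᵐ / m!`, which are zero for `m < 0`; integral indices make the formulas for
derivatives uniform. -/
def dp (y : h) (m : ℤ) : SymmetricAlgebra k h :=
  if m < 0 then 0 else (m.toNat.factorial : k)⁻¹ • ι k h y ^ m.toNat

theorem symD_pow (y : h) (n : ℕ) :
    symD k h (ι k h y ^ (n + 1)) = ((n : k) + 1) • ((ι k h y ^ n) ⊗ₜ[k] y) := by
  induction n with
  | zero => simp [symD_ι]
  | succ n ih =>
    rw [pow_succ', symD_mul, ih, symD_ι, smul_comm, TensorProduct.smul_tmul' (ι k h y),
      TensorProduct.smul_tmul' (ι k h y ^ (n + 1)), smul_eq_mul, smul_eq_mul, mul_one,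
      ← pow_succ']
    push_cast
    module

variable [CharZero k]

theorem symD_dp (y : h) (m : ℤ) : symD k h (dp k y m) = (dp k y (m - 1)) ⊗ₜ[k] y := by
  rcases lt_trichotomy m 0 with hm | rfl | hm
  · rw [dp, dp, if_pos hm, if_pos (by omega), map_zero, TensorProduct.zero_tmul]
  · simp [dp, symD_one]
  · obtain ⟨n, rfl⟩ : ∃ n : ℕ, m = n + 1 := ⟨(m - 1).toNat, by omega⟩
    rw [dp, dp, if_neg (by omega), if_neg (by omega), show ((n : ℤ) + 1).toNat = n + 1 by omega,
      show ((n : ℤ) + 1 - 1).toNat = n by omega, map_smul, symD_pow, smul_smul,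
      ← TensorProduct.smul_tmul', Nat.factorial_succ]
    congr 1
    have h1 : (n.factorial : k) ≠ 0 := Nat.cast_ne_zero.2 n.factorial_ne_zero
    have h2 : (n : k) + 1 ≠ 0 := by exact_mod_cast n.succ_ne_zero
    push_cast
    field_simp

theorem starT_dp (n : ℕ) (x y : h) (m : ℤ) :
    starT k h n x (dp k y m) = ι k h ((lieMul k h y ^ n) x) * dp k y (m - n) := by
  induction n generalizing x m with
  | zero => simp [starT_zero]
  | succ n ih =>
    rw [starT_succ, symD_dp, contr_tmul, LinearMap.comp_apply, ih, LinearMap.flip_apply,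
      ← Module.End.mul_apply, ← pow_succ]
    push_cast
    rw [sub_sub, add_comm (1 : ℤ)]

/-- The value of `T_n(x)` on `v yᵐ / m!`. In the first term one of the `n` derivatives in `T_n(x)`
has hit the factor `v`. -/
theorem starT_mul_dp (n : ℕ) (x y v : h) (m : ℤ) : starT k h n x (ι k h v * dp k y m) =
    ι k h (∑ q ∈ Finset.range n, (lieMul k h y ^ (n - 1 - q)) ⁅v, (lieMul k h y ^ q) x⁆) *
      dp k y (m - n + 1) + ι k h ((lieMul k h y ^ n) x) * ι k h v * dp k y (m - n) := by
  induction n generalizing x m with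
  | zero => simp [starT_zero, mul_assoc]
  | succ n ih =>
    rw [starT_succ, symD_mul, symD_dp, symD_ι, map_add, TensorProduct.smul_tmul',
      TensorProduct.smul_tmul', contr_tmul, contr_tmul, LinearMap.comp_apply,
      LinearMap.comp_apply, smul_eq_mul, smul_eq_mul, mul_one, ih, starT_dp, LinearMap.flip_apply,
      LinearMap.flip_apply, lieMul_apply, lieMul_apply, ← lieMul_apply k y x,
      Finset.sum_range_succ', map_add, add_mul]
    have e : ∀ (j : ℕ), (lieMul k h y ^ j) (lieMul k h y x) = (lieMul k h y ^ (j + 1)) x := by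
      intro j
      rw [pow_succ, Module.End.mul_apply]
    simp only [e]
    push_cast
    rw [show m - 1 - n + 1 = m - ((n : ℤ) + 1) + 1 by ring,
      show m - 1 - n = m - ((n : ℤ) + 1) by ring,
      show m - (n : ℤ) = m - ((n : ℤ) + 1) + 1 by ring]
    have e2 : ∀ q, n - 1 - q = n + 1 - 1 - (q + 1) := fun q => by omega
    simp only [e2, pow_zero, Module.End.one_apply, Nat.add_sub_cancel, Nat.sub_zero]
    ring

end Star

section Span

variable {k : Type*} [Field k] [CharZero k]

/-- If all values of a polynomial in one variable with coefficients in `M` lie in a subspace, so do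
the coefficients, as the field is infinite. -/
theorem mem_of_forall_sum_pow_smul_mem {M : Type*} [AddCommGroup M] [Module k M]
    (W : Submodule k M) (N : ℕ) (w : ℕ → M)
    (h : ∀ c : k, ∑ i ∈ Finset.range N, c ^ i • w i ∈ W) (i : ℕ) (hi : i < N) : w i ∈ W := by
  rw [← Submodule.Quotient.mk_eq_zero, ← Module.forall_dual_apply_eq_zero_iff k]
  intro φ
  let p : k[X] := ∑ i ∈ Finset.range N, Polynomial.monomial i (φ (Submodule.Quotient.mk (w i)))
  have hp : p = 0 := by
    refine Polynomial.funext fun c => ?_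
    have h1 := (Submodule.Quotient.mk_eq_zero W).2 (h c)
    have h2 := congrArg φ h1
    rw [← Submodule.mkQ_apply, map_sum, map_sum, map_zero] at h2
    simp only [map_smul, smul_eq_mul, Submodule.mkQ_apply] at h2
    simp only [p, Polynomial.eval_finsetSum, Polynomial.eval_monomial, Polynomial.eval_zero]
    rw [← h2]
    exact Finset.sum_congr rfl fun i _ => mul_comm _ _
  have h3 := congrArg (fun p => Polynomial.coeff p i) hp
  simpa [p, Polynomial.coeff_monomial, hi] using h3

/-- In characteristic zero the symmetric algebra is spanned by the powers of elements of degree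
one. -/
theorem span_pow_eq_top (V : Type*) [AddCommGroup V] [Module k V] :
    Submodule.span k (Set.range fun yn : V × ℕ => SymmetricAlgebra.ι k V yn.1 ^ yn.2) = ⊤ := by
  set W := Submodule.span k (Set.range fun yn : V × ℕ => SymmetricAlgebra.ι k V yn.1 ^ yn.2)
  have h1 : ∀ v : V, ∀ w ∈ W, SymmetricAlgebra.ι k V v * w ∈ W := by
    intro v
    suffices W ≤ W.comap (LinearMap.mulLeft k (SymmetricAlgebra.ι k V v)) from fun w hw => this hw
    refine Submodule.span_le.2 ?_
    rintro _ ⟨⟨y, n⟩, rfl⟩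
    -- `v yⁿ` is, up to a factor, the coefficient of `c` in `(c v + y)ⁿ⁺¹`
    have h2 := mem_of_forall_sum_pow_smul_mem W (n + 1 + 1)
      (fun i => SymmetricAlgebra.ι k V v ^ i * SymmetricAlgebra.ι k V y ^ (n + 1 - i) *
        ((n + 1).choose i : SymmetricAlgebra k V)) (fun c => by
        have h3 : SymmetricAlgebra.ι k V (c • v + y) ^ (n + 1) ∈ W :=
          Submodule.subset_span ⟨(c • v + y, n + 1), rfl⟩
        rw [map_add, map_smul, add_pow] at h3
        convert h3 using 2
        rw [smul_pow, smul_mul_assoc, smul_mul_assoc]) 1 (by omega)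
    have h4 := W.smul_mem ((n : k) + 1)⁻¹ h2
    have h5 : (n : k) + 1 ≠ 0 := by exact_mod_cast n.succ_ne_zero
    rw [SetLike.mem_coe, Submodule.mem_comap, LinearMap.mulLeft_apply]
    convert h4 using 1
    rw [Nat.choose_one_right, mul_comm _ ((n + 1 : ℕ) : SymmetricAlgebra k V), ← nsmul_eq_mul,
      ← Nat.cast_smul_eq_nsmul k, smul_smul, pow_one, Nat.add_sub_cancel]
    push_cast
    rw [inv_mul_cancel₀ h5, one_smul]
  have h2 : ∀ a : SymmetricAlgebra k V, ∀ w ∈ W, a * w ∈ W := by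
    intro a
    induction a using SymmetricAlgebra.induction with
    | algebraMap r =>
      intro w hw
      rw [← Algebra.smul_def]
      exact W.smul_mem r hw
    | ι v => exact h1 v
    | mul a b ha hb =>
      intro w hw
      rw [mul_assoc]
      exact ha _ (hb _ hw)
    | add a b ha hb =>
      intro w hw
      rw [add_mul]
      exact W.add_mem (ha _ hw) (hb _ hw)
  rw [eq_top_iff]
  rintro a -
  have h3 : (1 : SymmetricAlgebra k V) ∈ W := Submodule.subset_span ⟨(0, 0), by simp⟩
  simpa using h2 a 1 h3

end Span

/-! ### Bernoulli numbers and the bracket relation -/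

section Bernoulli

open PowerSeries in
/-- The functional equation of `φ(t) = t / (eᵗ - 1)` that expresses that the operators
`∑ₙ Bₙ / n! T_n(x)` form a representation:
`t (φ(s+t) - φ(t)) φ(s) + s (φ(s+t) - φ(s)) φ(t) + s t φ(s+t) = 0`. -/
theorem bernoulli_functional_equation {A : Type*} [CommRing A] [IsDomain A] [Algebra ℚ A] (s t : A)
    (hs : s ≠ 0) (ht : t ≠ 0) (hu : s + t ≠ 0) :
    C t * ((rescale (s + t) (bernoulliPowerSeries A) - rescale t (bernoulliPowerSeries A)) *
        rescale s (bernoulliPowerSeries A)) +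
      C s * ((rescale (s + t) (bernoulliPowerSeries A) - rescale s (bernoulliPowerSeries A)) *
        rescale t (bernoulliPowerSeries A)) +
      C (s * t) * (X * rescale (s + t) (bernoulliPowerSeries A)) = 0 := by
  have hb : ∀ a : A, rescale a (bernoulliPowerSeries A) * (rescale a (exp A) - 1) = C a * X := by
    intro a
    have := congrArg (rescale a) (bernoulliPowerSeries_mul_exp_sub_one A)
    rwa [map_mul, map_sub, map_one, rescale_X] at this
  have hne : ∀ a : A, a ≠ 0 → rescale a (exp A) - 1 ≠ 0 := by
    intro a ha h0
    have := congrArg (coeff 1) h0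
    simp [coeff_exp, coeff_one] at this
    exact ha this
  have he := exp_mul_exp_eq_exp_add s t
  have h1 := hb s
  have h2 := hb t
  have h3 := hb (s + t)
  -- multiplication by the three factors `exp - 1` turns the claim into an identity of polynomials
  refine (mul_eq_zero.1 ?_).resolve_right
    (mul_ne_zero (mul_ne_zero (hne s hs) (hne t ht)) (hne _ hu))
  rw [map_add] at h3
  rw [map_mul]
  generalize rescale s (bernoulliPowerSeries A) = P at *
  generalize rescale t (bernoulliPowerSeries A) = Q at *
  generalize rescale (s + t) (bernoulliPowerSeries A) = U at *
  rw [← he] at h3 ⊢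
  generalize rescale s (exp A) = es at *
  generalize rescale t (exp A) = et at *
  have e1 : P * U * ((es - 1) * (et - 1) * (es * et - 1)) =
      C s * X * ((C s + C t) * X) * (et - 1) := by rw [← h1, ← h3]; ring
  have e2 : P * Q * ((es - 1) * (et - 1) * (es * et - 1)) =
      C s * X * (C t * X) * (es * et - 1) := by rw [← h1, ← h2]; ring
  have e3 : Q * U * ((es - 1) * (et - 1) * (es * et - 1)) =
      C t * X * ((C s + C t) * X) * (es - 1) := by rw [← h2, ← h3]; ring
  have e4 : U * ((es - 1) * (et - 1) * (es * et - 1)) =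
      (C s + C t) * X * ((es - 1) * (et - 1)) := by rw [← h3]; ring
  linear_combination (C t) * e1 - (C t + C s) * e2 + C s * e3 + C s * C t * X * e4

variable (k : Type*) [Field k]

/-- The coefficients `Bₙ / n!` of `t / (eᵗ - 1)`. -/
def bern (n : ℕ) : k := ((bernoulli n / n.factorial : ℚ) : k)

theorem bern_zero : bern k 0 = 1 := by simp [bern]

open MvPolynomial in
/-- The coefficients of `bernoulli_functional_equation`, divided by `s t`. -/
theorem bern_poly [CharZero k] (n : ℕ) : ∑ ij ∈ Finset.HasAntidiagonal.antidiagonal n,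
      C (bern k ij.1 * bern k ij.2) * ∑ q ∈ Finset.range ij.1, (X 0 + X 1) ^ (ij.1 - 1 - q) *
        (X 0 ^ ij.2 * X 1 ^ q + X 0 ^ q * X 1 ^ ij.2) =
    if n = 0 then 0
    else -(C (bern k (n - 1)) * (X 0 + X 1 : MvPolynomial (Fin 2) k) ^ (n - 1)) := by
  set s : MvPolynomial (Fin 2) k := X 0 with hs
  set t : MvPolynomial (Fin 2) k := X 1 with ht
  have hs0 : s ≠ 0 := X_ne_zero _
  have ht0 : t ≠ 0 := X_ne_zero _
  have hu0 : s + t ≠ 0 := by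
    intro h0
    have := congrArg (MvPolynomial.eval fun i : Fin 2 => if i = 0 then (1 : k) else 0) h0
    simp [hs, ht] at this
  have hB : ∀ (a : MvPolynomial (Fin 2) k) (n : ℕ), PowerSeries.coeff n
      (PowerSeries.rescale a (bernoulliPowerSeries (MvPolynomial (Fin 2) k))) =
        a ^ n * C (bern k n) := by
    intro a n
    rw [PowerSeries.coeff_rescale, bernoulliPowerSeries, PowerSeries.coeff_mk]
    congr 1
  have h := congrArg (PowerSeries.coeff n) (bernoulli_functional_equation s t hs0 ht0 hu0)
  rw [map_add, map_add, PowerSeries.coeff_C_mul, PowerSeries.coeff_C_mul, PowerSeries.coeff_C_mul,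
    PowerSeries.coeff_mul, PowerSeries.coeff_mul, map_zero] at h
  simp only [map_sub, hB] at h
  refine mul_left_cancel₀ (mul_ne_zero hs0 ht0) ?_
  have hg : ∀ (a : MvPolynomial (Fin 2) k) (i : ℕ),
      (∑ q ∈ Finset.range i, a ^ q * (s + t) ^ (i - 1 - q)) * (a - (s + t)) = a ^ i - (s + t) ^ i :=
    fun a i => geom_sum₂_mul a (s + t) i
  have e1 : s * t * ∑ ij ∈ Finset.HasAntidiagonal.antidiagonal n,
      C (bern k ij.1 * bern k ij.2) * ∑ q ∈ Finset.range ij.1, (s + t) ^ (ij.1 - 1 - q) *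
        (s ^ ij.2 * t ^ q + s ^ q * t ^ ij.2) =
      t * ∑ p ∈ Finset.HasAntidiagonal.antidiagonal n,
        ((s + t) ^ p.1 * C (bern k p.1) - t ^ p.1 * C (bern k p.1)) * (s ^ p.2 * C (bern k p.2)) +
      s * ∑ p ∈ Finset.HasAntidiagonal.antidiagonal n,
        ((s + t) ^ p.1 * C (bern k p.1) - s ^ p.1 * C (bern k p.1)) *
          (t ^ p.2 * C (bern k p.2)) := by
    rw [Finset.mul_sum, Finset.mul_sum, Finset.mul_sum, ← Finset.sum_add_distrib]
    refine Finset.sum_congr rfl fun p _ => ?_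
    have e2 : ∑ q ∈ Finset.range p.1,
        (s + t) ^ (p.1 - 1 - q) * (s ^ p.2 * t ^ q + s ^ q * t ^ p.2) =
        s ^ p.2 * (∑ q ∈ Finset.range p.1, t ^ q * (s + t) ^ (p.1 - 1 - q)) +
          t ^ p.2 * (∑ q ∈ Finset.range p.1, s ^ q * (s + t) ^ (p.1 - 1 - q)) := by
      rw [Finset.mul_sum, Finset.mul_sum, ← Finset.sum_add_distrib]
      exact Finset.sum_congr rfl fun q _ => by ring
    rw [e2, map_mul]
    have g1 := hg t p.1
    have g2 := hg s p.1
    linear_combination (-C (bern k p.1) * C (bern k p.2) * s ^ p.2 * t) * g1 -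
      C (bern k p.1) * C (bern k p.2) * t ^ p.2 * s * g2
  rw [e1]
  rcases n with _ | n
  · simp
  · rw [PowerSeries.coeff_succ_X_mul, hB] at h
    rw [if_neg n.succ_ne_zero, Nat.add_sub_cancel]
    linear_combination h

variable {h : Type*} [LieRing h] [LieAlgebra k h]

/-- The identity between iterated brackets that corresponds to `bern_poly`. -/
theorem bern_lie [CharZero k] (x x' y : h) (n : ℕ) : ∑ ij ∈ Finset.HasAntidiagonal.antidiagonal n,
      (bern k ij.1 * bern k ij.2) • ∑ q ∈ Finset.range ij.1, (lieMul k h y ^ (ij.1 - 1 - q))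
        (⁅(lieMul k h y ^ ij.2) x', (lieMul k h y ^ q) x⁆ -
          ⁅(lieMul k h y ^ ij.2) x, (lieMul k h y ^ q) x'⁆) =
    if n = 0 then 0 else bern k (n - 1) • (lieMul k h y ^ (n - 1)) ⁅x, x'⁆ := by
  -- the variables act as `ad y` on the first and on the second factor of the bracket
  let ev : MvPolynomial (Fin 2) k →ₗ[k] h := (MvPolynomial.basisMonomials (Fin 2) k).constr k
    fun m => ⁅(lieMul k h y ^ m 0) x', (lieMul k h y ^ m 1) x⁆
  have hmon : ∀ m, ev (MvPolynomial.monomial m 1) =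
      ⁅(lieMul k h y ^ m 0) x', (lieMul k h y ^ m 1) x⁆ := by
    intro m
    have := (MvPolynomial.basisMonomials (Fin 2) k).constr_basis k
      (fun m => ⁅(lieMul k h y ^ m 0) x', (lieMul k h y ^ m 1) x⁆) m
    rwa [MvPolynomial.coe_basisMonomials] at this
  have hXX : ∀ a b, ev (MvPolynomial.X 0 ^ a * MvPolynomial.X 1 ^ b) =
      ⁅(lieMul k h y ^ a) x', (lieMul k h y ^ b) x⁆ := by
    intro a b
    rw [MvPolynomial.X_pow_eq_monomial, MvPolynomial.X_pow_eq_monomial,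
      MvPolynomial.monomial_mul, mul_one, hmon]
    simp
  have hadd : ∀ F, ev ((MvPolynomial.X 0 + MvPolynomial.X 1) * F) = lieMul k h y (ev F) := by
    intro F
    have : ev ∘ₗ LinearMap.mulLeft k (MvPolynomial.X 0 + MvPolynomial.X 1) =
        lieMul k h y ∘ₗ ev := by
      refine (MvPolynomial.basisMonomials (Fin 2) k).ext fun m => ?_
      rw [MvPolynomial.coe_basisMonomials, LinearMap.comp_apply, LinearMap.comp_apply,
        LinearMap.mulLeft_apply, add_mul, map_add, MvPolynomial.X, MvPolynomial.X,
        MvPolynomial.monomial_mul, MvPolynomial.monomial_mul, mul_one, hmon, hmon, hmon,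
        lieMul_apply, leibniz_lie]
      simp [pow_add, lieMul_apply]
    exact LinearMap.congr_fun this F
  have hpow : ∀ j F, ev ((MvPolynomial.X 0 + MvPolynomial.X 1) ^ j * F) =
      (lieMul k h y ^ j) (ev F) := by
    intro j
    induction j with
    | zero => intro F; simp
    | succ j ih => intro F; rw [pow_succ', mul_assoc, hadd, ih, pow_succ', Module.End.mul_apply]
  have key := congrArg ev (bern_poly k n)
  rw [map_sum] at key
  have e1 : ∀ ij ∈ Finset.HasAntidiagonal.antidiagonal n,
      ev (MvPolynomial.C (bern k ij.1 * bern k ij.2) * ∑ q ∈ Finset.range ij.1,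
        (MvPolynomial.X 0 + MvPolynomial.X 1) ^ (ij.1 - 1 - q) *
          (MvPolynomial.X 0 ^ ij.2 * MvPolynomial.X 1 ^ q +
            MvPolynomial.X 0 ^ q * MvPolynomial.X 1 ^ ij.2)) =
      (bern k ij.1 * bern k ij.2) • ∑ q ∈ Finset.range ij.1, (lieMul k h y ^ (ij.1 - 1 - q))
        (⁅(lieMul k h y ^ ij.2) x', (lieMul k h y ^ q) x⁆ -
          ⁅(lieMul k h y ^ ij.2) x, (lieMul k h y ^ q) x'⁆) := by
    intro ij _
    rw [MvPolynomial.C_mul', map_smul, map_sum]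
    congr 1
    refine Finset.sum_congr rfl fun q _ => ?_
    rw [hpow, map_add, hXX, hXX, ← lie_skew ((lieMul k h y ^ ij.2) x), sub_neg_eq_add]
  rw [Finset.sum_congr rfl e1] at key
  rw [key]
  split_ifs with hn
  · exact map_zero ev
  · have h1 := hXX 0 0
    simp only [pow_zero, mul_one, Module.End.one_apply] at h1
    have h2 := hpow (n - 1) 1
    rw [mul_one, h1] at h2
    rw [map_neg, MvPolynomial.C_mul', map_smul, h2, ← lie_skew x, map_neg, smul_neg]

/-- The bracket relation of the operators `∑ₙ Bₙ / n! T_n(x) ħⁿ`, degree by degree in `ħ`. On the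
powers of `y`, which span the symmetric algebra, the terms of degree two in `x, x'` cancel by
symmetry, and the others are given by `bern_lie`. -/
theorem starT_comm [CharZero k] (n : ℕ) (x x' : h) : ∑ ij ∈ Finset.HasAntidiagonal.antidiagonal n,
      (bern k ij.1 * bern k ij.2) • (starT k h ij.1 x * starT k h ij.2 x' -
        starT k h ij.1 x' * starT k h ij.2 x) =
    if n = 0 then 0 else bern k (n - 1) • starT k h (n - 1) ⁅x, x'⁆ := by
  refine LinearMap.ext_on (span_pow_eq_top (k := k) h) ?_
  rintro _ ⟨⟨y, m⟩, rfl⟩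
  have hdp : SymmetricAlgebra.ι k h y ^ m = (m.factorial : k) • dp k y m := by
    have : (m.factorial : k) ≠ 0 := Nat.cast_ne_zero.2 m.factorial_ne_zero
    rw [dp, if_neg (by omega), Int.toNat_natCast, smul_smul, mul_inv_cancel₀ this, one_smul]
  simp only [hdp, map_smul]
  congr 1
  rw [LinearMap.sum_apply]
  set z := fun i => (lieMul k h y ^ i) x
  set z' := fun i => (lieMul k h y ^ i) x'
  have e1 : ∀ ij ∈ Finset.HasAntidiagonal.antidiagonal n,
      ((bern k ij.1 * bern k ij.2) • (starT k h ij.1 x * starT k h ij.2 x' -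
        starT k h ij.1 x' * starT k h ij.2 x)) (dp k y m) =
      SymmetricAlgebra.ι k h ((bern k ij.1 * bern k ij.2) • ∑ q ∈ Finset.range ij.1,
        (lieMul k h y ^ (ij.1 - 1 - q)) (⁅z' ij.2, z q⁆ - ⁅z ij.2, z' q⁆)) *
          dp k y (m - n + 1) +
      ((bern k ij.1 * bern k ij.2) • (SymmetricAlgebra.ι k h (z ij.1) *
        SymmetricAlgebra.ι k h (z' ij.2) * dp k y (m - n)) -
      (bern k ij.2 * bern k ij.1) • (SymmetricAlgebra.ι k h (z ij.2) *
        SymmetricAlgebra.ι k h (z' ij.1) * dp k y (m - n))) := by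
    intro ij hij
    have hij' : (ij.1 : ℤ) + ij.2 = n := by
      exact_mod_cast Finset.HasAntidiagonal.mem_antidiagonal.1 hij
    rw [LinearMap.smul_apply, LinearMap.sub_apply, Module.End.mul_apply, Module.End.mul_apply,
      starT_dp, starT_dp, starT_mul_dp, starT_mul_dp,
      show (m : ℤ) - ij.2 - ij.1 = m - n by rw [← hij']; ring]
    simp only [map_sub, Finset.sum_sub_distrib, map_smul, z, z', mul_comm (bern k ij.2), smul_sub,
      smul_add, sub_mul, smul_mul_assoc, mul_comm (SymmetricAlgebra.ι k h (_ : h))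
        (SymmetricAlgebra.ι k h (_ : h))]
    rw [mul_comm (SymmetricAlgebra.ι k h ((lieMul k h y ^ ij.1) x'))]
    abel
  rw [Finset.sum_congr rfl e1, Finset.sum_add_distrib, ← Finset.sum_mul, ← map_sum, bern_lie,
    Finset.sum_sub_distrib]
  have hswap := Finset.Nat.sum_antidiagonal_swap (n := n) (f := fun ij : ℕ × ℕ =>
    (bern k ij.1 * bern k ij.2) • (SymmetricAlgebra.ι k h (z ij.1) *
      SymmetricAlgebra.ι k h (z' ij.2) * dp k y (m - n)))
  simp only [Prod.fst_swap, Prod.snd_swap] at hswap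
  rw [hswap, sub_self, add_zero]
  split_ifs with hn
  · simp
  · rw [LinearMap.smul_apply, starT_dp, map_smul, smul_mul_assoc,
      show (m : ℤ) - n + 1 = m - (n - 1 : ℕ) by omega]

section

variable {E : Type*} [Ring E] [Algebra k E]

/-- The series `∑ₙ Bₙ / n! T_n(x) ħⁿ`. For `T = starT` this is, up to rescaling, the operator of
multiplication from the left by `x ∈ h` in the universal enveloping algebra of `h`, transferred to
the symmetric algebra by means of the symmetrization map. -/
def bernSeries (T : ℕ → h →ₗ[k] E) : h →ₗ[k] PowerSeries E where
  toFun x := PowerSeries.mk fun n => bern k n • T n x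
  map_add' x y := by ext n; simp
  map_smul' c x := by ext n; simp [smul_comm c]

theorem bernSeries_coeff (T : ℕ → h →ₗ[k] E) (x : h) (n : ℕ) :
    PowerSeries.coeff n (bernSeries k T x) = bern k n • T n x := by
  simp [bernSeries]

/-- The series form a representation of the Lie algebra with bracket multiplied by `ħ`. -/
theorem bernSeries_lie (T : ℕ → h →ₗ[k] E)
    (hT : ∀ (n : ℕ) (x x' : h), ∑ ij ∈ Finset.HasAntidiagonal.antidiagonal n,
      (bern k ij.1 * bern k ij.2) • (T ij.1 x * T ij.2 x' - T ij.1 x' * T ij.2 x) =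
        if n = 0 then 0 else bern k (n - 1) • T (n - 1) ⁅x, x'⁆) (x x' : h) :
    bernSeries k T x * bernSeries k T x' - bernSeries k T x' * bernSeries k T x =
      PowerSeries.X * bernSeries k T ⁅x, x'⁆ := by
  ext1 n
  rw [map_sub, PowerSeries.coeff_mul, PowerSeries.coeff_mul, ← Finset.sum_sub_distrib]
  simp only [bernSeries_coeff]
  refine Eq.trans (Finset.sum_congr rfl fun ij _ => ?_) ((hT n x x').trans ?_)
  · rw [smul_mul_smul_comm, smul_mul_smul_comm, smul_sub]
  · rcases n with _ | n
    · simp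
    · rw [PowerSeries.coeff_succ_X_mul, bernSeries_coeff, if_neg n.succ_ne_zero,
        Nat.add_sub_cancel]

end

end Bernoulli

/-! ### The affine Lie algebra -/

section Affine

/-- A symmetric invariant bilinear form on a Lie algebra. -/
structure InvForm (k : Type*) [Field k] (g : Type*) [LieRing g] [LieAlgebra k g] where
  form : LinearMap.BilinForm k g
  symm : ∀ a b, form a b = form b a
  inv : ∀ a b c, form ⁅a, b⁆ c = form a ⁅b, c⁆

variable {k : Type*} [Field k] {g : Type*} [LieRing g] [LieAlgebra k g]

/-- The affine Lie algebra `g[t, t⁻¹] ⊕ k e` with the cocycle given by an invariant form; the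
Laurent polynomials are encoded as finitely supported functions. -/
def Affine (_F : InvForm k g) : Type _ := (ℤ →₀ g) × k

variable (F : InvForm k g)

instance : AddCommGroup (Affine F) := inferInstanceAs (AddCommGroup ((ℤ →₀ g) × k))
instance : Module k (Affine F) := inferInstanceAs (Module k ((ℤ →₀ g) × k))

/-- The element `a tᵖ`, as a function of `a` and `p`. -/
def fld : g →ₗ[k] (ℤ → Affine F) :=
  LinearMap.pi fun p => (LinearMap.inl k (ℤ →₀ g) k).comp (Finsupp.lsingle p)

/-- The central element. -/
def cen : Affine F := ((0, 1) : (ℤ →₀ g) × k)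

variable {F} in
theorem Affine.ind {P : Affine F → Prop} (hf : ∀ a p, P (fld F a p)) (hc : ∀ c : k, P (c • cen F))
    (ha : ∀ u v, P u → P v → P (u + v)) (u : Affine F) : P u := by
  obtain ⟨u, c⟩ := u
  let inl : (ℤ →₀ g) →ₗ[k] Affine F := LinearMap.inl k (ℤ →₀ g) k
  have e : ((u, c) : Affine F) = inl u + c • cen F := by
    refine Prod.ext ?_ ?_
    · change u = u + c • 0
      simp
    · change c = 0 + c • 1
      simp
  rw [e]
  refine ha _ _ ?_ (hc c)
  clear e
  induction u using Finsupp.induction_linear with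
  | zero => simpa [fld] using hf 0 0
  | add u v hu hv => rw [map_add]; exact ha _ _ hu hv
  | single p a => exact hf a p

/-- The bracket of `a tⁿ` and `b tᵐ`. -/
def affBil (n m : ℤ) : g →ₗ[k] g →ₗ[k] Affine F :=
  (lieMul k g).compr₂ ((LinearMap.proj (n + m)).comp (fld F)) +
    (if n + m = 0 then (n : k) else 0) • F.form.compr₂ (LinearMap.toSpanSingleton k _ (cen F))

theorem affBil_apply (n m : ℤ) (a b : g) : affBil F n m a b =
    fld F ⁅a, b⁆ (n + m) + ((if n + m = 0 then (n : k) else 0) * F.form a b) • cen F := by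
  rw [affBil, LinearMap.add_apply, LinearMap.add_apply, LinearMap.smul_apply,
    LinearMap.smul_apply, mul_smul]
  rfl

/-- The bracket of the affine Lie algebra as a bilinear map. -/
def affMul : Affine F →ₗ[k] Affine F →ₗ[k] Affine F :=
  (Finsupp.lsum k fun n => (Finsupp.lsum k fun m => (affBil F n m).flip).flip :
    (ℤ →₀ g) →ₗ[k] (ℤ →₀ g) →ₗ[k] Affine F).compl₁₂
      (LinearMap.fst k (ℤ →₀ g) k) (LinearMap.fst k (ℤ →₀ g) k)

theorem affMul_fld (n m : ℤ) (a b : g) : affMul F (fld F a n) (fld F b m) =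
    fld F ⁅a, b⁆ (n + m) + ((if n + m = 0 then (n : k) else 0) * F.form a b) • cen F := by
  rw [← affBil_apply]
  change (Finsupp.lsum k fun n => (Finsupp.lsum k fun m => (affBil F n m).flip).flip :
    (ℤ →₀ g) →ₗ[k] (ℤ →₀ g) →ₗ[k] Affine F) (Finsupp.single n a) (Finsupp.single m b) = _
  simp

theorem affMul_cen_left (u : Affine F) : affMul F (cen F) u = 0 := by
  change (Finsupp.lsum k fun n => (Finsupp.lsum k fun m => (affBil F n m).flip).flip :
    (ℤ →₀ g) →ₗ[k] (ℤ →₀ g) →ₗ[k] Affine F) 0 u.1 = _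
  rw [map_zero, LinearMap.zero_apply]

theorem affMul_cen_right (u : Affine F) : affMul F u (cen F) = 0 := by
  change (Finsupp.lsum k fun n => (Finsupp.lsum k fun m => (affBil F n m).flip).flip :
    (ℤ →₀ g) →ₗ[k] (ℤ →₀ g) →ₗ[k] Affine F) u.1 0 = _
  rw [map_zero]

theorem affMul_skew (u v : Affine F) : affMul F u v = -affMul F v u := by
  induction u using Affine.ind with
  | hc c => rw [map_smul, map_smul, LinearMap.smul_apply, affMul_cen_left, affMul_cen_right]; simp
  | ha u u' hu hu' => rw [map_add, map_add, LinearMap.add_apply, hu, hu']; abel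
  | hf a n =>
  induction v using Affine.ind with
  | hc c => rw [map_smul, map_smul, LinearMap.smul_apply, affMul_cen_left, affMul_cen_right]; simp
  | ha v v' hv hv' => rw [map_add, map_add, LinearMap.add_apply, hv, hv']; abel
  | hf b m =>
    rw [affMul_fld, affMul_fld, ← lie_skew, map_neg, Pi.neg_apply, add_comm m n, F.symm b a]
    split_ifs with h
    · have : (m : k) = -n := by
        rw [eq_neg_iff_add_eq_zero, add_comm]
        exact_mod_cast congrArg (Int.cast : ℤ → k) h
      rw [this]
      module
    · module

theorem affMul_leibniz (u v w : Affine F) :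
    affMul F u (affMul F v w) = affMul F (affMul F u v) w + affMul F v (affMul F u w) := by
  induction u using Affine.ind with
  | hc c =>
    simp only [map_smul, LinearMap.smul_apply, affMul_cen_left, smul_zero, map_zero,
      LinearMap.zero_apply, add_zero]
  | ha u u' hu hu' => simp only [map_add, LinearMap.add_apply, hu, hu']; abel
  | hf a n =>
  induction v using Affine.ind with
  | hc c =>
    simp only [map_smul, LinearMap.smul_apply, affMul_cen_left, affMul_cen_right, smul_zero,
      map_zero, LinearMap.zero_apply, add_zero]
  | ha v v' hv hv' => simp only [map_add, LinearMap.add_apply, hv, hv']; abel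
  | hf b m =>
  induction w using Affine.ind with
  | hc c =>
    simp only [map_smul, affMul_cen_right, smul_zero, map_zero, add_zero]
  | ha w w' hw hw' => simp only [map_add, hw, hw']; abel
  | hf c l =>
    simp only [affMul_fld, map_add, map_smul, LinearMap.add_apply, LinearMap.smul_apply,
      affMul_cen_left, affMul_cen_right, smul_zero, add_zero]
    have h1 : F.form b ⁅a, c⁆ = -F.form a ⁅b, c⁆ := by
      rw [← F.inv, ← F.inv, ← lie_skew a b, map_neg, LinearMap.neg_apply, neg_neg]
    rw [leibniz_lie a b c, map_add, Pi.add_apply, F.inv a b c, h1,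
      show n + (m + l) = n + m + l by ring, show m + (n + l) = n + m + l by ring]
    split_ifs with h
    · push_cast
      module
    · module

instance : Bracket (Affine F) (Affine F) := ⟨fun u v => affMul F u v⟩

theorem affine_lie (u v : Affine F) : ⁅u, v⁆ = affMul F u v := rfl

theorem lie_fld (n m : ℤ) (a b : g) : ⁅fld F a n, fld F b m⁆ =
    fld F ⁅a, b⁆ (n + m) + ((if n + m = 0 then (n : k) else 0) * F.form a b) • cen F :=
  affMul_fld F n m a b

theorem cen_lie (u : Affine F) : ⁅cen F, u⁆ = 0 := affMul_cen_left F u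

theorem lie_cen (u : Affine F) : ⁅u, cen F⁆ = 0 := affMul_cen_right F u

/-- The commutators of the fields `a(z)` and `b(w)` are annihilated by `(z - w)²`. -/
theorem Δ_pow_lie_fld (a b : g) : (Δ k ^ 2) (fun p q => ⁅fld F b q, fld F a p⁆) = 0 := by
  ext p q
  simp only [pow_two, Module.End.mul_apply, Δ_apply, lie_fld]
  rw [show q + (p + 1 + 1) = q + 1 + 1 + p by ring, show q + 1 + (p + 1) = q + 1 + 1 + p by ring]
  split_ifs with h
  · push_cast
    change _ = (0 : Affine F)
    module
  · change _ = (0 : Affine F)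
    module

variable [CharZero k]

instance : LieRing (Affine F) where
  add_lie u v w := by simp [affine_lie]
  lie_add u v w := by simp [affine_lie]
  lie_self u := by
    -- antisymmetry implies alternation, since `2` is invertible
    have h := affMul_skew F u u
    have h2 : (2 : k) • affMul F u u = 0 := by
      rw [two_smul]
      nth_rewrite 1 [h]
      exact neg_add_cancel _
    exact (smul_eq_zero.1 h2).resolve_left two_ne_zero
  leibniz_lie u v w := affMul_leibniz F u v w

instance : LieAlgebra k (Affine F) where
  lie_smul c u v := by simp [affine_lie]

end Affine

/-! ### The locality ideal -/

section LocIdeal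

variable {k : Type*} [Field k] {g : Type*} [LieRing g] [LieAlgebra k g]
  (F : InvForm k g)

open SymmetricAlgebra (ι)

/-- The ideal of the symmetric algebra of the affine Lie algebra that is generated by the
coefficients of `(z - w)³ a(z) b(w)`, `a, b ∈ g`, and by the products with the central element. -/
def locIdeal : Ideal (SymmetricAlgebra k (Affine F)) := Ideal.span
  ({s | ∃ (a b : g) (p q : ℤ), s = (Δ k ^ 3) (fun p q => ι k _ (fld F a p) * ι k _ (fld F b q)) p q}
    ∪ {s | ∃ y, s = ι k _ (cen F) * ι k _ y})

/-- The ideal `locIdeal` as a linear subspace. -/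
def locSub : Submodule k (SymmetricAlgebra k (Affine F)) := (locIdeal F).restrictScalars k

variable {F}

theorem mul_mem_locSub (t : SymmetricAlgebra k (Affine F)) {s : SymmetricAlgebra k (Affine F)}
    (hs : s ∈ locSub F) : t * s ∈ locSub F :=
  (locIdeal F).mul_mem_left t hs

theorem Δ_pow_add_mem {R : Type*} [AddCommGroup R] [Module k R] (Z : Submodule k R) (n : ℕ)
    {f f' : ℤ → ℤ → R} {p q : ℤ} (h : (Δ k ^ n) f p q ∈ Z) (h' : (Δ k ^ n) f' p q ∈ Z) :
    (Δ k ^ n) (fun p q => f p q + f' p q) p q ∈ Z :=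
  (congrFun₂ (map_add (Δ k ^ n) f f') p q).symm ▸ Z.add_mem h h'

theorem cen_mul_mem (y : Affine F) (s : SymmetricAlgebra k (Affine F)) :
    ι k _ y * (ι k _ (cen F) * s) ∈ locSub F := by
  rw [show ι k _ y * (ι k _ (cen F) * s) = s * (ι k _ (cen F) * ι k _ y) by ring]
  exact mul_mem_locSub s (Ideal.subset_span (Or.inr ⟨y, rfl⟩))

theorem Δ_pow_fld_mem (a b : g) (s : SymmetricAlgebra k (Affine F)) (p q : ℤ) :
    (Δ k ^ 3) (fun p q => ι k _ (fld F a p) * (ι k _ (fld F b q) * s)) p q ∈ locSub F := by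
  have h := mul_mem_locSub s (Ideal.subset_span (Or.inl ⟨a, b, p, q, rfl⟩) : _ ∈ locIdeal F)
  rw [← LinearMap.mulLeft_apply (R := k), ← Δ_pow_comp] at h
  simp only [LinearMap.mulLeft_apply] at h
  convert h using 4
  ring

variable [CharZero k]

/-- The operators `T_n(x)` map the multiples of the central element `e` into the ideal. (The element
`e` itself does not belong to the ideal, only its products do.) -/
theorem starT_cen_mul_mem (n : ℕ) (x : Affine F) (s : SymmetricAlgebra k (Affine F)) :
    starT k _ n x (ι k _ (cen F) * s) ∈ locSub F := by
  induction n generalizing x s with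
  | zero => exact cen_mul_mem x s
  | succ n ih =>
    rw [starT_succ, symD_mul, symD_ι, map_add]
    refine (locSub F).add_mem ?_ ?_
    · induction symD k (Affine F) s using TensorProduct.induction_on with
      | zero => rw [smul_zero, map_zero]; exact (locSub F).zero_mem
      | add w w' hw hw' => rw [smul_add, map_add]; exact (locSub F).add_mem hw hw'
      | tmul s y =>
        rw [TensorProduct.smul_tmul', contr_tmul]
        exact ih _ s
    · rw [TensorProduct.smul_tmul', contr_tmul, LinearMap.comp_apply, LinearMap.flip_apply,
        lieMul_apply, cen_lie, map_zero]
      exact (locSub F).zero_mem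

theorem starT_succ_cen (n : ℕ) (s : SymmetricAlgebra k (Affine F)) :
    starT k _ (n + 1) (cen F) s = 0 := by
  have : (lieMul k (Affine F)).flip (cen F) = 0 := by
    ext y
    exact lie_cen F y
  rw [starT_succ, this, LinearMap.comp_zero]
  induction symD k (Affine F) s using TensorProduct.induction_on with
  | zero => exact map_zero _
  | add w w' hw hw' => rw [map_add, hw, hw', add_zero]
  | tmul s y => rfl

theorem starT_cen_fld_mem (n : ℕ) (y : Affine F) (s : SymmetricAlgebra k (Affine F)) :
    starT k _ n (cen F) (ι k _ y * s) ∈ locSub F := by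
  rcases n with _ | n
  · rw [starT_zero, show ι k _ (cen F) * (ι k _ y * s) = ι k _ y * (ι k _ (cen F) * s) by ring]
    exact cen_mul_mem y s
  · rw [starT_succ_cen]
    exact (locSub F).zero_mem

/-- If the coefficients of `(z - w)³ G(a(z), b(w))` lie in a subspace, so do those of
`(z - w)³ G([y, a(z)], b(w))`, provided that the subspace contains all `G(e, b(w))`. -/
theorem Δ_pow_lie_mem {R : Type*} [AddCommGroup R] [Module k R] (Z : Submodule k R)
    (G : Affine F →ₗ[k] Affine F →ₗ[k] R) (b : g)
    (h : ∀ (a : g) (p q : ℤ), (Δ k ^ 3) (fun p q => G (fld F a p) (fld F b q)) p q ∈ Z)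
    (hc : ∀ q, G (cen F) (fld F b q) ∈ Z) (y : Affine F) (a : g) (p q : ℤ) :
    (Δ k ^ 3) (fun p q => G ⁅y, fld F a p⁆ (fld F b q)) p q ∈ Z := by
  induction y using Affine.ind with
  | hc c =>
    simp only [smul_lie, cen_lie, smul_zero, map_zero, LinearMap.zero_apply]
    exact Δ_pow_mem k 3 Z (fun _ _ => Z.zero_mem) p q
  | ha y y' hy hy' =>
    simp only [add_lie, map_add, LinearMap.add_apply]
    exact (congrFun₂ (map_add (Δ k ^ 3) (fun p q => G ⁅y, fld F a p⁆ (fld F b q))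
      (fun p q => G ⁅y', fld F a p⁆ (fld F b q))) p q).symm ▸ Z.add_mem hy hy'
  | hf c l =>
    simp only [lie_fld, map_add, map_smul, LinearMap.add_apply, LinearMap.smul_apply]
    have e := congrFun₂ (map_add (Δ k ^ 3) (fun p q => G (fld F ⁅c, a⁆ (l + p)) (fld F b q))
      (fun p q => ((if l + p = 0 then (l : k) else 0) * F.form c a) • G (cen F) (fld F b q))) p q
    refine e.symm ▸ Z.add_mem ?_ (Δ_pow_mem k 3 Z (fun _ q => Z.smul_mem _ (hc q)) p q)
    have := Δ_pow_shift k 3 l 0 (fun p q => G (fld F ⁅c, a⁆ p) (fld F b q)) p q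
    simp only [add_zero, add_comm _ l] at this
    exact this.symm ▸ h _ _ _

/-- The bilinear map `(x, y) ↦ T_n(x) (y s)`. -/
def starG (n : ℕ) (s : SymmetricAlgebra k (Affine F)) :
    Affine F →ₗ[k] Affine F →ₗ[k] SymmetricAlgebra k (Affine F) :=
  (starT k _ n).compl₂ (LinearMap.mulRight k s ∘ₗ ι k _)

/-- The distribution `T_n(a(z)) b(w) s` is local of order three modulo the ideal. -/
theorem starT_fld_mem (n : ℕ) (a b : g) (s : SymmetricAlgebra k (Affine F)) (p q : ℤ) :
    (Δ k ^ 3) (fun p q => starT k _ n (fld F a p) (ι k _ (fld F b q) * s)) p q ∈ locSub F := by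
  induction n generalizing a b s p q with
  | zero => exact Δ_pow_fld_mem a b s p q
  | succ n ih =>
    simp only [starT_succ, symD_mul, symD_ι, map_add]
    refine Δ_pow_add_mem _ 3 ?_ ?_
    · induction symD k (Affine F) s using TensorProduct.induction_on with
      | zero =>
        simp only [smul_zero, map_zero]
        exact Δ_pow_mem k 3 _ (fun _ _ => (locSub F).zero_mem) p q
      | add w w' hw hw' =>
        simp only [smul_add, map_add]
        exact Δ_pow_add_mem _ 3 hw hw'
      | tmul s y =>
        simp only [TensorProduct.smul_tmul', contr_tmul]
        exact Δ_pow_lie_mem (locSub F) (starG n s) b (fun a p q => ih a b s p q)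
          (fun _ => starT_cen_fld_mem n _ s) y a p q
    · simp only [TensorProduct.smul_tmul', contr_tmul, smul_eq_mul, mul_one]
      have h1 := Δ_pow_comp k 3 ((starT k (Affine F) n).flip s)
        (fun p q => ⁅fld F b q, fld F a p⁆) p q
      rw [Δ_pow_mono k (Δ_pow_lie_fld F a b) (by omega)] at h1
      have h2 : ((starT k (Affine F) n).flip s) ((0 : ℤ → ℤ → Affine F) p q) = 0 := map_zero _
      rw [h2] at h1
      exact h1.symm ▸ (locSub F).zero_mem

theorem starT_lie_fld_mem (n : ℕ) (y : Affine F) (a b : g) (s : SymmetricAlgebra k (Affine F))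
    (p q : ℤ) : (Δ k ^ 3) (fun p q => starT k _ n ⁅y, fld F a p⁆ (ι k _ (fld F b q) * s)) p q ∈
      locSub F :=
  Δ_pow_lie_mem (locSub F) (starG n s) b (fun a p q => starT_fld_mem n a b s p q)
    (fun _ => starT_cen_fld_mem n _ s) y a p q

/-- The operators `T_n(x)` map the generators `(z - w)³ a(z) b(w)` of the ideal, multiplied by any
`s`, into the ideal. The derivative in `T_{n+1}(x)` hits `s`, `b(w)` or `a(z)`; the last two cases
are covered by `starT_lie_fld_mem`. -/
theorem starT_fld_fld_mem (n : ℕ) (x : Affine F) (a b : g) (s : SymmetricAlgebra k (Affine F))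
    (p q : ℤ) : (Δ k ^ 3)
      (fun p q => starT k _ n x (ι k _ (fld F a p) * (ι k _ (fld F b q) * s))) p q ∈ locSub F := by
  induction n generalizing x s with
  | zero =>
    have := Δ_pow_comp k 3 (LinearMap.mulLeft k (ι k _ x))
      (fun p q => ι k _ (fld F a p) * (ι k _ (fld F b q) * s)) p q
    exact this.symm ▸ mul_mem_locSub _ (Δ_pow_fld_mem a b s p q)
  | succ n ih =>
    have hT : ∀ (a b : g) (s : SymmetricAlgebra k (Affine F)) (p q : ℤ), (Δ k ^ 3)
        (fun p q => starT k _ n ⁅fld F a p, x⁆ (ι k _ (fld F b q) * s)) p q ∈ locSub F := by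
      intro a b s p q
      have h1 := Δ_pow_comp k 3 (-LinearMap.id : SymmetricAlgebra k (Affine F) →ₗ[k] _)
        (fun p q => starT k _ n ⁅x, fld F a p⁆ (ι k _ (fld F b q) * s)) p q
      simp only [LinearMap.neg_apply, LinearMap.id_apply, ← LinearMap.neg_apply _ (_ * s),
        ← map_neg, lie_skew] at h1
      rw [h1]
      exact (locSub F).neg_mem (starT_lie_fld_mem n x a b s p q)
    simp only [starT_succ, symD_mul, symD_ι, map_add, smul_add]
    refine Δ_pow_add_mem _ 3 (Δ_pow_add_mem _ 3 ?_ ?_) ?_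
    · induction symD k (Affine F) s using TensorProduct.induction_on with
      | zero =>
        simp only [smul_zero, map_zero]
        exact Δ_pow_mem k 3 _ (fun _ _ => (locSub F).zero_mem) p q
      | add w w' hw hw' =>
        simp only [smul_add, map_add]
        exact Δ_pow_add_mem _ 3 hw hw'
      | tmul s y =>
        simp only [TensorProduct.smul_tmul', contr_tmul]
        exact ih _ s
    · simp only [TensorProduct.smul_tmul', contr_tmul, smul_eq_mul, mul_one]
      have h1 := Δ_pow_flip k 3
        (fun q p => starT k _ n ⁅fld F b q, x⁆ (ι k _ (fld F a p) * s)) p q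
      exact h1.symm ▸ (locSub F).smul_mem _ (hT b a s q p)
    · simp only [TensorProduct.smul_tmul', contr_tmul, smul_eq_mul, mul_one]
      exact hT a b s p q

/-- The ideal is stable under the operators `T_n(x)`. -/
theorem starT_mem (n : ℕ) (x : Affine F) {s : SymmetricAlgebra k (Affine F)} (hs : s ∈ locSub F) :
    starT k _ n x s ∈ locSub F := by
  suffices ∀ t, starT k _ n x (t * s) ∈ locSub F by simpa using this 1
  refine Submodule.span_induction ?_ ?_ ?_ ?_ (hs : s ∈ locIdeal F)
  · rintro _ (⟨a, b, p, q, rfl⟩ | ⟨y, rfl⟩) t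
    · have := Δ_pow_comp k 3 (starT k _ n x ∘ₗ LinearMap.mulLeft k t)
        (fun p q => ι k _ (fld F a p) * ι k _ (fld F b q)) p q
      have e : ∀ p q, (starT k _ n x ∘ₗ LinearMap.mulLeft k t)
          (ι k _ (fld F a p) * ι k _ (fld F b q)) =
            starT k _ n x (ι k _ (fld F a p) * (ι k _ (fld F b q) * t)) := by
        intro p q
        rw [LinearMap.comp_apply, LinearMap.mulLeft_apply, ← mul_assoc (ι k _ (fld F a p)),
          mul_comm t]
      simp only [e] at this
      exact this ▸ starT_fld_fld_mem n x a b t p q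
    · rw [show t * (ι k _ (cen F) * ι k _ y) = ι k _ (cen F) * (t * ι k _ y) by ring]
      exact starT_cen_mul_mem n x _
  · intro t
    rw [mul_zero, map_zero]
    exact (locSub F).zero_mem
  · intro s s' _ _ hs hs' t
    rw [mul_add, map_add]
    exact (locSub F).add_mem (hs t) (hs' t)
  · intro r s _ hs t
    rw [smul_eq_mul, ← mul_assoc]
    exact hs _

/-- The composition of the operators `T_i(a(z))` and `T_j(b(w))` is local of order three modulo the
ideal. -/
theorem starT_starT_mem (i j : ℕ) (a b : g) (s : SymmetricAlgebra k (Affine F)) (p q : ℤ) :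
    (Δ k ^ 3) (fun p q => starT k _ i (fld F a p) (starT k _ j (fld F b q) s)) p q ∈
      locSub F := by
  induction j generalizing b s p q with
  | zero => exact starT_fld_mem i a b s p q
  | succ j ih =>
    simp only [starT_succ]
    induction symD k (Affine F) s using TensorProduct.induction_on with
    | zero =>
      simp only [map_zero]
      exact Δ_pow_mem k 3 _ (fun _ _ => (locSub F).zero_mem) p q
    | add w w' hw hw' =>
      simp only [map_add]
      exact Δ_pow_add_mem _ 3 hw hw'
    | tmul s y =>
      simp only [contr_tmul]
      let G : Affine F →ₗ[k] Affine F →ₗ[k] SymmetricAlgebra k (Affine F) :=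
        ((starT k _ i).compl₂ ((starT k _ j).flip s)).flip
      have h1 : ∀ (b : g) (p q : ℤ), (Δ k ^ 3) (fun q p => G (fld F b q) (fld F a p)) q p ∈
          locSub F := by
        intro b p q
        have h2 := Δ_pow_flip k 3 (fun p q => G (fld F b q) (fld F a p)) q p
        exact h2.symm ▸ (locSub F).smul_mem _ (ih b s p q)
      have h3 := Δ_pow_lie_mem (locSub F) G a (fun b q p => h1 b p q) (fun p => by
        change starT k _ i (fld F a p) (starT k _ j (cen F) s) ∈ locSub F
        rcases j with _ | j
        · exact starT_cen_mul_mem i _ s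
        · rw [starT_succ_cen, map_zero]
          exact (locSub F).zero_mem) y b q p
      have h4 := Δ_pow_flip k 3 (fun q p => G ⁅y, fld F b q⁆ (fld F a p)) p q
      exact h4.symm ▸ (locSub F).smul_mem _ h3

end LocIdeal

/-! ### Laurent series of operators -/

section Laurent

variable (k : Type*) [Field k] (E : Type*) [Ring E] [Algebra k E]

/-- The Laurent series in `ħ` with coefficients in `E` that have poles of order at most `p`. -/
def polar (p : ℕ) : Submodule k (HahnSeries ℤ E) where
  carrier := {f | ∀ m < -(p : ℤ), f.coeff m = 0}
  add_mem' hf hg m hm := by rw [HahnSeries.coeff_add, hf m hm, hg m hm, add_zero]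
  zero_mem' _ _ := rfl
  smul_mem' c f hf m hm := by rw [HahnSeries.coeff_smul, hf m hm, smul_zero]

variable {E}

theorem mul_mem_polar {p q : ℕ} {f f' : HahnSeries ℤ E} (hf : f ∈ polar k E p)
    (hf' : f' ∈ polar k E q) : f * f' ∈ polar k E (p + q) := by
  intro m hm
  rw [HahnSeries.coeff_mul]
  refine Finset.sum_eq_zero fun ij hij => ?_
  have h := (Finset.mem_antidiagonal.1 hij).2.2
  push_cast at hm
  by_cases hi : ij.1 < -(p : ℤ)
  · rw [hf _ hi, zero_mul]
  · rw [hf' ij.2 (by omega), mul_zero]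

/-- Leading coefficients are multiplicative. -/
theorem coeff_mul_of_mem_polar {p q : ℕ} {f f' : HahnSeries ℤ E} (hf : f ∈ polar k E p)
    (hf' : f' ∈ polar k E q) :
    (f * f').coeff (-((p + q : ℕ) : ℤ)) = f.coeff (-(p : ℤ)) * f'.coeff (-(q : ℤ)) := by
  rw [HahnSeries.coeff_mul]
  refine Finset.sum_eq_single (-(p : ℤ), -(q : ℤ)) (fun ij hij hne => ?_) fun h => ?_
  · have h := (Finset.mem_antidiagonal.1 hij).2.2
    push_cast at h
    by_cases hi : ij.1 < -(p : ℤ)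
    · rw [hf _ hi, zero_mul]
    · have : ij.2 < -(q : ℤ) := by
        by_contra hj
        exact hne (Prod.ext (by dsimp only; omega) (by dsimp only; omega))
      rw [hf' _ this, mul_zero]
  · by_cases h1 : f.coeff (-(p : ℤ)) = 0
    · rw [h1, zero_mul]
    · by_cases h2 : f'.coeff (-(q : ℤ)) = 0
      · rw [h2, mul_zero]
      · exact absurd (Finset.mem_antidiagonal.2 ⟨h1, h2, by push_cast; ring⟩) h

theorem coeff_eq_zero_of_mem_polar_pred {p : ℕ} {f : HahnSeries ℤ E} (hp : 0 < p)
    (hf : f ∈ polar k E (p - 1)) : f.coeff (-(p : ℤ)) = 0 :=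
  hf _ (by omega)

theorem single_one_mul_comm (n : ℤ) (f : HahnSeries ℤ E) :
    HahnSeries.single n 1 * f = f * HahnSeries.single n 1 := by
  ext m
  rw [HahnSeries.coeff_single_mul, HahnSeries.coeff_mul_single, one_mul, mul_one]

/-- The map `f ↦ ħ⁻ⁿ f` from power series to Laurent series. -/
def poleSeries (n : ℕ) : PowerSeries E →ₗ[k] HahnSeries ℤ E :=
  LinearMap.mulLeft k (HahnSeries.single (-(n : ℤ)) 1) ∘ₗ
    (HahnSeries.ofPowerSeriesAlg ℤ k).toLinearMap

theorem poleSeries_apply (n : ℕ) (f : PowerSeries E) :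
    poleSeries k n f = HahnSeries.single (-(n : ℤ)) 1 * HahnSeries.ofPowerSeries ℤ E f := rfl

theorem poleSeries_mul (m n : ℕ) (f f' : PowerSeries E) :
    poleSeries k m f * poleSeries k n f' = poleSeries k (m + n) (f * f') := by
  simp only [poleSeries_apply]
  rw [mul_assoc, ← mul_assoc _ (HahnSeries.single _ _), ← single_one_mul_comm, map_mul,
    ← mul_assoc, ← mul_assoc, ← mul_assoc, HahnSeries.single_mul_single, mul_one, mul_assoc,
    mul_assoc]
  push_cast
  rw [neg_add]

theorem poleSeries_X_mul (n : ℕ) (f : PowerSeries E) :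
    poleSeries k (n + 1) (PowerSeries.X * f) = poleSeries k n f := by
  rw [poleSeries_apply, poleSeries_apply, map_mul, HahnSeries.ofPowerSeries_X, ← mul_assoc,
    HahnSeries.single_mul_single, mul_one]
  push_cast
  rw [show -((n : ℤ) + 1) + 1 = -n by ring]

theorem poleSeries_mem_polar (n : ℕ) (f : PowerSeries E) : poleSeries k n f ∈ polar k E n := by
  intro m hm
  rw [poleSeries_apply, HahnSeries.coeff_single_mul, one_mul, HahnSeries.ofPowerSeries_apply,
    HahnSeries.embDomain_of_notMem_range]
  rintro ⟨i, hi⟩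
  have h : (i : ℤ) = m - -(n : ℤ) := hi
  omega

theorem poleSeries_coeff (n : ℕ) (f : PowerSeries E) :
    (poleSeries k n f).coeff (-(n : ℤ)) = PowerSeries.coeff 0 f := by
  rw [poleSeries_apply, HahnSeries.coeff_single_mul, one_mul, sub_self]
  exact_mod_cast HahnSeries.ofPowerSeries_apply_coeff f 0

end Laurent

section Operators

variable {k : Type*} [Field k] {g : Type*} [LieRing g] [LieAlgebra k g] (F : InvForm k g)

open SymmetricAlgebra (ι)

/-- The quotient of the symmetric algebra of the affine Lie algebra by `locIdeal`, as a vector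
space. -/
abbrev LocQuot : Type _ := SymmetricAlgebra k (Affine F) ⧸ locSub F

/-- The algebra of operators on `LocQuot`. -/
def LocOp : Type _ := Module.End k (LocQuot F)

instance : Ring (LocOp F) := inferInstanceAs (Ring (Module.End k (LocQuot F)))
instance : Algebra k (LocOp F) := inferInstanceAs (Algebra k (Module.End k (LocQuot F)))

variable {F} in
/-- Application of an operator to the class of an element of the symmetric algebra. -/
def LocOp.app : LocOp F →ₗ[k] SymmetricAlgebra k (Affine F) →ₗ[k] LocQuot F :=
  LinearMap.lcomp k (LocQuot F) (locSub F).mkQ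

variable {F} in
theorem LocOp.ext {f f' : LocOp F} (h : ∀ s, f.app s = f'.app s) : f = f' :=
  (locSub F).linearMap_qext (LinearMap.ext h)

/-- The operators of multiplication by elements of the symmetric algebra on `LocQuot`. -/
def mulOp : SymmetricAlgebra k (Affine F) →ₗ[k] LocOp F where
  toFun t := (locSub F).mapQ (locSub F) (LinearMap.mulLeft k t) fun _ hs => mul_mem_locSub t hs
  map_add' t t' := LocOp.ext fun s => congrArg (locSub F).mkQ (add_mul t t' s)
  map_smul' c t := LocOp.ext fun s => congrArg (locSub F).mkQ (smul_mul_assoc c t s)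

variable {F}

theorem mulOp_app (t s : SymmetricAlgebra k (Affine F)) :
    (mulOp F t).app s = (locSub F).mkQ (t * s) := rfl

theorem mulOp_mul_app (t : SymmetricAlgebra k (Affine F)) (f : LocOp F)
    (s s' : SymmetricAlgebra k (Affine F)) (h : f.app s = (locSub F).mkQ s') :
    (mulOp F t * f).app s = (mulOp F t).app s' :=
  congrArg (DFunLike.coe (F := Module.End k (LocQuot F)) (mulOp F t)) h

theorem mulOp_mul (t t' : SymmetricAlgebra k (Affine F)) :
    mulOp F (t * t') = mulOp F t * mulOp F t' := by
  refine LocOp.ext fun s => ?_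
  rw [mulOp_mul_app t _ s (t' * s) rfl, mulOp_app, mulOp_app, mul_assoc]

theorem mulOp_seqMul (n : ℕ) (f f' : ℤ → SymmetricAlgebra k (Affine F)) (m : ℤ) :
    mulOp F (seqMul (LinearMap.mul k (SymmetricAlgebra k (Affine F))) n f f' m) =
      seqMul (LinearMap.mul k (LocOp F)) n (fun p => mulOp F (f p)) (fun q => mulOp F (f' q)) m :=
  seqMul_map (LinearMap.mul k (SymmetricAlgebra k (Affine F))) (LinearMap.mul k (LocOp F)) (mulOp F)
    (a' := fun p => mulOp F (f p)) (b' := fun q => mulOp F (f' q))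
    (fun p q => mulOp_mul (f p) (f' q)) n m

theorem mem_locSub_of_mulOp_eq_zero {t : SymmetricAlgebra k (Affine F)} (h : mulOp F t = 0) :
    t ∈ locSub F := by
  have h1 := mulOp_app t 1
  rw [h, mul_one] at h1
  exact (Submodule.Quotient.mk_eq_zero _).1 h1.symm

variable [CharZero k]

variable (F) in
/-- The operators induced by `T_n(x)` on `LocQuot`. -/
def locT (n : ℕ) : Affine F →ₗ[k] LocOp F where
  toFun x := (locSub F).mapQ (locSub F) (starT k _ n x) fun _ hs => starT_mem n x hs
  map_add' x y := LocOp.ext fun s =>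
    congrArg (locSub F).mkQ (LinearMap.congr_fun (map_add (starT k _ n) x y) s)
  map_smul' c x := LocOp.ext fun s =>
    congrArg (locSub F).mkQ (LinearMap.congr_fun (map_smul (starT k _ n) c x) s)

theorem locT_app (n : ℕ) (x : Affine F) (s : SymmetricAlgebra k (Affine F)) :
    (locT F n x).app s = (locSub F).mkQ (starT k _ n x s) := rfl

theorem locT_locT_app (i j : ℕ) (x y : Affine F) (s : SymmetricAlgebra k (Affine F)) :
    (locT F i x * locT F j y).app s = (locSub F).mkQ (starT k _ i x (starT k _ j y s)) := rfl

theorem locT_zero (x : Affine F) : locT F 0 x = mulOp F (ι k _ x) := rfl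

theorem locT_comm (n : ℕ) (x x' : Affine F) : ∑ ij ∈ Finset.HasAntidiagonal.antidiagonal n,
      (bern k ij.1 * bern k ij.2) • (locT F ij.1 x * locT F ij.2 x' -
        locT F ij.1 x' * locT F ij.2 x) =
    if n = 0 then 0 else bern k (n - 1) • locT F (n - 1) ⁅x, x'⁆ := by
  refine LocOp.ext fun s => ?_
  have h := congrArg (locSub F).mkQ (LinearMap.congr_fun (starT_comm k n x x') s)
  rw [LinearMap.sum_apply, map_sum] at h
  rw [map_sum, LinearMap.sum_apply]
  refine Eq.trans (Finset.sum_congr rfl fun ij _ => ?_) (h.trans ?_)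
  · simp only [LinearMap.smul_apply, LinearMap.sub_apply, Module.End.mul_apply, locT_locT_app,
      map_smul, map_sub]
  · split_ifs
    · simp
    · simp only [LinearMap.smul_apply, locT_app, map_smul]

theorem Δ_pow_locT (i j : ℕ) (a b : g) :
    (Δ k ^ 3) (fun p q => locT F i (fld F a p) * locT F j (fld F b q)) = 0 := by
  funext p q
  refine LocOp.ext fun s => ?_
  have h1 := Δ_pow_comp k 3 (LocOp.app.flip s)
    (fun p q => locT F i (fld F a p) * locT F j (fld F b q)) p q
  have h2 := Δ_pow_comp k 3 (locSub F).mkQ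
    (fun p q => starT k _ i (fld F a p) (starT k _ j (fld F b q) s)) p q
  exact h1.symm.trans
    (h2.trans ((Submodule.Quotient.mk_eq_zero _).2 (starT_starT_mem i j a b s p q)))

/-- The values of `T_n(x)` lie in the augmentation ideal, that is, in each subspace that contains
all multiples of elements of degree one. -/
theorem starT_mem_of_mul_mem (Z : Submodule k (SymmetricAlgebra k (Affine F)))
    (h : ∀ y s, ι k _ y * s ∈ Z) (n : ℕ) (x : Affine F) (s : SymmetricAlgebra k (Affine F)) :
    starT k _ n x s ∈ Z := by
  induction n generalizing x s with
  | zero => exact h x s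
  | succ n ih =>
    rw [starT_succ]
    induction symD k (Affine F) s using TensorProduct.induction_on with
    | zero => rw [map_zero]; exact Z.zero_mem
    | add w w' hw hw' => rw [map_add]; exact Z.add_mem hw hw'
    | tmul s y => rw [contr_tmul]; exact ih _ s

theorem locT_cen_mul (i j : ℕ) (y : Affine F) : locT F i (cen F) * locT F j y = 0 := by
  refine LocOp.ext fun s => ?_
  rw [locT_locT_app]
  refine (Submodule.Quotient.mk_eq_zero _).2 ?_
  rcases i with _ | i
  · have := starT_mem_of_mul_mem ((locSub F).comap (LinearMap.mulLeft k (ι k _ (cen F))))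
      (fun z t => starT_cen_fld_mem 0 z t) j y s
    exact this
  · rw [starT_succ_cen]
    exact (locSub F).zero_mem

variable (F) in
/-- The Lie algebra homomorphism `x ↦ ħ⁻¹ ∑ₙ Bₙ / n! T_n(x) ħⁿ` from the affine Lie algebra to the
Laurent series with coefficients in `LocOp`. -/
def opL : Affine F →ₗ[k] HahnSeries ℤ (LocOp F) := poleSeries k 1 ∘ₗ bernSeries k (locT F)

theorem opL_mul_opL (x y : Affine F) : opL F x * opL F y =
    poleSeries k 2 (bernSeries k (locT F) x * bernSeries k (locT F) y) :=
  poleSeries_mul k 1 1 _ _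

theorem opL_lie (x y : Affine F) : opL F x * opL F y - opL F y * opL F x = opL F ⁅x, y⁆ := by
  rw [opL_mul_opL, opL_mul_opL, ← map_sub, bernSeries_lie k _ locT_comm]
  exact poleSeries_X_mul k 1 _

/-- The operators of the affine Lie algebra are local of order three, where the bracket alone would
only give locality of their commutators. -/
theorem opL_local (a b : g) :
    (Δ k ^ 3) (fun p q => opL F (fld F a p) * opL F (fld F b q)) = 0 := by
  funext p q
  simp only [opL_mul_opL]
  have h1 := Δ_pow_comp k 3 (poleSeries k 2)
    (fun p q => bernSeries k (locT F) (fld F a p) * bernSeries k (locT F) (fld F b q)) p q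
  refine h1.trans ((congrArg (poleSeries k 2) ?_).trans (map_zero _))
  ext1 n
  have h2 := Δ_pow_comp k 3 ((PowerSeries.coeff n).restrictScalars k)
    (fun p q => bernSeries k (locT F) (fld F a p) * bernSeries k (locT F) (fld F b q)) p q
  refine h2.symm.trans ?_
  simp only [LinearMap.restrictScalars_apply, PowerSeries.coeff_mul, bernSeries_coeff,
    smul_mul_smul_comm]
  have h3 := congrFun₂ (map_sum (Δ k ^ 3) (fun (ij : ℕ × ℕ) p q => (bern k ij.1 * bern k ij.2) •
    (locT F ij.1 (fld F a p) * locT F ij.2 (fld F b q)))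
      (Finset.HasAntidiagonal.antidiagonal n)) p q
  simp only [Finset.sum_fn, Finset.sum_apply] at h3
  refine h3.trans (Finset.sum_eq_zero fun ij _ => ?_)
  have h4 := congrFun₂ (map_smul (Δ k ^ 3) (bern k ij.1 * bern k ij.2) fun p q =>
    locT F ij.1 (fld F a p) * locT F ij.2 (fld F b q)) p q
  refine h4.trans ?_
  rw [Δ_pow_locT, smul_zero]
  rfl

theorem opL_cen_mul (y : Affine F) : opL F (cen F) * opL F y = 0 := by
  rw [opL_mul_opL]
  refine (congrArg (poleSeries k 2) ?_).trans (map_zero _)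
  ext1 n
  rw [PowerSeries.coeff_mul, map_zero]
  refine Finset.sum_eq_zero fun ij _ => ?_
  rw [bernSeries_coeff, bernSeries_coeff, smul_mul_smul_comm, locT_cen_mul, smul_zero]

theorem opL_mul_cen (y : Affine F) : opL F y * opL F (cen F) = 0 := by
  have h := opL_lie (cen F) y
  rwa [cen_lie, map_zero, opL_cen_mul, zero_sub, neg_eq_zero] at h

theorem opL_mem_polar (x : Affine F) : opL F x ∈ polar k _ 1 := poleSeries_mem_polar k 1 _

theorem opL_coeff (x : Affine F) : (opL F x).coeff (-1) = mulOp F (ι k _ x) := by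
  refine (poleSeries_coeff k 1 _).trans ?_
  rw [bernSeries_coeff, bern_zero, one_smul, locT_zero]

end Operators

/-! ### Modes of the Kac–Moody and current conformal algebras -/

section KacMoodyModes

variable {k : Type*} [Field k] {g : Type*} [LieRing g] [LieAlgebra k g]

theorem KacMoody.ind {form : LinearMap.BilinForm k g} {P : KacMoody form → Prop}
    (hof : ∀ a, P (KacMoody.of form a)) (he : ∀ c : k, P (c • KacMoody.e form))
    (hD : ∀ u, P u → P (D k u)) (ha : ∀ u v, P u → P v → P (u + v)) (u : KacMoody form) : P u := by
  let inl : (k[X] ⊗[k] g) →ₗ[k] KacMoody form := LinearMap.inl k (k[X] ⊗[k] g) k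
  have hinl : ∀ u, P (inl u) := by
    intro u
    induction u using TensorProduct.induction_on with
    | zero => simpa using he 0
    | add u v hu hv => rw [map_add]; exact ha _ _ hu hv
    | tmul f a =>
      induction f using Polynomial.induction_on with
      | C c =>
        rw [show (Polynomial.C c : k[X]) = c • 1 by simp [Polynomial.smul_eq_C_mul],
          TensorProduct.smul_tmul]
        exact hof _
      | add f h hf hh => rw [TensorProduct.add_tmul, map_add]; exact ha _ _ hf hh
      | monomial n c hc =>
        have e : (Polynomial.C c * Polynomial.X ^ (n + 1) : k[X]) =
          Polynomial.X * (Polynomial.C c * Polynomial.X ^ n) := by ring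
        rw [e]
        exact hD _ hc
  obtain ⟨u, c⟩ := u
  have h : ((u, c) : (k[X] ⊗[k] g) × k) = (u, 0) + c • (0, 1) := by simp
  exact Eq.mpr (congrArg P h) (ha _ _ (hinl u) (he c))

theorem KacMoody.D_e (form : LinearMap.BilinForm k g) : D k (KacMoody.e form) = 0 := by
  refine (Prod.ext ?_ rfl : _ = ((0, 0) : (k[X] ⊗[k] g) × k))
  exact map_zero (curD k g)

variable (F : InvForm k g)

/-- The modes of the elements of the Kac–Moody conformal algebra in the affine Lie algebra: those of
`a ∈ g` are `a tᵖ`, the only non-zero mode of `e` is the one with the index `-1`, and `∂` acts as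
`seqD`. -/
def kmModes : KacMoody F.form →ₗ[k] (ℤ → Affine F) :=
  LinearMap.coprod
    (TensorProduct.lift (LinearMap.lcomp k _ (fld F) ∘ₗ
      (Polynomial.aeval (R := k) (seqD k (R := Affine F))).toLinearMap))
    (LinearMap.toSpanSingleton k (ℤ → Affine F) (Pi.single (-1) (cen F)))

theorem kmModes_of (a : g) : kmModes F (KacMoody.of F.form a) = fld F a := by
  refine (LinearMap.congr_fun (LinearMap.coprod_inl _ _) ((1 : k[X]) ⊗ₜ[k] a)).trans ?_
  simp

theorem kmModes_e : kmModes F (KacMoody.e F.form) = Pi.single (-1) (cen F) := by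
  refine (LinearMap.congr_fun (LinearMap.coprod_inr _ _) (1 : k)).trans ?_
  simp

theorem kmModes_D (u : KacMoody F.form) : kmModes F (D k u) = seqD k (kmModes F u) := by
  obtain ⟨u, c⟩ := u
  have h1 : seqD k (Pi.single (-1) (cen F) : ℤ → Affine F) = 0 := by
    funext m
    rw [seqD_apply]
    rcases eq_or_ne m 0 with rfl | hm
    · simp
    · rw [Pi.single_eq_of_ne (by omega)]
      simp
  let T : (k[X] ⊗[k] g) →ₗ[k] (ℤ → Affine F) :=
    TensorProduct.lift (LinearMap.lcomp k _ (fld F) ∘ₗ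
      (Polynomial.aeval (R := k) (seqD k (R := Affine F))).toLinearMap)
  have h2 : T (curD k g u) = seqD k (T u) := by
    induction u using TensorProduct.induction_on with
    | zero => simp
    | add u v hu hv => rw [map_add, map_add, hu, hv, map_add, map_add]
    | tmul f a => simp [T, curD]
  change T (curD k g u) + LinearMap.toSpanSingleton k (ℤ → Affine F) (Pi.single (-1) (cen F)) 0 =
    seqD k (T u + LinearMap.toSpanSingleton k (ℤ → Affine F) (Pi.single (-1) (cen F)) c)
  rw [map_zero, add_zero, h2, map_add, LinearMap.toSpanSingleton_apply, map_smul, h1, smul_zero,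
    add_zero]

variable [CharZero k]

theorem Δ_pow_lie_fld' (a b : g) : (Δ k ^ 2) (fun p q => ⁅fld F a p, fld F b q⁆) = 0 := by
  funext p q
  have h := Δ_pow_comp k 2 (-LinearMap.id : Affine F →ₗ[k] Affine F)
    (fun p q => ⁅fld F b q, fld F a p⁆) p q
  rw [Δ_pow_lie_fld] at h
  simp only [LinearMap.neg_apply, LinearMap.id_apply, lie_skew] at h
  exact h.trans (neg_zero)

/-- The `λ`-bracket of the Kac–Moody conformal algebra is the `n`-product of modes with respect to
the bracket of the affine Lie algebra. -/
theorem kmModes_nprod (n : ℕ) (u v : KacMoody F.form) :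
    kmModes F (nprod k n u v) = seqMul (lieMul k _) n (kmModes F u) (kmModes F v) := by
  induction v using KacMoody.ind generalizing n u with
  | ha v v' hv hv' => rw [map_add, map_add, hv, hv', map_add, map_add]
  | hD v hv =>
    rw [nprod_D_right, map_add, kmModes_D, map_smul, hv, hv, kmModes_D, seqMul_seqD_right]
  | he c =>
    rw [map_smul, nprod_eq_zero_of_D_right (KacMoody.D_e F.form), smul_zero, map_zero, map_smul,
      kmModes_e, map_smul]
    funext m
    have h := seqMul_mem (lieMul k (Affine F)) n ⊥ (a := kmModes F u)
      (b := Pi.single (-1) (cen F)) (fun p q => by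
        rcases eq_or_ne q (-1) with rfl | hq
        · rw [Pi.single_eq_same, lieMul_apply, lie_cen]; exact Submodule.zero_mem _
        · rw [Pi.single_eq_of_ne hq, map_zero]; exact Submodule.zero_mem _) m
    rw [Submodule.mem_bot] at h
    rw [Pi.smul_apply, h, smul_zero]
    rfl
  | hof b =>
    induction u using KacMoody.ind generalizing n with
    | ha u u' hu hu' =>
      rw [map_add, LinearMap.add_apply, map_add, hu, hu', map_add, map_add, LinearMap.add_apply]
    | hD u hu =>
      rw [nprod_D_left, map_neg, map_smul, hu, kmModes_D, seqMul_seqD_left]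
    | he c =>
      rw [map_smul, LinearMap.smul_apply, nprod_eq_zero_of_D_left (KacMoody.D_e F.form), smul_zero,
        map_zero, map_smul, kmModes_e, map_smul, LinearMap.smul_apply]
      funext m
      have h := seqMul_mem (lieMul k (Affine F)) n ⊥ (a := Pi.single (-1) (cen F))
        (b := kmModes F (KacMoody.of F.form b)) (fun p q => by
          rcases eq_or_ne p (-1) with rfl | hq
          · rw [Pi.single_eq_same, lieMul_apply, cen_lie]; exact Submodule.zero_mem _
          · rw [Pi.single_eq_of_ne hq, map_zero]; exact Submodule.zero_mem _) m
      rw [Submodule.mem_bot] at h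
      rw [Pi.smul_apply, h, smul_zero]
      rfl
    | hof a =>
      rw [KacMoody.nprod_of, kmModes_of, kmModes_of]
      funext m
      rcases n with _ | _ | n
      · rw [if_pos rfl, kmModes_of, seqMul_zero, lieMul_apply, lie_fld]
        simp
      · rw [zero_add, if_neg one_ne_zero, if_pos rfl, map_smul, kmModes_e, seqMul_eq,
          Δ_pow_succ k 0]
        simp only [pow_zero, Module.End.one_apply, lieMul_apply, lie_fld, zero_add]
        rw [add_comm 1 m, add_sub_add_left_eq_sub, ← sub_smul]
        rcases eq_or_ne m (-1) with rfl | hm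
        · simp
        · rw [Pi.smul_apply, Pi.single_eq_of_ne hm, if_neg (show m + 1 ≠ 0 by omega)]
          simp
      · rw [if_neg (by omega), if_neg (by omega), map_zero, seqMul_eq]
        have h := Δ_pow_mono k (Δ_pow_lie_fld' F a b) (show 2 ≤ n + 1 + 1 by omega)
        exact (congrFun₂ h 0 m).symm

/-- The fields attached to the elements of the Kac–Moody conformal algebra, with coefficients in
the algebra of Laurent series. -/
def kmField : KacMoody F.form →ₗ[k] (ℤ → HahnSeries ℤ (LocOp F)) :=
  (opL F).compLeft ℤ ∘ₗ kmModes F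

theorem kmField_apply (u : KacMoody F.form) (n : ℤ) : kmField F u n = opL F (kmModes F u n) := rfl

theorem kmField_D (u : KacMoody F.form) : kmField F (D k u) = seqD k (kmField F u) := by
  funext m
  rw [kmField_apply, kmModes_D, seqD_apply, seqD_apply, map_neg, map_smul, kmField_apply]

/-- The fields map the bracket of the Kac–Moody conformal algebra to the commutator of the
`n`-products. -/
theorem kmField_nprod (n : ℕ) (u v : KacMoody F.form) : kmField F (nprod k n u v) =
    seqMul (LinearMap.mul k _) n (kmField F u) (kmField F v) -
      seqMul (LinearMap.mul k _).flip n (kmField F u) (kmField F v) := by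
  funext m
  rw [kmField_apply, kmModes_nprod, seqMul_map (lieMul k _)
    (LinearMap.mul k (HahnSeries ℤ (LocOp F)) - (LinearMap.mul k _).flip) (opL F)
    (a' := kmField F u) (b' := kmField F v)]
  · simp only [seqMul_eq, LinearMap.sub_apply, Pi.sub_apply]
    exact congrFun₂ (map_sub (Δ k ^ n) _ _) 0 m
  · intro p q
    exact (opL_lie _ _).symm

theorem kmField_cen_mul (u : KacMoody F.form) :
    (fun p q => LinearMap.mul k _ (kmField F (KacMoody.e F.form) p) (kmField F u q)) = 0 ∧
    (fun p q => LinearMap.mul k _ (kmField F u p) (kmField F (KacMoody.e F.form) q)) = 0 := by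
  constructor
  · funext p q
    rw [kmField_apply F (KacMoody.e F.form), kmModes_e]
    rcases eq_or_ne p (-1) with rfl | hq
    · rw [Pi.single_eq_same]; exact opL_cen_mul _
    · rw [Pi.single_eq_of_ne hq, map_zero, map_zero]; rfl
  · funext p q
    rw [kmField_apply F (KacMoody.e F.form), kmModes_e]
    rcases eq_or_ne q (-1) with rfl | hq
    · rw [Pi.single_eq_same]; exact opL_mul_cen _
    · rw [Pi.single_eq_of_ne hq, map_zero, map_zero]; rfl

theorem kmField_local_of (a b : g) : (Δ k ^ 3) (fun p q => LinearMap.mul k _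
    (kmField F (KacMoody.of F.form a) p) (kmField F (KacMoody.of F.form b) q)) = 0 := by
  simp only [kmField_apply, kmModes_of]
  exact opL_local a b

/-- The fields are mutually local. -/
theorem kmField_local (u v : KacMoody F.form) : ∃ N, (Δ k ^ N)
    (fun p q => LinearMap.mul k _ (kmField F u p) (kmField F v q)) = 0 := by
  induction v using KacMoody.ind generalizing u with
  | ha v v' hv hv' =>
    simp only [map_add, Pi.add_apply]
    exact exists_Δ_pow_add k (hv u) (hv' u)
  | hD v hv =>
    obtain ⟨N, hN⟩ := hv u
    rw [kmField_D]
    exact ⟨N + 1, (Δ_pow_seqD _ hN).2⟩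
  | he c =>
    refine ⟨0, ?_⟩
    have := congrArg (c • ·) (kmField_cen_mul F u).2
    funext p q
    simp only [map_smul, Pi.smul_apply]
    exact (congrFun₂ this p q).trans (smul_zero c)
  | hof b =>
    induction u using KacMoody.ind with
    | ha v v' hv hv' =>
      simp only [map_add, Pi.add_apply, LinearMap.add_apply]
      exact exists_Δ_pow_add k hv hv'
    | hD v hv =>
      obtain ⟨N, hN⟩ := hv
      rw [kmField_D]
      exact ⟨N + 1, (Δ_pow_seqD _ hN).1⟩
    | he c =>
      refine ⟨0, ?_⟩
      have := congrArg (c • ·) (kmField_cen_mul F (KacMoody.of F.form b)).1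
      funext p q
      simp only [map_smul, Pi.smul_apply, LinearMap.smul_apply]
      exact (congrFun₂ this p q).trans (smul_zero c)
    | hof a => exact ⟨3, kmField_local_of F a b⟩

theorem kmField_gens_local {ι : Type*} (X₁ : Module.Basis ι k g) (i j : Option ι) (n : ℕ)
    (hn : 3 ≤ n) : seqMul (LinearMap.mul k _) n (kmField F (KacMoody.gens F.form X₁ i))
      (kmField F (KacMoody.gens F.form X₁ j)) = 0 := by
  suffices (Δ k ^ 3) (fun p q => LinearMap.mul k _ (kmField F (KacMoody.gens F.form X₁ i) p)
      (kmField F (KacMoody.gens F.form X₁ j) q)) = 0 by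
    funext m
    exact congrFun₂ (Δ_pow_mono k this hn) 0 m
  rcases i with _ | i
  · rw [KacMoody.gens, (kmField_cen_mul F _).1, map_zero]
  · rcases j with _ | j
    · rw [KacMoody.gens, KacMoody.gens, (kmField_cen_mul F _).2, map_zero]
    · exact kmField_local_of F _ _

end KacMoodyModes

section CurModes

variable {k : Type*} [Field k] (g : Type*) [LieRing g] [LieAlgebra k g]

/-- The zero bilinear form. -/
def InvForm.zero : InvForm k g := ⟨0, fun _ _ => rfl, fun _ _ _ => rfl⟩

/-- The inclusion of the current conformal algebra into the Kac–Moody conformal algebra of the zero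
form. -/
def curInl : Cur k g →ₗ[k] KacMoody (InvForm.zero (k := k) g).form :=
  LinearMap.inl k (k[X] ⊗[k] g) k

theorem curInl_isHom : IsHom (curInl (k := k) g) := by
  refine ⟨fun a => rfl, fun n a b => ?_⟩
  refine Eq.trans ?_ (kmMul_apply _ n _ _).symm
  refine Prod.ext rfl ?_
  refine (tensor_ind₂ k g (p := fun u v => kmForm k g 0 n u v = 0) ?_ ?_ ?_ ?_ ?_ a b).symm
  · simp
  · simp
  · intro f a h b
    simp [kmForm_tmul]
  · intro u u' v hu hu'
    rw [map_add, LinearMap.add_apply, hu, hu', add_zero]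
  · intro u v v' hu hu'
    rw [map_add, hu, hu', add_zero]

end CurModes

/-! ### Field representations of the universal envelope -/

section FieldEval

variable {k : Type*} [Field k] {T B : Type*} [Ring B] [Algebra k B]

/-- The value of a monomial, for symbols that stand for sequences of modes. -/
def Word.seqEval (k : Type*) [Field k] {T B : Type*} [Ring B] [Algebra k B] (f : T → ℤ → B) :
    Word T → ℤ → B
  | .of t => f t
  | .D w => seqD k (w.seqEval k f)
  | .mul n u v => seqMul (LinearMap.mul k B) n (u.seqEval k f) (v.seqEval k f)

/-- The values of formal combinations of monomials, for symbols that stand for sequences of modes.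
In contrast to `Free.eval`, no locality is required. -/
def Free.seqEval (f : T → ℤ → B) : Free k T →ₗ[k] (ℤ → B) :=
  Finsupp.linearCombination k (Word.seqEval k f)

theorem Free.seqEval_of (f : T → ℤ → B) (t : T) : Free.seqEval f (Free.of k t) = f t := by
  simp [Free.seqEval, Free.of, Word.seqEval]

theorem Free.seqEval_D (f : T → ℤ → B) (a : Free k T) :
    Free.seqEval f (Free.D k a) = seqD k (Free.seqEval f a) := by
  have : (Free.seqEval f).comp (Free.D k) = (seqD k).comp (Free.seqEval (k := k) f) := by
    refine Finsupp.lhom_ext' fun w => LinearMap.ext_ring ?_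
    simp [Free.seqEval, Free.D, Word.seqEval]
  exact LinearMap.congr_fun this a

theorem Free.seqEval_mul (f : T → ℤ → B) (n : ℕ) (a b : Free k T) :
    Free.seqEval f (Free.mul k n a b) =
      seqMul (LinearMap.mul k B) n (Free.seqEval f a) (Free.seqEval f b) := by
  have : (Free.mul k n).compr₂ (Free.seqEval f) =
      (seqMul (LinearMap.mul k B) n).compl₁₂ (Free.seqEval (k := k) f) (Free.seqEval f) := by
    refine Finsupp.lhom_ext' fun u => LinearMap.ext_ring ?_
    refine Finsupp.lhom_ext' fun v => LinearMap.ext_ring ?_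
    simp [Free.seqEval, Free.mul, Word.seqEval]
  exact LinearMap.congr_fun₂ this a b

theorem Free.seqEval_D_pow (f : T → ℤ → B) (s : ℕ) (a : Free k T) :
    Free.seqEval f ((Free.D k ^ s) a) = (seqD k ^ s) (Free.seqEval f a) := by
  induction s with
  | zero => simp
  | succ s ih => simp only [pow_succ', Module.End.mul_apply, Free.seqEval_D, ih]

theorem Free.ker_seqEval (f : T → ℤ → B) :
    IsIdeal (LinearMap.ker (Free.seqEval (k := k) f)) where
  D_mem a ha := by
    rw [LinearMap.mem_ker] at ha ⊢
    rw [Free.seqEval_D, ha, map_zero]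
  mul_mem_left n a b hb := by
    rw [LinearMap.mem_ker] at hb ⊢
    rw [Free.seqEval_mul, hb, map_zero]
  mul_mem_right n a ha b := by
    rw [LinearMap.mem_ker] at ha ⊢
    rw [Free.seqEval_mul, ha, map_zero, LinearMap.zero_apply]
  sesq_left n a b := by
    rw [LinearMap.mem_ker, map_add, map_smul, Free.seqEval_mul, Free.seqEval_mul, Free.seqEval_D,
      seqMul_seqD_left, neg_add_cancel]
  sesq_right n a b := by
    rw [LinearMap.mem_ker, map_sub, map_add, map_smul, Free.seqEval_mul, Free.seqEval_D,
      Free.seqEval_D, Free.seqEval_mul, Free.seqEval_mul, seqMul_seqD_right, sub_self]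
  assoc n m a b c := by
    rw [LinearMap.mem_ker, map_sub, map_sum, Free.seqEval_mul, Free.seqEval_mul,
      seqMul_assoc _ (fun x y z => (mul_assoc x y z).symm), sub_eq_zero]
    refine Finset.sum_congr rfl fun s _ => ?_
    rw [map_smul, Free.seqEval_mul, Free.seqEval_mul]

variable {L : Type*} [AddCommGroup L] [Module k L] [ConformalAlgebra k L] {ι : Type*} (x : ι → L)
  (N : ι → ι → ℕ)

/-- A map from a Lie conformal algebra `L` to mutually local sequences of modes over an associative
algebra, compatible with `∂` and the commutator, such that the values on the generators `x i`, `x j`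
satisfy the locality `N i j`. -/
structure IsFieldMap (τ : L →ₗ[k] (ℤ → B)) : Prop where
  map_D : ∀ a, τ (D k a) = seqD k (τ a)
  map_nprod : ∀ n a b, τ (nprod k n a b) =
    seqMul (LinearMap.mul k B) n (τ a) (τ b) - seqMul (LinearMap.mul k B).flip n (τ a) (τ b)
  isLocal : ∀ a b, ∃ M, (Δ k ^ M) (fun p q => LinearMap.mul k B (τ a p) (τ b q)) = 0
  loc : ∀ i j, ∀ n ≥ N i j, seqMul (LinearMap.mul k B) n (τ (x i)) (τ (x j)) = 0

variable {x N}

/-- The formal combinations of monomials whose fields vanish contain the defining relations of the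
envelope. Locality of the fields enters through `seqMul_flip_eq_sum`, which identifies the
commutator of conformal algebras with that of fields. -/
theorem IsFieldMap.ker_seqEval [CharZero k] {τ : L →ₗ[k] (ℤ → B)} (hτ : IsFieldMap x N τ) :
    IsEnvelopeIdeal k x N (LinearMap.ker (Free.seqEval (k := k) τ)) :=
  { toIsIdeal := Free.ker_seqEval τ
    of_add := fun a b => by simp [Free.seqEval_of]
    of_smul := fun c a => by simp [Free.seqEval_of]
    of_D := fun a => by simp [Free.seqEval_of, Free.seqEval_D, hτ.map_D]
    of_bracket := fun n M a b h => by
      simp only [LinearMap.mem_ker, Free.seqEval_mul, Free.seqEval_of] at h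
      obtain ⟨K, hK⟩ := hτ.isLocal b a
      rw [LinearMap.mem_ker, map_sub, map_sub, Free.seqEval_mul, Free.seqEval_of, Free.seqEval_of,
        Free.seqEval_of, hτ.map_nprod, seqMul_flip_eq_sum _ hK h, Free.opp, map_sum]
      simp only [map_smul, Free.seqEval_D_pow, Free.seqEval_mul, Free.seqEval_of]
      exact sub_self _
    loc := fun i j n hn => by
      rw [LinearMap.mem_ker, Free.seqEval_mul, Free.seqEval_of, Free.seqEval_of]
      exact hτ.loc i j n hn }

/-- A linear map from an associative conformal algebra to sequences of modes over an associative
algebra which respects `∂` and the `n`-products. -/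
structure IsFieldHom {C : Type*} [AddCommGroup C] [Module k C] [ConformalAlgebra k C]
    (ρ : C →ₗ[k] (ℤ → B)) : Prop where
  map_D : ∀ a, ρ (D k a) = seqD k (ρ a)
  map_nprod : ∀ n a b, ρ (nprod k n a b) = seqMul (LinearMap.mul k B) n (ρ a) (ρ b)

/-- A field map on `L` extends to the universal envelope. The fields need not belong to a single
conformal algebra, hence this is not an instance of the universal property. -/
theorem IsFieldMap.exists_hom [CharZero k] {τ : L →ₗ[k] (ℤ → B)} (hτ : IsFieldMap x N τ)
    (hx : Generates k x) : ∃ ρ : Envelope k N hx →ₗ[k] (ℤ → B), IsFieldHom ρ ∧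
      ∀ a, ρ (Envelope.ofL k N hx a) = τ a := by
  have hle : envelopeIdeal k x N ≤ LinearMap.ker (Free.seqEval (k := k) τ) :=
    sInf_le hτ.ker_seqEval
  refine ⟨(envelopeIdeal k x N).liftQ (Free.seqEval τ) hle, ⟨fun a => ?_, fun n a b => ?_⟩,
    fun a => Free.seqEval_of _ a⟩
  · obtain ⟨a, rfl⟩ := (envelopeIdeal k x N).mkQ_surjective a
    exact Free.seqEval_D τ a
  · obtain ⟨a, rfl⟩ := (envelopeIdeal k x N).mkQ_surjective a
    obtain ⟨b, rfl⟩ := (envelopeIdeal k x N).mkQ_surjective b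
    exact Free.seqEval_mul τ n a b

end FieldEval

section LeadingCoeff

variable {k : Type*} [Field k] {E : Type*} [Ring E] [Algebra k E] {C : Type*} [AddCommGroup C]
  [Module k C] [ConformalAlgebra k C] {ι : Type*} {x : ι → C}
  {ρ : C →ₗ[k] (ℤ → HahnSeries ℤ E)}

/-- If the fields of the generators have poles of order at most one in `ħ`, those of elements of
degree at most `p` have poles of order at most `p`. -/
theorem IsFieldHom.mem_polar (hρ : IsFieldHom ρ) (hx : ∀ i n, ρ (x i) n ∈ polar k E 1)
    {p : ℕ} {a : C} (ha : a ∈ fil k x p) (n : ℤ) : ρ a n ∈ polar k E p := by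
  have hm : ∀ q a, IsMonomial k x q a → ∀ n, ρ a n ∈ polar k E q := by
    intro q a h
    induction h with
    | gen i => exact hx i
    | D p a _ ih =>
      intro n
      rw [hρ.map_D]
      exact (polar k E p).neg_mem ((polar k E p).smul_mem _ (ih _))
    | nprod n p q a b _ _ iha ihb =>
      intro m
      rw [hρ.map_nprod]
      exact seqMul_mem _ n _ (fun i j => mul_mem_polar k (iha i) (ihb j)) m
  have : fil k x p ≤ (polar k E p).comap (LinearMap.proj n ∘ₗ ρ) := by
    refine Submodule.span_le.2 ?_
    rintro a ⟨q, hq, h⟩ m hlt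
    exact hm q a h n m (by omega)
  exact this ha

/-- The coefficients of `ħ⁻ᵖ` of the modes of an element of the component `F_p` of the
filtration. -/
def filCoeff (x : ι → C) (ρ : C →ₗ[k] (ℤ → HahnSeries ℤ E)) (p : ℕ) : fil k x p →ₗ[k] (ℤ → E) :=
  (HahnSeries.coeff.linearMap (-(p : ℤ))).compLeft ℤ ∘ₗ ρ ∘ₗ (fil k x p).subtype

theorem filCoeff_apply (p : ℕ) (a : fil k x p) (n : ℤ) :
    filCoeff x ρ p a n = (ρ (a : C) n).coeff (-(p : ℤ)) := rfl

/-- A representation by Laurent series of order at least `-p` on `F_p` induces, by taking leading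
coefficients, a representation of the associated graded conformal algebra. -/
theorem IsFieldHom.exists_gr (hρ : IsFieldHom ρ) (hx : ∀ i n, ρ (x i) n ∈ polar k E 1) :
    ∃ σ : Gr k x →ₗ[k] (ℤ → E), IsFieldHom σ ∧
      ∀ i n, σ (Gr.gen k x i) n = (ρ (x i) n).coeff (-1) := by
  have h0 : ∀ p, (fil k x (p - 1)).submoduleOf (fil k x p) ≤ LinearMap.ker (filCoeff x ρ p) := by
    intro p a ha
    rw [LinearMap.mem_ker]
    have ha' : (a : C) ∈ fil k x (p - 1) := ha
    funext n
    rw [filCoeff_apply]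
    rcases p with _ | p
    · rw [(Submodule.mem_bot k).1 ((fil_zero (k := k) x).le ha'), map_zero]
      rfl
    · exact coeff_eq_zero_of_mem_polar_pred k p.succ_pos (hρ.mem_polar hx ha' n)
  let σ : Gr k x →ₗ[k] (ℤ → E) := DirectSum.toModule k ℕ (ℤ → E) fun p =>
    Submodule.liftQ _ (filCoeff x ρ p) (h0 p)
  have hσ : ∀ p a, σ (Gr.symbol k x p a) = filCoeff x ρ p a := by
    intro p a
    refine (DirectSum.toModule_lof k p _).trans ?_
    rfl
  refine ⟨σ, ⟨fun u => ?_, fun n u v => ?_⟩, fun i n => ?_⟩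
  · induction u using Gr.ind with
    | h0 => simp only [map_zero]
    | ha u v hu hv => simp only [map_add, hu, hv]
    | hs p a =>
      rw [Gr.D_symbol', hσ, hσ]
      funext n
      rw [filCoeff_apply, hρ.map_D, seqD_apply, seqD_apply, filCoeff_apply]
      rfl
  · refine Gr.ind₂ x (P := fun u v => σ (nprod k n u v) = seqMul (LinearMap.mul k E) n (σ u) (σ v))
      ?_ ?_ ?_ ?_ ?_ u v
    · intro v
      simp only [map_zero, LinearMap.zero_apply]
    · intro u
      simp only [map_zero]
    · intro p a q b
      rw [Gr.nprod_symbol, hσ, hσ, hσ]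
      funext m
      rw [filCoeff_apply, hρ.map_nprod]
      exact seqMul_map (LinearMap.mul k (HahnSeries ℤ E)) (LinearMap.mul k E)
        (HahnSeries.coeff.linearMap (-((p + q : ℕ) : ℤ)))
        (fun i j => coeff_mul_of_mem_polar k (hρ.mem_polar hx a.2 i) (hρ.mem_polar hx b.2 j)) n m
    · intro u u' v hu hu'
      simp only [map_add, LinearMap.add_apply, hu, hu']
    · intro u v v' hu hu'
      simp only [map_add, hu, hu']
  · rw [Gr.gen, hσ]
    rfl

end LeadingCoeff

/-! ### Faithfulness of field representations -/

section CommModes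

variable {k : Type*} [Field k] [CharZero k] {C : Type*} [AddCommGroup C] [Module k C]
  [ConformalAlgebra k C]

/-- The coefficient algebra of a commutative conformal algebra, as a commutative algebra without a
unit. -/
def CommModes (_hA : IsAssoc k C) (_hc : IsCommutative k C) : Type _ := Modes k C

variable (hA : IsAssoc k C) (hc : IsCommutative k C)

instance : AddCommGroup (CommModes hA hc) := inferInstanceAs (AddCommGroup (Modes k C))
instance : Module k (CommModes hA hc) := inferInstanceAs (Module k (Modes k C))

instance : NonUnitalCommRing (CommModes hA hc) where
  mul u v := modeMul k (C := C) u v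
  left_distrib u v w := map_add (modeMul k (C := C) u) v w
  right_distrib u v w := LinearMap.congr_fun (map_add (modeMul k (C := C)) u v) w
  zero_mul u := LinearMap.congr_fun (map_zero (modeMul k (C := C))) u
  mul_zero u := map_zero (modeMul k (C := C) u)
  mul_assoc u v w := (modeMul_assoc k hA u v w).symm
  mul_comm u v := modeMul_comm k hc u v

instance : IsScalarTower k (CommModes hA hc) (CommModes hA hc) :=
  ⟨fun c u v => LinearMap.congr_fun (map_smul (modeMul k (C := C)) c u) v⟩

instance : SMulCommClass k (CommModes hA hc) (CommModes hA hc) :=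
  ⟨fun c u v => (map_smul (modeMul k (C := C) u) c v).symm⟩

/-- The inclusion of the coefficient algebra into its unitization. -/
def modesInr : Modes k C →ₗ[k] Unitization k (CommModes hA hc) :=
  Unitization.inrHom k k (CommModes hA hc)

theorem modesInr_injective : Function.Injective (modesInr hA hc) :=
  Unitization.inr_injective (R := k) (A := CommModes hA hc)

theorem modesInr_mul (u v : Modes k C) :
    modesInr hA hc (modeMul k u v) = modesInr hA hc u * modesInr hA hc v :=
  Unitization.inr_mul k (A := CommModes hA hc) u v

theorem modesInr_seqMul (n : ℕ) (f f' : ℤ → Modes k C) (m : ℤ) :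
    modesInr hA hc (seqMul (modeMul k) n f f' m) =
      seqMul (LinearMap.mul k (Unitization k (CommModes hA hc))) n
        (fun p => modesInr hA hc (f p)) (fun q => modesInr hA hc (f' q)) m :=
  seqMul_map (modeMul k) (LinearMap.mul k (Unitization k (CommModes hA hc))) (modesInr hA hc)
    (a' := fun p => modesInr hA hc (f p)) (b' := fun q => modesInr hA hc (f' q))
    (fun p q => modesInr_mul hA hc (f p) (f' q)) n m

end CommModes

section Symbols

variable {k : Type*} [Field k] {g : Type*} [LieRing g] [LieAlgebra k g]
  {C : Type*} [AddCommGroup C] [Module k C] [ConformalAlgebra k C]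

/-- The map from the affine Lie algebra to the coefficient algebra of `C` that sends `a tᵖ` to the
mode of `γ a` with the index `p`, and the central element to the mode of `ε` with the index `-1`. -/
def affModes (F : InvForm k g) (γ : g →ₗ[k] C) (ε : C) : Affine F →ₗ[k] Modes k C :=
  LinearMap.coprod (Finsupp.lsum k fun p => mode k p ∘ₗ γ)
    (LinearMap.toSpanSingleton k (Modes k C) (mode k (-1) ε))

variable {F : InvForm k g} (γ : g →ₗ[k] C) (ε : C)

theorem affModes_fld (a : g) (p : ℤ) : affModes F γ ε (fld F a p) = mode k p (γ a) := by
  refine (LinearMap.congr_fun (LinearMap.coprod_inl _ _) (Finsupp.single p a)).trans ?_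
  simp

theorem affModes_cen : affModes F γ ε (cen F) = mode k (-1) ε := by
  refine (LinearMap.congr_fun (LinearMap.coprod_inr (Finsupp.lsum k fun p : ℤ => mode k p ∘ₗ γ)
    (LinearMap.toSpanSingleton k (Modes k C) (mode k (-1) ε))) (1 : k)).trans ?_
  simp

variable [CharZero k]

section

variable (hA : IsAssoc k C) (hc : IsCommutative k C)

/-- The extension of `affModes` to the symmetric algebra. -/
def symModes (F : InvForm k g) :
    SymmetricAlgebra k (Affine F) →ₐ[k] Unitization k (CommModes hA hc) :=
  SymmetricAlgebra.lift (modesInr hA hc ∘ₗ affModes F γ ε)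

theorem symModes_ι (u : Affine F) : symModes γ ε hA hc F (SymmetricAlgebra.ι k _ u) =
    modesInr hA hc (affModes F γ ε u) :=
  SymmetricAlgebra.lift_ι_apply (modesInr hA hc ∘ₗ affModes F γ ε) u

theorem symModes_seqMul (n : ℕ) (f f' : ℤ → SymmetricAlgebra k (Affine F)) (m : ℤ) :
    symModes γ ε hA hc F (seqMul (LinearMap.mul k (SymmetricAlgebra k (Affine F))) n f f' m) =
      seqMul (LinearMap.mul k (Unitization k (CommModes hA hc))) n
        (fun p => symModes γ ε hA hc F (f p)) (fun q => symModes γ ε hA hc F (f' q)) m :=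
  seqMul_map (LinearMap.mul k (SymmetricAlgebra k (Affine F)))
    (LinearMap.mul k (Unitization k (CommModes hA hc))) (symModes γ ε hA hc F).toLinearMap
    (a' := fun p => symModes γ ε hA hc F (f p)) (b' := fun q => symModes γ ε hA hc F (f' q))
    (fun p q => map_mul (symModes γ ε hA hc F) (f p) (f' q)) n m

end

variable {γ ε}

/-- The modes of a torsion element annihilate the coefficient algebra. -/
theorem modeMul_eq_zero_of_D (hε : D k ε = 0) (n : ℤ) (u : Modes k C) :
    modeMul k (mode k n ε) u = 0 := by
  induction u using Modes.ind with
  | hm m b =>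
    rw [modeMul_mode k n m ε b 0 fun s _ => nprod_eq_zero_of_D_left hε s b]
    simp
  | ha u v hu hv => rw [map_add, hu, hv, add_zero]

/-- The extension of `affModes` to the symmetric algebra annihilates the locality ideal, if `C`
satisfies the relations that define the ideal. -/
theorem symModes_eq_zero (hA : IsAssoc k C) (hc : IsCommutative k C)
    (hγ : ∀ a b, ∀ n ≥ 3, nprod k n (γ a) (γ b) = 0) (hε : D k ε = 0)
    {s : SymmetricAlgebra k (Affine F)} (hs : s ∈ locSub F) : symModes γ ε hA hc F s = 0 := by
  suffices locIdeal F ≤ RingHom.ker (symModes γ ε hA hc F) from this hs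
  refine Ideal.span_le.2 ?_
  rintro _ (⟨a, b, p, q, rfl⟩ | ⟨y, rfl⟩)
  · refine (RingHom.mem_ker).2 ?_
    have h1 := Δ_pow_comp k 3 (symModes γ ε hA hc F).toLinearMap (fun p q =>
      SymmetricAlgebra.ι k _ (fld F a p) * SymmetricAlgebra.ι k _ (fld F b q)) p q
    refine h1.symm.trans ?_
    simp only [AlgHom.toLinearMap_apply, map_mul, symModes_ι, affModes_fld, ← modesInr_mul]
    rw [Δ_pow_comp, Δ_pow_modeMul k 3 _ _ 3 fun s hs => hγ a b s hs, Finset.sum_eq_zero, map_zero]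
    intro s _
    rw [hγ a b (3 + s) (by omega), map_zero, smul_zero]
  · refine (RingHom.mem_ker).2 ?_
    rw [map_mul, symModes_ι, symModes_ι, ← modesInr_mul, affModes_cen, modeMul_eq_zero_of_D hε,
      map_zero]

/-- A field representation of a commutative conformal algebra `C` in which the modes of the
generators are the multiplication operators by the elements of the affine Lie algebra is faithful,
if these elements are mapped back to the modes of the generators in the coefficient algebra. -/
theorem IsFieldHom.injective (hA : IsAssoc k C) (hc : IsCommutative k C) {I : Type*} {x : I → C}
    (hx : Generates k x)
    (hγ : ∀ a b, ∀ n ≥ 3, nprod k n (γ a) (γ b) = 0) (hε : D k ε = 0)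
    {σ : C →ₗ[k] (ℤ → LocOp F)} (hσ : IsFieldHom σ) (f : I → ℤ → Affine F)
    (hf : ∀ i n, σ (x i) n = mulOp F (SymmetricAlgebra.ι k _ (f i n)))
    (hf' : ∀ i n, affModes F γ ε (f i n) = mode k n (x i)) : Function.Injective σ := by
  let π := symModes γ ε hA hc F
  -- the elements `c` whose modes act as multiplications by elements that `π` maps to the modes of
  -- `c`; they form a conformal subalgebra which contains the generators
  let S : Submodule k C :=
    { carrier := {c | ∃ f : ℤ → SymmetricAlgebra k (Affine F), (∀ n, σ c n = mulOp F (f n)) ∧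
        ∀ n, π (f n) = modesInr hA hc (modes k c n)}
      zero_mem' := ⟨0, fun n => by simp, fun n => by simp⟩
      add_mem' := by
        rintro c c' ⟨f, h1, h2⟩ ⟨f', h1', h2'⟩
        refine ⟨f + f', fun n => ?_, fun n => ?_⟩
        · rw [map_add, Pi.add_apply, Pi.add_apply, map_add, h1, h1']
        · rw [Pi.add_apply, map_add, map_add, Pi.add_apply, map_add, h2, h2']
      smul_mem' := by
        rintro r c ⟨f, h1, h2⟩
        refine ⟨r • f, fun n => ?_, fun n => ?_⟩
        · rw [map_smul, Pi.smul_apply, Pi.smul_apply, map_smul, h1]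
        · rw [Pi.smul_apply, map_smul, map_smul, Pi.smul_apply, map_smul, h2] }
  have hS : S = ⊤ := by
    refine hx S (fun i => ⟨fun n => SymmetricAlgebra.ι k _ (f i n), hf i, fun n => ?_⟩) ?_ ?_
    · rw [modes_apply, ← hf' i n]
      exact symModes_ι γ ε hA hc (f i n)
    · rintro c ⟨f, h1, h2⟩
      refine ⟨seqD k f, fun n => ?_, fun n => ?_⟩
      · rw [hσ.map_D, seqD_apply, seqD_apply, map_neg, map_smul, h1]
      · rw [modes_D, seqD_apply, seqD_apply, map_neg, map_smul, map_neg, map_smul, h2]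
    · rintro n c ⟨f, h1, h2⟩ c' ⟨f', h1', h2'⟩
      refine ⟨seqMul (LinearMap.mul k _) n f f', fun m => ?_, fun m => ?_⟩
      · rw [hσ.map_nprod, mulOp_seqMul, funext h1, funext h1']
      · rw [modes_nprod, symModes_seqMul, modesInr_seqMul, funext h2, funext h2']
  rw [injective_iff_map_eq_zero]
  intro c hc0
  obtain ⟨f, h1, h2⟩ : c ∈ S := hS ▸ Submodule.mem_top
  refine modes_injective k ?_
  rw [map_zero]
  funext n
  refine modesInr_injective hA hc ?_
  rw [← h2, Pi.zero_apply, map_zero]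
  refine symModes_eq_zero hA hc hγ hε (mem_locSub_of_mulOp_eq_zero ?_)
  rw [← h1, hc0]
  rfl

end Symbols

section Homs

variable {k : Type*} [Field k] {C C' C'' : Type*} [AddCommGroup C] [Module k C]
  [ConformalAlgebra k C] [AddCommGroup C'] [Module k C'] [ConformalAlgebra k C']

theorem IsHom.map_D_pow {f : C →ₗ[k] C'} (hf : IsHom f) (s : ℕ) (a : C) :
    f ((D k ^ s) a) = (D k ^ s) (f a) := by
  induction s with
  | zero => rfl
  | succ s ih => rw [pow_succ', pow_succ', Module.End.mul_apply, Module.End.mul_apply, hf.1, ih]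

theorem IsHom.map_opp {f : C →ₗ[k] C'} (hf : IsHom f) (n : ℕ) (a b : C) :
    f (opp k n a b) = opp k n (f a) (f b) := by
  obtain ⟨M, hM⟩ := ConformalAlgebra.locality (k := k) b a
  rw [opp_eq_sum n M a b hM, opp_eq_sum n M (f a) (f b) fun m hm => by
    rw [← hf.2]; exact (congrArg f (hM m hm)).trans (map_zero f), map_sum]
  refine Finset.sum_congr rfl fun s _ => ?_
  rw [map_smul, hf.map_D_pow, hf.2]

theorem IsHom.symm {f : C →ₗ[k] C'} (hf : IsHom f) (h : Function.Bijective f) :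
    IsHom (LinearEquiv.ofBijective f h).symm.toLinearMap := by
  set e := LinearEquiv.ofBijective f h
  have he : ∀ a, e.symm (f a) = a := fun a => e.symm_apply_apply a
  refine ⟨fun a => ?_, fun n a b => ?_⟩
  · obtain ⟨a, rfl⟩ := h.2 a
    change e.symm _ = D k (e.symm _)
    rw [he, ← hf.1, he]
  · obtain ⟨a, rfl⟩ := h.2 a
    obtain ⟨b, rfl⟩ := h.2 b
    change e.symm _ = nprod k n (e.symm _) (e.symm _)
    rw [he, he, ← hf.2, he]

theorem IsFieldHom.comp_isHom {B : Type*} [Ring B] [Algebra k B] {σ : C' →ₗ[k] (ℤ → B)}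
    (hσ : IsFieldHom σ) {f : C →ₗ[k] C'} (hf : IsHom f) : IsFieldHom (σ ∘ₗ f) where
  map_D a := by rw [LinearMap.comp_apply, hf.1, hσ.map_D, LinearMap.comp_apply]
  map_nprod n a b := by
    rw [LinearMap.comp_apply, hf.2, hσ.map_nprod, LinearMap.comp_apply, LinearMap.comp_apply]

/-- The free commutative conformal algebra is generated by its generators, as it is a quotient of
the span of all monomials. -/
theorem ComConf.generates {Y : Type*} (N : Y → Y → ℕ) : Generates k (ComConf.gen k N) := by
  intro S hg hD hn
  have hw : ∀ w : Word Y, (comConfIdeal k N).mkQ (Finsupp.single w 1) ∈ S := by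
    intro w
    induction w with
    | of y => exact hg y
    | D w ih => rw [← Free.D_single]; exact hD _ ih
    | mul n u v hu hv => rw [← Free.mul_single]; exact hn n _ hu _ hv
  rw [eq_top_iff]
  rintro c -
  obtain ⟨a, rfl⟩ := (comConfIdeal k N).mkQ_surjective c
  induction a using Finsupp.induction_linear with
  | zero => rw [map_zero]; exact S.zero_mem
  | add a b ha hb => rw [map_add]; exact S.add_mem ha hb
  | single w c =>
    rw [← mul_one c, ← smul_eq_mul, ← Finsupp.smul_single, map_smul]
    exact S.smul_mem c (hw w)

/-- The generators of `C ⊕ k e`, for generators `x i` of `C`. -/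
def prodGens {ι : Type*} (x : ι → C) : Option ι → C × TrivialLine k
  | none => (0, TrivialLine.e k)
  | some i => (x i, 0)

variable (k C) in
theorem inl_isHom : IsHom (LinearMap.inl k C (TrivialLine k)) :=
  ⟨fun _ => Prod.ext rfl rfl, fun _ _ _ => Prod.ext rfl rfl⟩

theorem prodGens_generates {ι : Type*} {x : ι → C} (hx : Generates k x) :
    Generates k (prodGens (k := k) x) := by
  intro S hg hD hn
  have h1 : S.comap (LinearMap.inl k C (TrivialLine k)) = ⊤ := by
    refine hx _ (fun i => hg (some i)) (fun a ha => ?_) fun n a ha b hb => ?_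
    · rw [Submodule.mem_comap, (inl_isHom k C).1]
      exact hD _ ha
    · rw [Submodule.mem_comap, (inl_isHom k C).2]
      exact hn n _ ha _ hb
  rw [eq_top_iff]
  rintro ⟨u, c⟩ -
  have h2 : (u, (0 : TrivialLine k)) ∈ S := (h1 ▸ Submodule.mem_top :
    u ∈ S.comap (LinearMap.inl k C (TrivialLine k)))
  have h3 : (0, TrivialLine.e k) ∈ S := hg none
  let c' : k := c
  have h4 : (u, (0 : TrivialLine k)) + c' • ((0 : C), TrivialLine.e k) = (u, c) :=
    Prod.ext (by simp) ((zero_add _).trans (mul_one c'))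
  exact h4 ▸ S.add_mem h2 (S.smul_mem c' h3)

theorem prod_isAssoc (hA : IsAssoc k C) : IsAssoc k (C × TrivialLine k) := by
  intro n m a b c
  refine Prod.ext ?_ ?_
  · rw [Prod.fst_sum]
    exact hA n m a.1 b.1 c.1
  · rw [Prod.snd_sum]
    refine Eq.trans ?_ (Finset.sum_eq_zero fun s _ => smul_zero (n.choose s : k)).symm
    rfl

theorem prod_isCommutative [CharZero k] (hA : IsAssoc k C) (hc : IsCommutative k C) {ι : Type*}
    {x : ι → C} (hx : Generates k x) : IsCommutative k (C × TrivialLine k) := by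
  have h0 : D k (prodGens (k := k) x none) = 0 := Prod.ext (map_zero (D k)) rfl
  refine isCommutative_of_generates k (prod_isAssoc hA) (prodGens_generates hx) ?_
  intro n i j
  rcases i with _ | i
  · rw [nprod_eq_zero_of_D_left h0, opp_eq_sum n 0 _ _ fun m _ => nprod_eq_zero_of_D_right h0 m _]
    rfl
  · rcases j with _ | j
    · rw [nprod_eq_zero_of_D_right h0, opp_eq_sum n 0 _ _ fun m _ => nprod_eq_zero_of_D_left h0 m _]
      rfl
    · have h1 := (inl_isHom k C).2 n (x i) (x j)
      rw [hc n, (inl_isHom k C).map_opp] at h1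
      exact h1.symm

end Homs

/-! ### The associated graded algebra of the envelope -/

section GrEnvelope

variable {k : Type*} [Field k] {L : Type*} [AddCommGroup L] [Module k L] [ConformalAlgebra k L]
  {ι : Type*} {x : ι → L} (N : ι → ι → ℕ) (hx : Generates k x)

/-- The generators of the universal envelope. -/
abbrev Envelope.gens (i : ι) : Envelope k N hx := Envelope.ofL k N hx (x i)

theorem Envelope.gr_isAssoc : IsAssoc k (Gr k (Envelope.gens N hx)) :=
  Gr.isAssoc _ (Envelope.isAssoc k N hx)

/-- If the brackets of the generators of `L` are linear in the generators, the associated graded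
algebra of the envelope is commutative. -/
theorem Envelope.gr_isCommutative [CharZero k] (h : ∀ n i j,
    Envelope.ofL k N hx (nprod k n (x i) (x j)) ∈ fil k (Envelope.gens N hx) 1) :
    IsCommutative k (Gr k (Envelope.gens N hx)) := by
  refine Gr.isCommutative _ (Envelope.isAssoc k N hx) fun n i j => ?_
  rw [← (Envelope.ofL_isLieHom k N hx).2]
  exact h n i j

/-- The generators inherit their locality from the envelope. -/
theorem Envelope.gr_gen_local (i j : ι) (n : ℕ) (hn : n ≥ N i j) :
    nprod k n (Gr.gen k (Envelope.gens N hx) i) (Gr.gen k (Envelope.gens N hx) j) = 0 := by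
  rw [Gr.gen, Gr.gen, Gr.nprod_symbol]
  refine Gr.symbol_eq_zero _ ?_
  have h := Envelope.ofL_local k N hx i j n hn
  have h' : nprod k n (Envelope.gens N hx i) (Envelope.gens N hx j) = 0 := h
  have h2 : nprod k n (Envelope.gens N hx i) (Envelope.gens N hx j) ∈
      fil k (Envelope.gens N hx) (1 + 1 - 1) := h'.symm ▸ Submodule.zero_mem _
  exact h2

end GrEnvelope

section GrEquiv

variable {k : Type*} [Field k] {g : Type*} [LieRing g] [LieAlgebra k g]
  {ι : Type*} (X₁ : Module.Basis ι k g)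

/-- The linear map from `g` to the free commutative conformal algebra that sends the basis to the
generators. -/
def basisGen : g →ₗ[k] ComConf k (fun _ _ : ι => 3) := X₁.constr k (ComConf.gen k _)

theorem basisGen_basis (i : ι) : basisGen X₁ (X₁ i) = ComConf.gen k _ i :=
  X₁.constr_basis k _ i

theorem basisGen_local (a b : g) (n : ℕ) (hn : n ≥ 3) :
    nprod k n (basisGen X₁ a) (basisGen X₁ b) = 0 := by
  have h : (nprod k n).compl₁₂ (basisGen X₁) (basisGen X₁) = 0 := by
    refine X₁.ext fun i => X₁.ext fun j => ?_
    rw [LinearMap.compl₁₂_apply, basisGen_basis, basisGen_basis]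
    exact ComConf.gen_local k _ i j n hn
  exact LinearMap.congr_fun₂ h a b

/-- The elements of `g` have degree at most one, as the basis consists of generators. -/
theorem Envelope.ofL_of_mem (form : LinearMap.BilinForm k g) (N : Option ι → Option ι → ℕ) (a : g) :
    Envelope.ofL k N (KacMoody.generates form X₁) (KacMoody.of form a) ∈
      fil k (Envelope.gens N (KacMoody.generates form X₁)) 1 := by
  have h : (⊤ : Submodule k g) ≤ (fil k (Envelope.gens N (KacMoody.generates form X₁)) 1).comap
      (Envelope.ofL k N (KacMoody.generates form X₁) ∘ₗ KacMoody.of form) := by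
    rw [← X₁.span_eq, Submodule.span_le]
    rintro _ ⟨i, rfl⟩
    exact gen_mem_fil (Envelope.gens N (KacMoody.generates form X₁)) (some i)
  exact h (Submodule.mem_top (x := a))

theorem Cur.nprod_of (n : ℕ) (a b : g) : nprod k n (Cur.of k g a) (Cur.of k g b) =
    if n = 0 then Cur.of k g ⁅a, b⁆ else 0 := by
  have h := congrArg (LinearMap.fst k (k[X] ⊗[k] g) k)
    (KacMoody.nprod_of (0 : LinearMap.BilinForm k g) n a b)
  refine Eq.trans ?_ (h.trans ?_)
  · exact (congrArg Prod.fst (kmMul_apply (0 : LinearMap.BilinForm k g) n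
      ((1 : k[X]) ⊗ₜ[k] a, (0 : k)) ((1 : k[X]) ⊗ₜ[k] b, (0 : k)))).symm
  · split_ifs
    · rfl
    · exact congrArg Prod.fst (zero_smul k (KacMoody.e (0 : LinearMap.BilinForm k g)))
    · rfl

variable [CharZero k]

theorem kmField_isFieldMap (F : InvForm k g) :
    IsFieldMap (KacMoody.gens F.form X₁) (fun _ _ => 3) (kmField F) where
  map_D := kmField_D F
  map_nprod := kmField_nprod F
  isLocal := kmField_local F
  loc := kmField_gens_local F X₁

theorem KacMoody.gr_isCommutative (form : LinearMap.BilinForm k g) (N : Option ι → Option ι → ℕ) :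
    IsCommutative k (Gr k (Envelope.gens N (KacMoody.generates form X₁))) := by
  refine Envelope.gr_isCommutative N (KacMoody.generates form X₁) fun n i j => ?_
  rcases i with _ | i
  · rw [KacMoody.gens, nprod_eq_zero_of_D_left (KacMoody.D_e form), map_zero]
    exact Submodule.zero_mem _
  · rcases j with _ | j
    · rw [KacMoody.gens, KacMoody.gens, nprod_eq_zero_of_D_right (KacMoody.D_e form), map_zero]
      exact Submodule.zero_mem _
    · rw [KacMoody.gens, KacMoody.gens, KacMoody.nprod_of]
      split_ifs
      · exact Envelope.ofL_of_mem X₁ form N _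
      · rw [map_smul]
        exact Submodule.smul_mem _ _
          (gen_mem_fil (Envelope.gens N (KacMoody.generates form X₁)) none)
      · rw [map_zero]
        exact Submodule.zero_mem _

theorem Cur.gr_isCommutative (N : ι → ι → ℕ) :
    IsCommutative k (Gr k (Envelope.gens N (Cur.generates X₁))) := by
  refine Envelope.gr_isCommutative N (Cur.generates X₁) fun n i j => ?_
  rw [Cur.nprod_of]
  split_ifs
  · have h : (⊤ : Submodule k g) ≤ (fil k (Envelope.gens N (Cur.generates X₁)) 1).comap
        (Envelope.ofL k N (Cur.generates X₁) ∘ₗ Cur.of k g) := by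
      rw [← X₁.span_eq, Submodule.span_le]
      rintro _ ⟨i, rfl⟩
      exact gen_mem_fil (Envelope.gens N (Cur.generates X₁)) i
    exact h (Submodule.mem_top (x := ⁅X₁ i, X₁ j⁆))
  · rw [map_zero]
    exact Submodule.zero_mem _

/-- A torsion element has at most one non-zero mode. -/
theorem mode_eq_zero_of_D {C : Type*} [AddCommGroup C] [Module k C] [ConformalAlgebra k C] {ε : C}
    (hε : D k ε = 0) {n : ℤ} (hn : n ≠ -1) : mode k n ε = 0 := by
  have h := mode_D k (n + 1) ε
  rw [hε, map_zero, add_sub_cancel_right, zero_eq_neg] at h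
  refine (smul_eq_zero.1 h).resolve_left ?_
  exact_mod_cast fun h => hn (by omega)

/-- A homomorphism extends to the direct sum with the trivial line by any torsion element `z`:
torsion elements are annihilated by all products. -/
theorem exists_hom_prod {C C' : Type*} [AddCommGroup C] [Module k C] [ConformalAlgebra k C]
    [AddCommGroup C'] [Module k C'] [ConformalAlgebra k C'] {θ : C →ₗ[k] C'} (hθ : IsHom θ)
    {z : C'} (hz : D k z = 0) : ∃ Θ : C × TrivialLine k →ₗ[k] C', IsHom Θ ∧
      (∀ u, Θ (u, 0) = θ u) ∧ Θ (0, TrivialLine.e k) = z := by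
  let Θ : C × TrivialLine k →ₗ[k] C' := LinearMap.coprod θ (LinearMap.toSpanSingleton k C' z)
  have hΘ : ∀ u (c : k), Θ (u, c) = θ u + c • z := fun _ _ => rfl
  refine ⟨Θ, ⟨fun ⟨u, (c : k)⟩ => ?_, fun n ⟨u, (c : k)⟩ ⟨v, (d : k)⟩ => ?_⟩, fun u => ?_, ?_⟩
  · refine (hΘ (D k u) (0 : k)).trans ?_
    rw [hΘ, map_add, map_smul, hz, zero_smul, smul_zero, hθ.1]
  · refine (hΘ (nprod k n u v) (0 : k)).trans ?_
    simp only [hΘ, map_add, LinearMap.add_apply, map_smul, LinearMap.smul_apply, hθ.2,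
      nprod_eq_zero_of_D_left hz, nprod_eq_zero_of_D_right hz, smul_zero, zero_smul, add_zero]
  · refine (hΘ u (0 : k)).trans ?_
    rw [zero_smul, add_zero]
  · refine (hΘ 0 (1 : k)).trans ?_
    rw [map_zero, zero_add, one_smul]

/-- A homomorphism from a commutative conformal algebra to the associated graded algebra of an
envelope, which maps generators to generators, is bijective, if the Lie conformal algebra has a
field representation by elements of the affine Lie algebra and these elements are mapped back to
the modes of the generators in the coefficient algebra. -/
theorem bijective_of_isFieldMap {F : InvForm k g} {L : Type*} [AddCommGroup L] [Module k L]
    [ConformalAlgebra k L] {I : Type*} {x : I → L} {N : I → I → ℕ} (hx : Generates k x)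
    {τ : L →ₗ[k] (ℤ → HahnSeries ℤ (LocOp F))} (hτ : IsFieldMap x N τ) (f : I → ℤ → Affine F)
    (hf : ∀ i n, τ (x i) n = opL F (f i n))
    {C : Type*} [AddCommGroup C] [Module k C] [ConformalAlgebra k C] (hA : IsAssoc k C)
    (hc : IsCommutative k C) {c : I → C} (hcg : Generates k c) {γ : g →ₗ[k] C} {ε : C}
    (hγ : ∀ a b, ∀ n ≥ 3, nprod k n (γ a) (γ b) = 0) (hε : D k ε = 0)
    (hf' : ∀ i n, affModes F γ ε (f i n) = mode k n (c i))
    {Θ : C →ₗ[k] Gr k (Envelope.gens N hx)} (hΘ : IsHom Θ)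
    (hΘc : ∀ i, Θ (c i) = Gr.gen k (Envelope.gens N hx) i) : Function.Bijective Θ := by
  -- `ρ` represents the envelope, and its leading coefficients `σ` represent the graded algebra
  obtain ⟨ρ, hρ, hρx⟩ := hτ.exists_hom hx
  obtain ⟨σ, hσ, hσx⟩ := hρ.exists_gr (x := Envelope.gens N hx) fun i n => by
    rw [Envelope.gens, hρx, hf]
    exact opL_mem_polar _
  constructor
  · have h := IsFieldHom.injective hA hc hcg hγ hε (hσ.comp_isHom hΘ) f (fun i n => by
      rw [LinearMap.comp_apply, hΘc, hσx, Envelope.gens, hρx, hf, opL_coeff]) hf'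
    rw [LinearMap.coe_comp] at h
    exact h.of_comp
  · rw [← LinearMap.range_eq_top]
    exact range_eq_top_of_generates (Gr.generates _) hΘ fun i => ⟨c i, hΘc i⟩

theorem exists_gr_kacMoody_equiv (F : InvForm k g) :
    ∃ Φ : Gr k (Envelope.gens (fun _ _ => 3) (KacMoody.generates F.form X₁))
        ≃ₗ[k] ComConf k (fun _ _ : ι => 3) × TrivialLine k,
      IsHom (k := k) Φ.toLinearMap ∧
      (∀ i : ι, Φ (Gr.gen k _ (some i)) = (ComConf.gen k _ i, 0)) ∧
      Φ (Gr.gen k _ none) = (0, TrivialLine.e k) := by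
  let hx := KacMoody.generates F.form X₁
  let C := ComConf k (fun _ _ : ι => 3)
  obtain ⟨θ, ⟨hθ, hθg⟩, -⟩ := ComConf.existsUnique_hom k (fun _ _ : ι => 3)
    (Envelope.gr_isAssoc (fun _ _ => 3) hx) (KacMoody.gr_isCommutative X₁ F.form (fun _ _ => 3))
    (fun i => Gr.gen k _ (some i)) fun i j n hn => Envelope.gr_gen_local _ _ (some i) (some j) n hn
  have hDe : D k (Gr.gen k (Envelope.gens (fun _ _ => 3) hx) none) = 0 := by
    rw [Gr.gen, Gr.D_symbol']
    refine Gr.symbol_eq_zero _ ?_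
    have h := (Envelope.ofL_isLieHom k (fun _ _ => 3) hx).1 (KacMoody.e F.form)
    rw [KacMoody.D_e, map_zero] at h
    have h' : D k (Envelope.gens (fun _ _ => 3) hx none) = 0 := h.symm
    have h2 : D k (Envelope.gens (fun _ _ => 3) hx none) ∈
        fil k (Envelope.gens (fun _ _ => 3) hx) (1 - 1) := h'.symm ▸ Submodule.zero_mem _
    exact h2
  obtain ⟨Θ, hΘ, hΘθ, hΘe⟩ := exists_hom_prod hθ hDe
  have hε : D k ((0, TrivialLine.e k) : C × TrivialLine k) = 0 := Prod.ext (map_zero (D k)) rfl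
  have hΘc : ∀ i, Θ (prodGens (ComConf.gen k (fun _ _ : ι => 3)) i) = Gr.gen k _ i := by
    rintro (_ | i)
    · exact hΘe
    · exact (hΘθ _).trans (hθg i)
  have hbij := bijective_of_isFieldMap hx (kmField_isFieldMap X₁ F)
    (fun i => kmModes F (KacMoody.gens F.form X₁ i)) (fun i n => rfl)
    (prod_isAssoc (ComConf.isAssoc k _))
    (prod_isCommutative (ComConf.isAssoc k _) (ComConf.isCommutative k _) (ComConf.generates _))
    (prodGens_generates (ComConf.generates (fun _ _ : ι => 3)))
    (γ := LinearMap.inl k C (TrivialLine k) ∘ₗ basisGen X₁) (ε := (0, TrivialLine.e k))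
    (fun a b n hn => by
      rw [LinearMap.comp_apply, LinearMap.comp_apply, ← (inl_isHom k C).2,
        basisGen_local X₁ a b n hn, map_zero]) hε
    (by
      rintro (_ | i) n
      · rw [KacMoody.gens, kmModes_e]
        rcases eq_or_ne n (-1) with rfl | hn
        · rw [Pi.single_eq_same, affModes_cen]
          rfl
        · rw [Pi.single_eq_of_ne hn, map_zero]
          exact (mode_eq_zero_of_D hε hn).symm
      · rw [KacMoody.gens, kmModes_of, affModes_fld, LinearMap.comp_apply, basisGen_basis]
        rfl) hΘ hΘc
  refine ⟨(LinearEquiv.ofBijective Θ hbij).symm, hΘ.symm hbij, fun i => ?_, ?_⟩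
  · rw [LinearEquiv.symm_apply_eq]
    exact (hΘc (some i)).symm
  · rw [LinearEquiv.symm_apply_eq]
    exact (hΘc none).symm

theorem curField_isFieldMap : IsFieldMap (fun i => Cur.of k g (X₁ i)) (fun _ _ => 3)
    (kmField (InvForm.zero g) ∘ₗ curInl g) where
  map_D a := by
    rw [LinearMap.comp_apply, (curInl_isHom g).1, kmField_D, LinearMap.comp_apply]
  map_nprod n a b := by
    rw [LinearMap.comp_apply, (curInl_isHom g).2, kmField_nprod, LinearMap.comp_apply,
      LinearMap.comp_apply]
  isLocal a b := kmField_local _ _ _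
  loc i j n hn := kmField_gens_local (InvForm.zero g) X₁ (some i) (some j) n hn

theorem exists_gr_cur_equiv :
    ∃ Ψ : Gr k (Envelope.gens (fun _ _ => 3) (Cur.generates X₁))
        ≃ₗ[k] ComConf k (fun _ _ : ι => 3),
      IsHom (k := k) Ψ.toLinearMap ∧ ∀ i : ι, Ψ (Gr.gen k _ i) = ComConf.gen k _ i := by
  let hx := Cur.generates X₁
  obtain ⟨Θ, ⟨hΘ, hΘc⟩, -⟩ := ComConf.existsUnique_hom k (fun _ _ : ι => 3)
    (Envelope.gr_isAssoc (fun _ _ => 3) hx) (Cur.gr_isCommutative X₁ (fun _ _ => 3))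
    (fun i => Gr.gen k _ i) fun i j n hn => Envelope.gr_gen_local _ _ i j n hn
  have hf : ∀ i n, (kmField (InvForm.zero g) ∘ₗ curInl g) (Cur.of k g (X₁ i)) n =
      opL (InvForm.zero g) (fld (InvForm.zero g) (X₁ i) n) := fun i n =>
    congrArg (opL (InvForm.zero g)) (congrFun (kmModes_of (InvForm.zero g) (X₁ i)) n)
  have hbij := bijective_of_isFieldMap hx (curField_isFieldMap X₁)
    (fun i => fld (InvForm.zero g) (X₁ i))
    hf
    (ComConf.isAssoc k _) (ComConf.isCommutative k _) (ComConf.generates (fun _ _ : ι => 3))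
    (γ := basisGen X₁) (ε := 0) (basisGen_local X₁) (map_zero (D k))
    (fun i n => by rw [affModes_fld, basisGen_basis]) hΘ hΘc
  refine ⟨(LinearEquiv.ofBijective Θ hbij).symm, hΘ.symm hbij, fun i => ?_⟩
  rw [LinearEquiv.symm_apply_eq]
  exact (hΘc i).symm

end GrEquiv

end Conf

theorem mainTheorem2 {k : Type*} [Field k] [CharZero k] {g : Type*} [LieRing g] [LieAlgebra k g]
    {ι : Type*} (X₁ : Module.Basis ι k g) :
    (∀ form : LinearMap.BilinForm k g,
      (∀ a b : g, form a b = form b a) → (∀ a b c : g, form ⁅a, b⁆ c = form a ⁅b, c⁆) →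
      ∃ Φ : Conf.Gr k (fun i : Option ι => Conf.Envelope.ofL k (fun _ _ => 3)
              (Conf.KacMoody.generates form X₁) (Conf.KacMoody.gens form X₁ i))
            ≃ₗ[k] Conf.ComConf k (fun _ _ : ι => 3) × Conf.TrivialLine k,
        Conf.IsHom (k := k) Φ.toLinearMap ∧
        (∀ i : ι, Φ (Conf.Gr.gen k _ (some i)) = (Conf.ComConf.gen k _ i, 0)) ∧
        Φ (Conf.Gr.gen k _ none) = (0, Conf.TrivialLine.e k)) ∧
    ∃ Ψ : Conf.Gr k (fun i : ι => Conf.Envelope.ofL k (fun _ _ => 3)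
            (Conf.Cur.generates X₁) (Conf.Cur.of k g (X₁ i)))
          ≃ₗ[k] Conf.ComConf k (fun _ _ : ι => 3),
      Conf.IsHom (k := k) Ψ.toLinearMap ∧
      ∀ i : ι, Ψ (Conf.Gr.gen k _ i) = Conf.ComConf.gen k _ i :=
  ⟨fun form hs hi => Conf.exists_gr_kacMoody_equiv X₁ ⟨form, hs, hi⟩,
    Conf.exists_gr_cur_equiv X₁⟩
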